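/- There are a randomized query algorithm $\mathcal A$ and an absolute constant $C>0$ with the following property. Let $0<\varepsilon\le 2$, and let $G=(V,E)$ be a finite, nonempty, undirected simple graph without isolated vertices, with adjacency matrix $A$, diagonal degree matrix $D$, and normalized Laplacian $L=I-D^{-1/2}AD^{-1/2}$, whose eigenvalues (with multiplicity) are $\lambda_1,\dots,\lambda_{|V|}\in[0,2]$. The algorithm receives the accuracy $\varepsilon$ (through the integer $\lceil 1/\varepsilon\rceil$) and accesses $G$ only through two kinds of unit-cost queries: one returns a uniformly random vertex of $G$, the other returns, for a vertex already obtained, a uniformly random neighbour of that vertex. All queries have independent answers. It is not told $|V|$; vertex names can only be stored, copied, and compared for equality. Otherwise it is a program of a random access machine whose steps (addition, truncated subtraction, memory access, tests, output, etc.) have unit cost. Then $\mathcal A$ always halts within $\exp(C/\varepsilon)$ steps and makes at most $\exp(C/\varepsilon)$ queries, independently of $|V|$. With probability at least $2/3$ it outputs a discrete probability distribution $q$ on $[0,2]$, given as a list of at most $C/\varepsilon$ weighted point masses with rational locations and weights, such that $$W_1\Big(\frac1{|V|}\sum_{i=1}^{|V|}\delta_{\lambda_i},\; q\Big)\le\varepsilon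 ,$$ where $W_1(\mu,\nu)=\inf_\pi\int|x-y|\,d\pi(x,y)$, the infimum over all couplings $\pi$ of $\mu$ and $\nu$, is the earth mover (Wasserstein-1) distance. -/

import Mathlib

open MeasureTheory
open scoped ENNReal

namespace GraphSpectrum

/-! ### The normalized Laplacian and its spectral distribution -/

section Laplacian

variable {V : Type*} [Fintype V] [DecidableEq V] (G : SimpleGraph V) [DecidableRel G.Adj]

/-- The diagonal matrix `D ^ (-1/2)`, where `D` is the diagonal matrix of vertex degrees. -/
noncomputable def invSqrtDegree : Matrix V V ℝ :=
  Matrix.diagonal fun v => (Real.sqrt (G.degree v))⁻¹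

/-- The normalized Laplacian `I - D ^ (-1/2) A D ^ (-1/2)`. -/
noncomputable def normLaplacian : Matrix V V ℝ :=
  1 - invSqrtDegree G * G.adjMatrix ℝ * invSqrtDegree G

theorem normLaplacian_isHermitian : (normLaplacian G).IsHermitian := by
  have h : (invSqrtDegree G).IsHermitian := Matrix.isHermitian_diagonal _
  have hA : (G.adjMatrix ℝ).IsHermitian := by
    rw [Matrix.IsHermitian, Matrix.conjTranspose_eq_transpose_of_trivial,
      SimpleGraph.transpose_adjMatrix]
  refine Matrix.isHermitian_one.sub ?_
  simp only [Matrix.IsHermitian, Matrix.conjTranspose_mul, h.eq, hA.eq, Matrix.mul_assoc]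

/-- The spectral distribution of the normalized Laplacian: `|V|` equally weighted point masses
at its eigenvalues, listed with multiplicity. -/
noncomputable def spectralMeasure : Measure ℝ :=
  ∑ i : V, ((Fintype.card V : ℝ≥0∞)⁻¹) • Measure.dirac ((normLaplacian_isHermitian G).eigenvalues i)

end Laplacian

/-- Earth mover (Wasserstein-1) distance on the real line: the infimum of the transport cost
over all couplings of `μ` and `ν` (it is `⊤` if there is no coupling). -/
noncomputable def W1 (μ ν : Measure ℝ) : ℝ≥0∞ :=
  ⨅ (π : Measure (ℝ × ℝ)) (_ : π.map Prod.fst = μ) (_ : π.map Prod.snd = ν),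
    ∫⁻ p, ENNReal.ofReal |p.1 - p.2| ∂π

/-! ### Output format: finitely supported distributions with rational data -/

/-- An atom at the rational location `num / den` with unnormalized mass `mass`. -/
structure Atom where
  num : ℕ
  den : ℕ
  mass : ℕ

/-- The location of an atom. -/
noncomputable def Atom.loc (a : Atom) : ℝ := (a.num : ℝ) / (a.den : ℝ)

/-- The total unnormalized mass of a list of atoms. -/
def totalMass (l : List Atom) : ℕ := (l.map Atom.mass).sum

/-- The probability distribution described by a list of atoms, where each atom receives its
share of the total mass. -/
noncomputable def outputMeasure (l : List Atom) : Measure ℝ :=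
  (l.map fun a => ((a.mass : ℝ≥0∞) / (totalMass l : ℝ≥0∞)) • Measure.dirac a.loc).sum

/-- The list describes a genuine probability distribution supported in `[0, 2]`. -/
def IsDistribution (l : List Atom) : Prop :=
  0 < totalMass l ∧ ∀ a ∈ l, 0 < a.den ∧ a.loc ≤ 2

/-! ### The machine model

A random access machine with natural number registers, an indirectly addressed memory, a write-only
output, and registers for vertices. Vertex names are atomic: a vertex register can only be
filled by a query, copied, and compared with another one. Arithmetic is limited to addition and
(truncated) subtraction, so that in `t` steps numbers grow by at most `t` bits.
The only source of randomness is the answers of the two kinds of queries. -/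

/-- Programs. All arguments of type `ℕ`, except for the constant `c` of `const`, are indices
of registers. -/
inductive Prog : Type
  /-- `r_x := c` -/
  | const (x c : ℕ)
  /-- `r_x := r_y + r_z` -/
  | add (x y z : ℕ)
  /-- `r_x := r_y - r_z`, truncated at zero -/
  | sub (x y z : ℕ)
  /-- `r_x := mem[r_y]` -/
  | load (x y : ℕ)
  /-- `mem[r_x] := r_y` -/
  | store (x y : ℕ)
  /-- append the atom `(r_x, r_y, r_z)` to the output -/
  | emit (x y z : ℕ)
  /-- query: `v_a :=` a uniformly random vertex -/
  | randVertex (a : ℕ)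
  /-- query: `v_a :=` a uniformly random neighbour of `v_b` -/
  | randNeighbor (a b : ℕ)
  /-- `v_a := v_b` -/
  | copyVertex (a b : ℕ)
  /-- sequential composition -/
  | seq (p q : Prog)
  /-- if `r_x ≠ 0` then `p` else `q` -/
  | cond (x : ℕ) (p q : Prog)
  /-- if `v_a = v_b` then `p` else `q` -/
  | condVertex (a b : ℕ) (p q : Prog)
  /-- while `r_x ≠ 0` do `p` -/
  | loop (x : ℕ) (p : Prog)

/-- The state of the machine; `queries` counts the queries made so far. A vertex register that
has not been filled yet holds `none`. -/
structure State (V : Type*) where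
  reg : ℕ → ℕ
  mem : ℕ → ℕ
  vtx : ℕ → Option V
  out : List Atom
  queries : ℕ

/-- The initial state: the input is in register `0`, everything else is empty. -/
def State.init (V : Type*) (input : ℕ) : State V where
  reg := Function.update (fun _ => 0) 0 input
  mem := fun _ => 0
  vtx := fun _ => none
  out := []
  queries := 0

/-- A configuration: the stack of programs still to be executed, and the state. -/
structure Config (V : Type*) where
  todo : List Prog
  state : State V

/-- A configuration has halted if nothing is left to be executed. -/
def Config.Halted {V : Type*} (c : Config V) : Prop := c.todo = []

section Semantics

variable {V : Type*} [Fintype V] [DecidableEq V] [Nonempty V]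
  (G : SimpleGraph V) [DecidableRel G.Adj]

/-- The distribution of the answer to a neighbour query: uniform on the neighbours of the given
vertex. The answer is `none` if no vertex is given, or if it has no neighbour. -/
noncomputable def neighborDist : Option V → PMF (Option V)
  | none => PMF.pure none
  | some v =>
    if h : (G.neighborFinset v).Nonempty then (PMF.uniformOfFinset (G.neighborFinset v) h).map some
    else PMF.pure none

/-- One step of the machine. Every elementary instruction, every query, every evaluation of a
test and the unfolding of a sequential composition is one step; a halted configuration does not change any more. -/
noncomputable def step : Config V → PMF (Config V)
  | ⟨[], s⟩ => PMF.pure ⟨[], s⟩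
  | ⟨.const x c :: k, s⟩ => PMF.pure ⟨k, { s with reg := Function.update s.reg x c }⟩
  | ⟨.add x y z :: k, s⟩ =>
      PMF.pure ⟨k, { s with reg := Function.update s.reg x (s.reg y + s.reg z) }⟩
  | ⟨.sub x y z :: k, s⟩ =>
      PMF.pure ⟨k, { s with reg := Function.update s.reg x (s.reg y - s.reg z) }⟩
  | ⟨.load x y :: k, s⟩ =>
      PMF.pure ⟨k, { s with reg := Function.update s.reg x (s.mem (s.reg y)) }⟩
  | ⟨.store x y :: k, s⟩ =>
      PMF.pure ⟨k, { s with mem := Function.update s.mem (s.reg x) (s.reg y) }⟩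
  | ⟨.emit x y z :: k, s⟩ =>
      PMF.pure ⟨k, { s with out := s.out ++ [⟨s.reg x, s.reg y, s.reg z⟩] }⟩
  | ⟨.randVertex a :: k, s⟩ =>
      (PMF.uniformOfFintype V).map fun v =>
        ⟨k, { s with vtx := Function.update s.vtx a (some v), queries := s.queries + 1 }⟩
  | ⟨.randNeighbor a b :: k, s⟩ =>
      (neighborDist G (s.vtx b)).map fun v =>
        ⟨k, { s with vtx := Function.update s.vtx a v, queries := s.queries + 1 }⟩
  | ⟨.copyVertex a b :: k, s⟩ =>
      PMF.pure ⟨k, { s with vtx := Function.update s.vtx a (s.vtx b) }⟩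
  | ⟨.seq p q :: k, s⟩ => PMF.pure ⟨p :: q :: k, s⟩
  | ⟨.cond x p q :: k, s⟩ => PMF.pure ⟨(if s.reg x ≠ 0 then p else q) :: k, s⟩
  | ⟨.condVertex a b p q :: k, s⟩ => PMF.pure ⟨(if s.vtx a = s.vtx b then p else q) :: k, s⟩
  | ⟨.loop x p :: k, s⟩ =>
      PMF.pure ⟨if s.reg x ≠ 0 then p :: .loop x p :: k else k, s⟩

/-- The distribution of the configuration after `t` steps. -/
noncomputable def runFrom (c : Config V) : ℕ → PMF (Config V)
  | 0 => PMF.pure c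
  | t + 1 => (runFrom c t).bind (step G)

/-- The distribution of the configuration of the machine with program `P` after `t` steps, when
it is started on the given input with query access to `G`. -/
noncomputable def run (P : Prog) (input t : ℕ) : PMF (Config V) :=
  runFrom G ⟨[P], State.init V input⟩ t

end Semantics

end GraphSpectrum

/-! Put `y_i = 1 - λ_i`. The matrix `I - L` is similar to the transition matrix `D⁻¹A` of the random
walk, so the moment `|V|⁻¹ ∑ y_i ^ t` is a normalized trace: the probability that a walk of length
`t` from a uniform vertex ends where it started (`returnProb_toReal`). It can be estimated by
sampling walks, without knowing `|V|`.

To get from moments to a distribution, smooth the spectrum with the kernel `K(v) = U_k(1 - v²/8)^4`,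
where `U_k` is the Chebyshev polynomial of the second kind. It is a nonnegative polynomial of degree
`8k`, at least `(k+1)^4/16` for `|v| ≤ 2/(k+1)`, and it decays like `|v|⁻⁴`. Hence its mean
displacement is `O(1/k)` (`sum_abs_mul_kernel_le` against `le_centralSum`), and its total mass over
a fine grid hardly depends on the eigenvalue at which it is centred (`sum_kernel_bounds`). Spreading
every eigenvalue along the kernel therefore moves the spectral distribution by `O(1/k)` in `W1`
(`W1_le_of_kernel`). The smoothed weight at the grid point `A/M - 1` is the mean of `K(A/M - 2 +
y_i)`, a linear combination of the first `8k + 1` moments. Evaluating it by the Chebyshev recurrence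
amplifies errors of the moments by at most `625^k` (`kernelValue_error`). The parameters are `k =
8192 ⌈1/ε⌉`, `B = 2^(32k)` walks for each length, and `M = B k` grid points per unit length. By
Chebyshev's inequality all moments are within `4096⁻ᵏ` with probability at least `2/3`, which beats
the amplification. `output_accuracy` combines these estimates into the error `8192/k`.

The rest shows that a concrete program does this. Scaling by powers of `4M²` keeps all numbers
integers, and products are repeated additions, so the time is polynomial in `B k`, that is,
`exp(O(1/ε))`. Programs are handled by lower bounds for expectations over runs that halt in time:
the test function `1` then yields halting, an indicator yields the success probability. -/

namespace GraphSpectrum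

/-! ### Expectations -/

/-- The expectation of a nonnegative function. -/
noncomputable def expect {α : Type*} (p : PMF α) (f : α → ℝ≥0∞) : ℝ≥0∞ := ∑' a, p a * f a

section Expect

variable {α β : Type*}

theorem expect_pure (a : α) (f : α → ℝ≥0∞) : expect (PMF.pure a) f = f a := by
  classical
  rw [expect, tsum_eq_single a]
  · simp
  · intro b hb
    simp [PMF.pure_apply, hb]

theorem expect_bind (p : PMF α) (q : α → PMF β) (f : β → ℝ≥0∞) :
    expect (p.bind q) f = expect p fun a => expect (q a) f := by
  simp only [expect, PMF.bind_apply, ← ENNReal.tsum_mul_right, ← ENNReal.tsum_mul_left]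
  rw [ENNReal.tsum_comm]
  simp only [mul_assoc]

theorem expect_map (p : PMF α) (φ : α → β) (f : β → ℝ≥0∞) :
    expect (p.map φ) f = expect p (f ∘ φ) := by
  simp only [PMF.map, expect_bind, Function.comp_apply, expect_pure]
  rfl

theorem expect_mono {p : PMF α} {f g : α → ℝ≥0∞} (h : ∀ a ∈ p.support, f a ≤ g a) :
    expect p f ≤ expect p g := by
  refine ENNReal.tsum_le_tsum fun a => ?_
  by_cases ha : p a = 0
  · simp [ha]
  · exact mul_le_mul_right (h a ((PMF.mem_support_iff _ _).2 ha)) _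

theorem expect_const (p : PMF α) (c : ℝ≥0∞) : expect p (fun _ => c) = c := by
  rw [expect, ENNReal.tsum_mul_right, p.tsum_coe, one_mul]

theorem expect_add (p : PMF α) (f g : α → ℝ≥0∞) :
    expect p (fun a => f a + g a) = expect p f + expect p g := by
  simp only [expect, mul_add, ENNReal.tsum_add]

theorem expect_mul_const (p : PMF α) (f : α → ℝ≥0∞) (c : ℝ≥0∞) :
    expect p (fun a => f a * c) = expect p f * c := by
  simp only [expect, ← mul_assoc, ENNReal.tsum_mul_right]

theorem expect_uniformOfFintype [Fintype α] [Nonempty α] (f : α → ℝ≥0∞) :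
    expect (PMF.uniformOfFintype α) f = ∑ a, (Fintype.card α : ℝ≥0∞)⁻¹ * f a := by
  simp [expect, tsum_fintype]

open Classical in
theorem toOuterMeasure_eq_expect (p : PMF α) (s : Set α) :
    p.toOuterMeasure s = expect p (fun a => if a ∈ s then 1 else 0) := by
  rw [PMF.toOuterMeasure_apply, expect]
  refine tsum_congr fun a => ?_
  by_cases h : a ∈ s <;> simp [h]

end Expect

/-! ### Views of states

The program works with signed integers. An integer is represented as the difference of two
consecutive registers or memory cells. -/

/-- The visible part of a state: integer variables, integer memory, vertex registers, output. -/
@[ext]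
structure View (V : Type*) where
  var : ℕ → ℤ
  mem : ℕ → ℤ
  vtx : ℕ → Option V
  out : List Atom

/-- The visible part of a state. Variable `x` is stored in the registers `4 x` and `4 x + 1`; the
other registers are scratch space. -/
def State.view {V : Type*} (s : State V) : View V where
  var x := (s.reg (4 * x) : ℤ) - s.reg (4 * x + 1)
  mem a := (s.mem (2 * a) : ℤ) - s.mem (2 * a + 1)
  vtx := s.vtx
  out := s.out

/-! ### A program logic for expectations over halting runs. -/

section Logic

variable {V : Type*} [Fintype V] [DecidableEq V] [Nonempty V]
  (G : SimpleGraph V) [DecidableRel G.Adj]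

/-- A function of states as a function of configurations, vanishing unless the machine has
halted. -/
def haltWeight {V : Type*} (g : State V → ℝ≥0∞) : Config V → ℝ≥0∞
  | ⟨[], s⟩ => g s
  | ⟨_ :: _, _⟩ => 0

/-- The expectation of `g` at the final state, over the runs that halt within `T` steps. -/
noncomputable def haltValue (g : State V → ℝ≥0∞) (c : Config V) (T : ℕ) : ℝ≥0∞ :=
  expect (runFrom G c T) (haltWeight g)

/-- `runFrom` adds new steps at the end, whereas reasoning along a program needs the first step
split off. -/
theorem runFrom_succ' (c : Config V) (T : ℕ) :
    runFrom G c (T + 1) = (step G c).bind fun c' => runFrom G c' T := by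
  induction T with
  | zero => simp [runFrom]
  | succ T ih =>
    rw [runFrom, ih, PMF.bind_bind]
    rfl

theorem haltValue_succ (g : State V → ℝ≥0∞) (c : Config V) (T : ℕ) :
    haltValue G g c (T + 1) = expect (step G c) fun c' => haltValue G g c' T := by
  rw [haltValue, runFrom_succ', expect_bind]
  rfl

theorem haltValue_succ_of_step {c c' : Config V} (h : step G c = PMF.pure c')
    (g : State V → ℝ≥0∞) (T : ℕ) : haltValue G g c (T + 1) = haltValue G g c' T := by
  rw [haltValue_succ, h, expect_pure]

/-- Halted configurations are fixed by `step` and the others carry weight zero, so more time can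
only add value. This is why time bounds may be relaxed freely. -/
theorem haltValue_mono (g : State V → ℝ≥0∞) (c : Config V) : Monotone (haltValue G g c) := by
  refine monotone_nat_of_le_succ fun T => ?_
  rw [haltValue, haltValue, runFrom, expect_bind]
  refine expect_mono fun c' _ => ?_
  rcases c' with ⟨_ | ⟨p, k⟩, s⟩
  · simp [step, expect_pure]
  · simp [haltWeight]

theorem haltValue_zero (g : State V → ℝ≥0∞) (c : Config V) :
    haltValue G g c 0 = haltWeight g c := by
  rw [haltValue, runFrom, expect_pure]

/-- From state `s` the program `p` reaches the state `s'` within `t` steps. -/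
def Det (p : Prog) (t : ℕ) (s s' : State V) : Prop :=
  ∀ g k T, haltValue G g ⟨k, s'⟩ T ≤ haltValue G g ⟨p :: k, s⟩ (T + t)

variable {G}

theorem Det.of_step {p : Prog} {s s' : State V}
    (h : ∀ k, step G ⟨p :: k, s⟩ = PMF.pure ⟨k, s'⟩) : Det G p 1 s s' := fun g k T => by
  rw [haltValue_succ_of_step G (h k)]

theorem Det.const (x c : ℕ) (s : State V) :
    Det G (.const x c) 1 s { s with reg := Function.update s.reg x c } :=
  .of_step fun _ => rfl

theorem Det.add (x y z : ℕ) (s : State V) :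
    Det G (.add x y z) 1 s { s with reg := Function.update s.reg x (s.reg y + s.reg z) } :=
  .of_step fun _ => rfl

theorem Det.sub (x y z : ℕ) (s : State V) :
    Det G (.sub x y z) 1 s { s with reg := Function.update s.reg x (s.reg y - s.reg z) } :=
  .of_step fun _ => rfl

theorem Det.load (x y : ℕ) (s : State V) :
    Det G (.load x y) 1 s { s with reg := Function.update s.reg x (s.mem (s.reg y)) } :=
  .of_step fun _ => rfl

theorem Det.store (x y : ℕ) (s : State V) :
    Det G (.store x y) 1 s { s with mem := Function.update s.mem (s.reg x) (s.reg y) } :=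
  .of_step fun _ => rfl

theorem Det.emit (x y z : ℕ) (s : State V) :
    Det G (.emit x y z) 1 s { s with out := s.out ++ [⟨s.reg x, s.reg y, s.reg z⟩] } :=
  .of_step fun _ => rfl

theorem Det.seq {p q : Prog} {t u : ℕ} {s₁ s₂ s₃ : State V} (hp : Det G p t s₁ s₂)
    (hq : Det G q u s₂ s₃) : Det G (.seq p q) (t + u + 1) s₁ s₃ := fun g k T => by
  rw [← add_assoc, haltValue_succ_of_step G (c' := ⟨p :: q :: k, s₁⟩) rfl]
  refine (hq g k T).trans ?_
  have := hp g (q :: k) (T + u)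
  rwa [show T + u + t = T + (t + u) by ring] at this

theorem Det.loop_zero {x : ℕ} {p : Prog} {s : State V} (h : s.reg x = 0) :
    Det G (.loop x p) 1 s s := .of_step fun k => by simp [step, h]

theorem Det.loop_succ {x : ℕ} {p : Prog} {t u : ℕ} {s₁ s₂ s₃ : State V} (h : s₁.reg x ≠ 0)
    (hp : Det G p t s₁ s₂) (hl : Det G (.loop x p) u s₂ s₃) :
    Det G (.loop x p) (t + u + 1) s₁ s₃ := fun g k T => by
  rw [← add_assoc, haltValue_succ_of_step G (c' := ⟨p :: .loop x p :: k, s₁⟩)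
    (by simp [step, h])]
  refine (hl g k T).trans ?_
  have := hp g (.loop x p :: k) (T + u)
  rwa [show T + u + t = T + (t + u) by ring] at this

variable (G) in
/-- From every state with view `h` the program `p` halts within `t` steps, and the view of the
resulting state has the distribution `ν`. This is expressed by what the runs yield when some
continuation is executed after `p`. -/
def Runs (p : Prog) (t : ℕ) (h : View V) (ν : PMF (View V)) : Prop :=
  ∀ g k T (Φ : View V → ℝ≥0∞), (∀ s', Φ s'.view ≤ haltValue G g ⟨k, s'⟩ T) →
    ∀ s : State V, s.view = h → expect ν Φ ≤ haltValue G g ⟨p :: k, s⟩ (T + t)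

theorem Runs.mono {p : Prog} {t u : ℕ} {h : View V} {ν : PMF (View V)} (hr : Runs G p t h ν)
    (htu : t ≤ u) : Runs G p u h ν := fun g k T Φ hΦ s hs =>
  (hr g k T Φ hΦ s hs).trans (haltValue_mono G g _ (by omega))

theorem Runs.of_det {p : Prog} {t : ℕ} {h h' : View V}
    (hd : ∀ s : State V, s.view = h → ∃ s', s'.view = h' ∧ Det G p t s s') :
    Runs G p t h (PMF.pure h') := fun g k T Φ hΦ s hs => by
  obtain ⟨s', rfl, h'⟩ := hd s hs
  rw [expect_pure]
  exact (hΦ s').trans (h' g k T)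

open Classical in
-- The common core of the rules for sequences and loops: the expectation of `Φ` under `κ` serves as
-- the test function for `p`. It is cut off to zero outside the support of `ν`, where nothing is
-- known about `κ`.
theorem Runs.extend {p : Prog} {t u : ℕ} {h : View V} {ν : PMF (View V)} {κ : View V → PMF (View V)}
    (hp : Runs G p t h ν) {g : State V → ℝ≥0∞} {k' : List Prog} {T : ℕ} {Φ : View V → ℝ≥0∞}
    (hκ : ∀ h' ∈ ν.support, ∀ s : State V, s.view = h' →
      expect (κ h') Φ ≤ haltValue G g ⟨k', s⟩ (T + u)) (s : State V) (hs : s.view = h) :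
    expect (ν.bind κ) Φ ≤ haltValue G g ⟨p :: k', s⟩ (T + (t + u)) := by
  have := hp g k' (T + u) (fun h' => if h' ∈ ν.support then expect (κ h') Φ else 0) (fun s' => by
    split_ifs with h'
    · exact hκ _ h' s' rfl
    · exact zero_le) s hs
  rw [show T + u + t = T + (t + u) by ring] at this
  refine le_trans ?_ this
  rw [expect_bind]
  exact expect_mono fun a ha => by simp [ha]

theorem Runs.seq {p q : Prog} {t u : ℕ} {h : View V} {ν : PMF (View V)}
    {κ : View V → PMF (View V)} (hp : Runs G p t h ν)
    (hq : ∀ h' ∈ ν.support, Runs G q u h' (κ h')) :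
    Runs G (.seq p q) (t + u + 1) h (ν.bind κ) := fun g k T Φ hΦ s hs => by
  rw [← add_assoc, haltValue_succ_of_step G (c' := ⟨p :: q :: k, s⟩) rfl]
  exact hp.extend (fun h' hh' s' hs' => hq h' hh' g k T Φ hΦ s' hs') s hs

theorem Runs.seq_pure {p q : Prog} {t u : ℕ} {h h' : View V} {ν : PMF (View V)}
    (hp : Runs G p t h (PMF.pure h')) (hq : Runs G q u h' ν) :
    Runs G (.seq p q) (t + u + 1) h ν := by
  have := hp.seq (q := q) (u := u) (κ := fun _ => ν) (fun h'' hh => by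
    rw [PMF.support_pure, Set.mem_singleton_iff] at hh
    rwa [hh])
  rwa [PMF.bind_const] at this

theorem Runs.randVertex (a : ℕ) (h : View V) :
    Runs G (.randVertex a) 1 h ((PMF.uniformOfFintype V).map fun v =>
      { h with vtx := Function.update h.vtx a (some v) }) := fun g k T Φ hΦ s hs => by
  subst hs
  rw [haltValue_succ, step, expect_map, expect_map]
  exact expect_mono fun v _ => hΦ _

theorem Runs.randNeighbor (a b : ℕ) (h : View V) :
    Runs G (.randNeighbor a b) 1 h ((neighborDist G (h.vtx b)).map fun v =>
      { h with vtx := Function.update h.vtx a v }) := fun g k T Φ hΦ s hs => by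
  subst hs
  rw [haltValue_succ, step, expect_map, expect_map]
  exact expect_mono fun v _ => hΦ _

theorem Runs.copyVertex (a b : ℕ) (h : View V) :
    Runs G (.copyVertex a b) 1 h
      (PMF.pure { h with vtx := Function.update h.vtx a (h.vtx b) }) :=
  .of_det fun s hs => ⟨{ s with vtx := Function.update s.vtx a (s.vtx b) }, by subst hs; rfl,
    .of_step fun _ => rfl⟩

theorem Runs.condVertex {a b : ℕ} {p q : Prog} {t : ℕ} {h : View V} {ν : PMF (View V)}
    (hr : Runs G (if h.vtx a = h.vtx b then p else q) t h ν) :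
    Runs G (.condVertex a b p q) (t + 1) h ν := fun g k T Φ hΦ s hs => by
  rw [← add_assoc, haltValue_succ_of_step G
    (c' := ⟨(if s.vtx a = s.vtx b then p else q) :: k, s⟩) rfl]
  refine hr g k T Φ hΦ s hs |>.trans (le_of_eq ?_)
  subst hs
  rfl

/-- While variable `x` is positive do `p`. -/
def whilePos (x : ℕ) (p : Prog) : Prog :=
  .seq (.sub 2 (4 * x) (4 * x + 1)) (.loop 2 (.seq p (.sub 2 (4 * x) (4 * x + 1))))

theorem view_update_two {V : Type*} (s : State V) (c : ℕ) :
    State.view { s with reg := Function.update s.reg 2 c } = s.view := by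
  ext
  · simp only [State.view]
    rw [Function.update_of_ne (by omega), Function.update_of_ne (by omega)]
  all_goals rfl

/-- The truncated difference of the two halves of a variable is nonzero exactly when the variable is
positive. It lives in the scratch register `2`, which `p` may overwrite, so it is recomputed after
each pass. -/
theorem haltValue_whilePos (x : ℕ) (p : Prog) (g : State V → ℝ≥0∞) (k : List Prog)
    (s : State V) (T : ℕ) : haltValue G g ⟨whilePos x p :: k, s⟩ (T + 2) =
      haltValue G g ⟨.loop 2 (.seq p (.sub 2 (4 * x) (4 * x + 1))) :: k,
        { s with reg := Function.update s.reg 2 (s.reg (4 * x) - s.reg (4 * x + 1)) }⟩ T := by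
  rw [whilePos, haltValue_succ_of_step G rfl, haltValue_succ_of_step G rfl]

theorem Runs.whilePos_nonpos {x : ℕ} (p : Prog) {h : View V} (hx : h.var x ≤ 0) :
    Runs G (whilePos x p) 3 h (PMF.pure h) := fun g k T Φ hΦ s hs => by
  have h0 : s.reg (4 * x) - s.reg (4 * x + 1) = 0 := by
    subst hs
    simp only [State.view] at hx
    omega
  rw [show T + 3 = T + 1 + 2 by ring, haltValue_whilePos, expect_pure,
    haltValue_succ_of_step G (c' := ⟨k, { s with reg := Function.update s.reg 2 0 }⟩)
      (by simp [step, h0])]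
  have := hΦ { s with reg := Function.update s.reg 2 0 }
  rwa [view_update_two, hs] at this

theorem Runs.whilePos_pos {x : ℕ} {p : Prog} {t u : ℕ} {h : View V} {ν : PMF (View V)}
    {κ : View V → PMF (View V)} (hx : 0 < h.var x) (hp : Runs G p t h ν)
    (hl : ∀ h' ∈ ν.support, Runs G (whilePos x p) u h' (κ h')) :
    Runs G (whilePos x p) (t + u + 4) h (ν.bind κ) := fun g k T Φ hΦ s hs => by
  have h0 : s.reg (4 * x) - s.reg (4 * x + 1) ≠ 0 := by
    subst hs
    simp only [State.view] at hx
    omega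
  rw [show T + (t + u + 4) = T + (t + u) + 1 + 1 + 2 by ring, haltValue_whilePos,
    haltValue_succ_of_step G (c' := ⟨.seq p (.sub 2 (4 * x) (4 * x + 1)) ::
      .loop 2 (.seq p (.sub 2 (4 * x) (4 * x + 1))) :: k,
      { s with reg := Function.update s.reg 2 (s.reg (4 * x) - s.reg (4 * x + 1)) }⟩)
      (by simp [step, h0]), haltValue_succ_of_step G rfl]
  refine hp.extend (fun h' hh' s' hs' => ?_) _ (by rw [view_update_two, hs])
  refine (hl h' hh' g k T Φ hΦ s' hs').trans ?_
  -- After `p` the stack holds the renewed test and the loop, which is `whilePos` after its first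
  -- unfolding; the one step of difference is slack.
  refine (haltValue_mono G g _ (Nat.le_succ _)).trans (le_of_eq ?_)
  rw [whilePos, Nat.succ_eq_add_one, haltValue_succ_of_step G rfl]

end Logic

/-! ### Integer instructions -/

/-- Instructions for integer variables. All arguments except for the constant of `set` are
indices of variables. -/
inductive Instr : Type
  /-- `x := c` -/
  | set (x c : ℕ)
  /-- `x := y + z` -/
  | add (x y z : ℕ)
  /-- `x := y - z` -/
  | sub (x y z : ℕ)
  /-- `x := max (y - z) 0` -/
  | tsub (x y z : ℕ)
  /-- `x := x + y * z` -/
  | mulAcc (x y z : ℕ)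
  /-- `x := mem[y]` -/
  | load (x y : ℕ)
  /-- `mem[x] := y` -/
  | store (x y : ℕ)
  /-- append the atom `(x, y, z)` to the output -/
  | emit (x y z : ℕ)

/-- The machine program of an instruction. -/
def Instr.prog : Instr → Prog
  | .set x c => .seq (.const (4 * x) c) (.const (4 * x + 1) 0)
  | .add x y z => .seq (.add (4 * x) (4 * y) (4 * z)) (.add (4 * x + 1) (4 * y + 1) (4 * z + 1))
  -- The first half waits in register `2`, because the second one still reads an old half of `z`,
  -- and `x` may be `z`.
  | .sub x y z => .seq (.add 2 (4 * y) (4 * z + 1)) (.seq (.add (4 * x + 1) (4 * y + 1) (4 * z))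
      (.seq (.const 3 0) (.add (4 * x) 2 3)))
  | .tsub x y z => .seq (.add 2 (4 * y) (4 * z + 1)) (.seq (.add 3 (4 * y + 1) (4 * z))
      (.seq (.sub (4 * x) 2 3) (.const (4 * x + 1) 0)))
  -- Registers `2` and `3` hold the positive and the negative part of `z`, at most one of them
  -- nonzero. The second loop adds `-y` by swapping the halves. The halves of `y` are copied to `7`
  -- and `10`, since `x` may be `y`; register `6` is the zero used for copying, then the one used
  -- for counting down.
  | .mulAcc x y z => .seq (.sub 2 (4 * z) (4 * z + 1)) (.seq (.sub 3 (4 * z + 1) (4 * z))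
      (.seq (.const 6 0) (.seq (.add 7 (4 * y) 6) (.seq (.add 10 (4 * y + 1) 6) (.seq (.const 6 1)
      (.seq (.loop 2 (.seq (.add (4 * x) (4 * x) 7) (.seq (.add (4 * x + 1) (4 * x + 1) 10)
        (.sub 2 2 6))))
      (.loop 3 (.seq (.add (4 * x) (4 * x) 10) (.seq (.add (4 * x + 1) (4 * x + 1) 7)
        (.sub 3 3 6))))))))))
  | .load x y => .seq (.sub 2 (4 * y) (4 * y + 1)) (.seq (.add 2 2 2) (.seq (.load (4 * x) 2)
      (.seq (.const 3 1) (.seq (.add 2 2 3) (.load (4 * x + 1) 2)))))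
  | .store x y => .seq (.sub 2 (4 * x) (4 * x + 1)) (.seq (.add 2 2 2) (.seq (.store 2 (4 * y))
      (.seq (.const 3 1) (.seq (.add 2 2 3) (.store 2 (4 * y + 1))))))
  | .emit x y z => .seq (.sub 2 (4 * x) (4 * x + 1)) (.seq (.sub 3 (4 * y) (4 * y + 1))
      (.seq (.sub 6 (4 * z) (4 * z + 1)) (.emit 2 3 6)))

/-- The effect of an instruction. -/
def Instr.den {V : Type*} : Instr → View V → View V
  | .set x c, h => { h with var := Function.update h.var x c }
  | .add x y z, h => { h with var := Function.update h.var x (h.var y + h.var z) }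
  | .sub x y z, h => { h with var := Function.update h.var x (h.var y - h.var z) }
  | .tsub x y z, h => { h with var := Function.update h.var x (max (h.var y - h.var z) 0) }
  | .mulAcc x y z, h => { h with var := Function.update h.var x (h.var x + h.var y * h.var z) }
  | .load x y, h => { h with var := Function.update h.var x (h.mem (h.var y).toNat) }
  | .store x y, h => { h with mem := Function.update h.mem (h.var x).toNat (h.var y) }
  | .emit x y z, h =>
      { h with out := h.out ++ [⟨(h.var x).toNat, (h.var y).toNat, (h.var z).toNat⟩] }

/-- A bound for the running time of an instruction. -/
def Instr.time {V : Type*} : Instr → View V → ℕ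
  | .mulAcc _ _ z, h => 15 + 6 * (h.var z).natAbs
  | _, _ => 15

/-! ### Correctness and cost of instructions, blocks and deterministic loops. -/

section Instr

variable {V : Type*} [Fintype V] [DecidableEq V] [Nonempty V]
  {G : SimpleGraph V} [DecidableRel G.Adj]

theorem Det.mono {p : Prog} {t u : ℕ} {s s' : State V} (hd : Det G p t s s') (htu : t ≤ u) :
    Det G p u s s' := fun g k T =>
  (hd g k T).trans (haltValue_mono G g _ (by omega))

/-- The accumulation loop: `n` times add the registers `y₁`, `y₂` to `x₁`, `x₂`. -/
theorem Det.accumulate {x₁ x₂ y₁ y₂ i : ℕ} (h₁ : x₁ ≠ x₂)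
    (hy : y₁ ≠ x₁ ∧ y₁ ≠ x₂ ∧ y₂ ≠ x₁ ∧ y₂ ≠ x₂) (hyi : y₁ ≠ i ∧ y₂ ≠ i)
    (hi : i ≠ x₁ ∧ i ≠ x₂ ∧ i ≠ 6) (h6 : x₁ ≠ 6 ∧ x₂ ≠ 6) (n : ℕ) :
    ∀ s : State V, s.reg i = n → s.reg 6 = 1 →
      Det G (.loop i (.seq (.add x₁ x₁ y₁) (.seq (.add x₂ x₂ y₂) (.sub i i 6)))) (6 * n + 1) s
        { s with reg := Function.update (Function.update (Function.update s.reg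
          x₁ (s.reg x₁ + n * s.reg y₁)) x₂ (s.reg x₂ + n * s.reg y₂)) i 0 } := by
  induction n with
  | zero =>
    intro s hs _
    have h := Det.loop_zero (G := G) (p := (.seq (.add x₁ x₁ y₁) (.seq (.add x₂ x₂ y₂) (.sub i i 6)))) hs
    convert h
    funext r
    simp only [Function.update_apply]
    split_ifs with a b c
    · rw [a, hs]
    · rw [b]; simp
    · rw [c]; simp
    · rfl
  | succ n ih =>
    intro s hs hs6
    have hb := (Det.add (G := G) x₁ x₁ y₁ s).seq ((Det.add x₂ x₂ y₂ _).seq (Det.sub i i 6 _))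
    have := ih _ (by simp [Function.update_apply, hi, hs, hs6, h6.1.symm,
      h6.2.symm]) (by simp [Function.update_apply, hi.2.2.symm, hs6, h6.1.symm,
      h6.2.symm]) |> Det.loop_succ (by omega) hb
    have h := this.mono (u := 6 * (n + 1) + 1) (by omega)
    convert h using 2
    funext r
    simp only [Function.update_apply, h₁, h₁.symm, hy, hyi, hi, hi.1.symm, hi.2.1.symm, if_false,
      if_true]
    split_ifs <;> first | rfl | ring

theorem variable_index (x y : ℕ) : (4 * x = 4 * y ↔ x = y) ∧ 4 * x ≠ 4 * y + 1 ∧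
    4 * x + 1 ≠ 4 * y := by omega

theorem scratch_index (x : ℕ) : (4 * x ≠ 2 ∧ 4 * x ≠ 3 ∧ 4 * x ≠ 6 ∧ 4 * x ≠ 7 ∧ 4 * x ≠ 10) ∧
    (4 * x + 1 ≠ 2 ∧ 4 * x + 1 ≠ 3 ∧ 4 * x + 1 ≠ 6 ∧ 4 * x + 1 ≠ 7 ∧ 4 * x + 1 ≠ 10) ∧
    (2 ≠ 4 * x ∧ 3 ≠ 4 * x ∧ 6 ≠ 4 * x ∧ 7 ≠ 4 * x ∧ 10 ≠ 4 * x) ∧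
    (2 ≠ 4 * x + 1 ∧ 3 ≠ 4 * x + 1 ∧ 6 ≠ 4 * x + 1 ∧ 7 ≠ 4 * x + 1 ∧ 10 ≠ 4 * x + 1) := by
  omega

theorem Instr.runs (c : Instr) (h : View V) : Runs G c.prog (c.time h) h (PMF.pure (c.den h)) := by
  refine .of_det fun s hs => ?_
  subst hs
  cases c with
  | set x c =>
    refine ⟨_, ?_, ((Det.const _ _ _).seq (Det.const _ _ _)).mono (by simp [Instr.time])⟩
    ext w
    · by_cases hw : w = x <;>
        simp [State.view, Instr.den, Function.update_apply, variable_index, hw]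
    all_goals rfl
  | add x y z =>
    refine ⟨_, ?_, ((Det.add _ _ _ _).seq (Det.add _ _ _ _)).mono (by simp [Instr.time])⟩
    ext w
    · by_cases hw : w = x <;>
        simp [State.view, Instr.den, Function.update_apply, variable_index, hw]
      ring
    all_goals rfl
  | sub x y z =>
    refine ⟨_, ?_, ((Det.add _ _ _ _).seq ((Det.add _ _ _ _).seq ((Det.const _ _ _).seq
      (Det.add _ _ _ _)))).mono (by simp [Instr.time])⟩
    ext w
    · by_cases hw : w = x <;>
        simp [State.view, Instr.den, Function.update_apply, variable_index, scratch_index, hw]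
      ring
    all_goals rfl
  | tsub x y z =>
    refine ⟨_, ?_, ((Det.add _ _ _ _).seq ((Det.add _ _ _ _).seq ((Det.sub _ _ _ _).seq
      (Det.const _ _ _)))).mono (by simp [Instr.time])⟩
    ext w
    · by_cases hw : w = x <;>
        simp [State.view, Instr.den, Function.update_apply, variable_index, scratch_index, hw]
      omega
    all_goals rfl
  | mulAcc x y z =>
    refine ⟨_, ?_, ((Det.sub _ _ _ _).seq ((Det.sub _ _ _ _).seq ((Det.const _ _ _).seq
      ((Det.add _ _ _ _).seq ((Det.add _ _ _ _).seq ((Det.const _ _ _).seq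
      ((Det.accumulate (by omega) (by omega) (by omega) (by omega) (by omega)
        (s.reg (4 * z) - s.reg (4 * z + 1)) _ ?_ ?_).seq
      (Det.accumulate (by omega) (by omega) (by omega) (by omega) (by omega)
        (s.reg (4 * z + 1) - s.reg (4 * z)) _ ?_ ?_)))))))).mono ?_⟩
    · ext w
      · by_cases hw : w = x
        · simp only [State.view, Instr.den, Function.update_apply, variable_index, scratch_index,
            hw, if_true, if_false]
          simp
          rcases le_total (s.reg (4 * z)) (s.reg (4 * z + 1)) with h | h <;>
          · push_cast [Nat.sub_eq_zero_of_le h, Nat.cast_sub h]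
            ring
        · simp [State.view, Instr.den, Function.update_apply, variable_index, scratch_index, hw]
      all_goals rfl
    · simp
    · simp
    · simp [scratch_index]
    · simp [scratch_index]
    · simp only [Instr.time, State.view]
      omega
  | load x y =>
    refine ⟨_, ?_, ((Det.sub _ _ _ _).seq ((Det.add _ _ _ _).seq ((Det.load _ _ _).seq
      ((Det.const _ _ _).seq ((Det.add _ _ _ _).seq (Det.load _ _ _)))))).mono
      (by simp [Instr.time])⟩
    ext w
    · have ht : ((s.reg (4 * y) : ℤ) - s.reg (4 * y + 1)).toNat =
          s.reg (4 * y) - s.reg (4 * y + 1) := by omega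
      by_cases hw : w = x <;>
        simp [State.view, Instr.den, Function.update_apply, variable_index, scratch_index, hw, ht,
          two_mul]
    all_goals rfl
  | store x y =>
    refine ⟨_, ?_, ((Det.sub _ _ _ _).seq ((Det.add _ _ _ _).seq ((Det.store _ _ _).seq
      ((Det.const _ _ _).seq ((Det.add _ _ _ _).seq (Det.store _ _ _)))))).mono
      (by simp [Instr.time])⟩
    have ht : ((s.reg (4 * x) : ℤ) - s.reg (4 * x + 1)).toNat =
          s.reg (4 * x) - s.reg (4 * x + 1) := by omega
    ext w
    · simp [State.view, Instr.den, scratch_index]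
    · have h1 : ∀ a b : ℕ, 2 * a ≠ b + b + 1 := by omega
      have h2 : ∀ a b : ℕ, 2 * a + 1 ≠ b + b := by omega
      have h3 : ∀ a b : ℕ, 2 * a = b + b ↔ a = b := by omega
      by_cases hw : w = s.reg (4 * x) - s.reg (4 * x + 1) <;>
        simp [State.view, Instr.den, Function.update_apply, scratch_index, hw, ht,
          h1, h2, h3]
    all_goals rfl
  | emit x y z =>
    refine ⟨_, ?_, ((Det.sub _ _ _ _).seq ((Det.sub _ _ _ _).seq ((Det.sub _ _ _ _).seq
      (Det.emit _ _ _ _)))).mono (by simp [Instr.time])⟩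
    ext w
    · simp [State.view, Instr.den, scratch_index]
    · rfl
    · rfl
    · simp [State.view, Instr.den, scratch_index]

/-- A straight-line program. -/
def block : List Instr → Prog
  | [] => .const 2 0
  | c :: l => .seq c.prog (block l)

/-- The effect of a straight-line program. -/
def blockDen {V : Type*} : List Instr → View V → View V
  | [], h => h
  | c :: l, h => blockDen l (c.den h)

/-- A bound for the running time of a straight-line program. -/
def blockTime {V : Type*} : List Instr → View V → ℕ
  | [], _ => 1
  | c :: l, h => c.time h + blockTime l (c.den h) + 1

theorem block_runs (l : List Instr) : ∀ h : View V,
    Runs G (block l) (blockTime l h) h (PMF.pure (blockDen l h)) := by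
  induction l with
  | nil => exact fun h => .of_det fun s hs => ⟨_, by rw [view_update_two, hs]; rfl, Det.const 2 0 s⟩
  | cons c l ih => exact fun h => (c.runs h).seq_pure (ih _)

variable (G) in
/-- Total correctness with a time bound, for programs without random choices: from a view that
satisfies `P` the program `p` reaches within `t` steps a view that satisfies `Q`. -/
def Triple (P : View V → Prop) (p : Prog) (t : ℕ) (Q : View V → Prop) : Prop :=
  ∀ h, P h → ∃ h', Runs G p t h (PMF.pure h') ∧ Q h'

theorem Triple.mono {P P' Q Q' : View V → Prop} {p : Prog} {t t' : ℕ} (h : Triple G P p t Q)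
    (hP : ∀ h, P' h → P h) (ht : t ≤ t') (hQ : ∀ h, Q h → Q' h) : Triple G P' p t' Q' :=
  fun v hv => (h v (hP v hv)).imp fun _ hv' => ⟨hv'.1.mono ht, hQ _ hv'.2⟩

theorem Triple.block {P Q : View V → Prop} {l : List Instr} {t : ℕ}
    (h : ∀ v, P v → Q (blockDen l v) ∧ blockTime l v ≤ t) : Triple G P (block l) t Q :=
  fun v hv => ⟨_, (block_runs l v).mono (h v hv).2, (h v hv).1⟩

theorem Triple.seq {P Q R : View V → Prop} {p q : Prog} {t u : ℕ} (hp : Triple G P p t Q)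
    (hq : Triple G Q q u R) : Triple G P (.seq p q) (t + u + 1) R := fun v hv => by
  obtain ⟨v', hv', hQ⟩ := hp v hv
  obtain ⟨v'', hv'', hR⟩ := hq v' hQ
  exact ⟨v'', hv'.seq_pure hv'', hR⟩

/-- The variable `x` counts down from `n`, and `I i` describes the state after `i` passes. The `4`
extra steps per pass pay for the test and the unfolding. -/
theorem Triple.whilePos {x n t : ℕ} {p : Prog} (I : ℕ → View V → Prop)
    (hx : ∀ i ≤ n, ∀ v, I i v → v.var x = n - i)
    (hp : ∀ i < n, Triple G (I i) p t (I (i + 1))) :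
    Triple G (I 0) (whilePos x p) (n * (t + 4) + 3) (I n) := by
  suffices H : ∀ d i, i + d = n → Triple G (I i) (GraphSpectrum.whilePos x p)
      (d * (t + 4) + 3) (I n) from H n 0 (zero_add n)
  intro d
  induction d with
  | zero =>
    rintro i rfl v hv
    exact ⟨v, (Runs.whilePos_nonpos p (by rw [hx i le_rfl v hv]; simp)).mono (by omega), hv⟩
  | succ d ih =>
    intro i hi v hv
    obtain ⟨v₁, hr, h₁⟩ := hp i (by omega) v hv
    obtain ⟨v₂, hr₂, h₂⟩ := ih (i + 1) (by omega) v₁ h₁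
    have := Runs.whilePos_pos (x := x) (p := p) (κ := fun _ => PMF.pure v₂) (u := d * (t + 4) + 3)
      (by rw [hx i (by omega) v hv]; omega) hr (fun h' hh' => by
        rw [PMF.support_pure, Set.mem_singleton_iff] at hh'
        rwa [hh'])
    rw [PMF.bind_const] at this
    exact ⟨v₂, this.mono (by ring_nf; omega), h₂⟩

end Instr

/-! ### Sampling random walks -/

section Walk

variable {V : Type*} [Fintype V] [DecidableEq V] [Nonempty V]
  (G : SimpleGraph V) [DecidableRel G.Adj]

/-- The distribution of the end point of a random walk of length `t`. -/
noncomputable def walkDist : ℕ → Option V → PMF (Option V)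
  | 0, o => PMF.pure o
  | t + 1, o => (neighborDist G o).bind (walkDist t)

/-- The probability that a random walk of length `t` from a random vertex ends where it
started. -/
noncomputable def returnProb (t : ℕ) : ℝ≥0∞ :=
  expect (PMF.uniformOfFintype V) fun v => walkDist G t (some v) (some v)

/-- Walk `r` steps with vertex register `1`, where `r` is the value of variable `14`. -/
def walkProg : Prog := whilePos 14 (.seq (.randNeighbor 1 1) (block [.sub 14 14 1]))

variable {G}

/-- Variable `1` holds the constant one throughout. Each move costs `19` steps for the body and `4`
for the loop. -/
theorem walkProg_runs (t : ℕ) : ∀ h : View V, h.var 14 = t → h.var 1 = 1 →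
    Runs G walkProg (23 * t + 3) h ((walkDist G t (h.vtx 1)).map fun o =>
      { h with var := Function.update h.var 14 0, vtx := Function.update h.vtx 1 o }) := by
  induction t with
  | zero =>
    intro h h14 _
    have hh : h = { h with var := Function.update h.var 14 0
                           vtx := Function.update h.vtx 1 (h.vtx 1) } := by
      rw [← Nat.cast_zero, ← h14]
      simp
    have := Runs.whilePos_nonpos (G := G) (.seq (.randNeighbor 1 1) (block [.sub 14 14 1]))
      (x := 14) (h := h) (by simp [h14])
    rw [walkDist, PMF.pure_map, ← hh]
    exact this
  | succ t ih =>
    intro h h14 h1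
    have hb : Runs G (.seq (.randNeighbor 1 1) (block [.sub 14 14 1])) 19 h
        ((neighborDist G (h.vtx 1)).map fun o =>
          { h with var := Function.update h.var 14 t, vtx := Function.update h.vtx 1 o }) := by
      have := (Runs.randNeighbor (G := G) 1 1 h).seq (q := block [.sub 14 14 1]) (u := 17)
        (κ := fun h' => PMF.pure (blockDen [.sub 14 14 1] h')) (fun h' _ => block_runs _ _)
      convert this using 1
      rw [PMF.bind_map, PMF.map]
      congr 1
      funext o
      simp [blockDen, Instr.den, h1, h14]
    have hl := Runs.whilePos_pos (x := 14) (u := 23 * t + 3)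
      (κ := fun h' => (walkDist G t (h'.vtx 1)).map fun o =>
      { h' with var := Function.update h'.var 14 0, vtx := Function.update h'.vtx 1 o })
      (by rw [h14]; omega) hb (fun h' hh' => by
        rw [PMF.mem_support_map_iff] at hh'
        obtain ⟨o, _, rfl⟩ := hh'
        exact ih _ (by simp) (by simpa using h1))
    have hl' := hl.mono (u := 23 * (t + 1) + 3) (by omega)
    rw [PMF.bind_map] at hl'
    rw [walkDist, PMF.map_bind]
    refine (congrArg (Runs G walkProg _ h) ?_).mpr hl'
    congr 1
    funext o
    simp

/-- One sample: variable `12` is increased if a random walk returns to its start, where the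
length of the walk is variable `10`; variable `13` is decreased. -/
def sampleProg : Prog :=
  .seq (.randVertex 0) (.seq (.copyVertex 1 0) (.seq (block [.set 14 0, .add 14 14 10])
    (.seq walkProg (.seq (.condVertex 0 1 (block [.add 12 12 1]) (block []))
      (block [.sub 13 13 1])))))

/-- Later arguments need only that the counter receives a Bernoulli increment. The complementary
weight `p'` is given by an equation, which avoids truncated subtraction in `ℝ≥0∞`. -/
theorem sampleProg_runs {h : View V} {j : ℕ} (h10 : h.var 10 = j) (h1 : h.var 1 = 1) :
    ∃ ν, Runs G sampleProg (23 * j + 85) h ν ∧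
      (∀ h' ∈ ν.support, h'.mem = h.mem ∧ h'.out = h.out ∧ h'.var 13 = h.var 13 - 1 ∧
        ∀ x, x < 12 → h'.var x = h.var x) ∧
      ∃ p' : ℝ≥0∞, returnProb G j + p' = 1 ∧ ∀ f : ℤ → ℝ≥0∞,
        expect ν (fun h' => f (h'.var 12)) =
          returnProb G j * f (h.var 12 + 1) + p' * f (h.var 12) := by
  classical
  let mid : View V → Option V → View V := fun h₁ o =>
    { h₁ with var := Function.update (Function.update h₁.var 14 j) 14 0
              vtx := Function.update (Function.update h₁.vtx 1 (h₁.vtx 0)) 1 o }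
  let fin : View V → View V := fun h₄ => blockDen [.sub 13 13 1]
    (if h₄.vtx 0 = h₄.vtx 1 then blockDen [.add 12 12 1] h₄ else h₄)
  have hfin : ∀ h₄, Runs G (.seq (.condVertex 0 1 (block [.add 12 12 1]) (block []))
      (block [.sub 13 13 1])) (18 + 17 + 1) h₄ (PMF.pure (fin h₄)) := fun h₄ => by
    refine Runs.seq_pure (h' := if h₄.vtx 0 = h₄.vtx 1 then blockDen [.add 12 12 1] h₄ else h₄)
      (Runs.condVertex (t := 17) ?_) (block_runs _ _)
    split_ifs
    · exact block_runs _ _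
    · exact (block_runs [] h₄).mono (by simp [blockTime])
  have hrest : ∀ h₁ : View V, h₁.var 10 = j → h₁.var 1 = 1 → Runs G (.seq (.copyVertex 1 0)
      (.seq (block [.set 14 0, .add 14 14 10]) (.seq walkProg
        (.seq (.condVertex 0 1 (block [.add 12 12 1]) (block [])) (block [.sub 13 13 1])))))
      (1 + (33 + ((23 * j + 3) + (18 + 17 + 1) + 1) + 1) + 1) h₁
      (((walkDist G j (h₁.vtx 0)).map (mid h₁)).bind fun h₄ => PMF.pure (fin h₄)) := by
    intro h₁ h10 h1
    refine (Runs.copyVertex 1 0 h₁).seq_pure (Runs.seq_pure (block_runs _ _) ?_)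
    have := (walkProg_runs (G := G) j { h₁ with
      var := Function.update h₁.var 14 j
      vtx := Function.update h₁.vtx 1 (h₁.vtx 0) } (by simp) (by simpa using h1)).seq
      (fun h' _ => hfin h')
    convert this using 1
    · simp [blockDen, Instr.den, h10]
    · simp [mid]
  have hall := (Runs.randVertex (G := G) 0 h).seq (fun h' hh' => hrest h'
    (by
      rw [PMF.mem_support_map_iff] at hh'
      obtain ⟨o, _, rfl⟩ := hh'
      exact h10)
    (by
      rw [PMF.mem_support_map_iff] at hh'
      obtain ⟨o, _, rfl⟩ := hh'
      exact h1))
  refine ⟨_, hall.mono (by omega), ?_, ?_⟩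
  · intro h' hh'
    simp only [PMF.mem_support_bind_iff, PMF.mem_support_map_iff, PMF.mem_support_pure_iff] at hh'
    obtain ⟨h₁, ⟨v, _, rfl⟩, h₄, ⟨o, _, rfl⟩, rfl⟩ := hh'
    have h13 : ∀ x, x < 12 → x ≠ 12 ∧ x ≠ 13 ∧ x ≠ 14 := by omega
    by_cases hov : o = some v
    · simp +contextual [fin, mid, blockDen, Instr.den, hov, h1, h13]
    · simp +contextual [fin, mid, blockDen, Instr.den, Ne.symm hov, h1, h13]
  · have hw : ∀ v, walkDist G j (some v) (some v) = expect (walkDist G j (some v))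
        fun o => if some v = o then 1 else 0 := fun v => by
      rw [expect, tsum_eq_single (some v)]
      · simp
      · intro o ho
        simp [ho.symm]
    refine ⟨expect (PMF.uniformOfFintype V) fun v => expect (walkDist G j (some v))
      fun o => if some v = o then 0 else 1, ?_, fun f => ?_⟩
    · simp only [returnProb, hw, ← expect_add]
      refine Eq.trans (congrArg _ (funext fun v => ?_)) (expect_const (PMF.uniformOfFintype V) 1)
      refine Eq.trans (congrArg _ (funext fun o => ?_)) (expect_const (walkDist G j (some v)) 1)
      split_ifs <;> simp
    · simp only [expect_bind, expect_map, expect_pure, returnProb, hw, ← expect_add,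
        ← expect_mul_const]
      congr 1
      funext v
      simp only [Function.comp_apply, Function.update_self]
      congr 1
      funext o
      by_cases hov : some v = o
      · simp [fin, mid, blockDen, Instr.den, hov, h1]
      · simp [fin, mid, blockDen, Instr.den, hov]

theorem returnProb_le_one (j : ℕ) : returnProb G j ≤ 1 := by
  rw [returnProb, ← expect_const (PMF.uniformOfFintype V) 1]
  exact expect_mono fun v _ => PMF.coe_le_one _ _

/-- Repeat `sampleProg` as often as variable `13` says. -/
def samplesProg : Prog := whilePos 13 sampleProg

/-- The second moment of a sum of independent Bernoulli variables is the squared bias plus the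
variance, which is at most `n`. The centre `a` and the initial counter stay arbitrary for the
induction. -/
theorem samplesProg_runs {j : ℕ} (a : ℝ) (n : ℕ) : ∀ h : View V, h.var 10 = j → h.var 1 = 1 →
    h.var 13 = n →
    ∃ ν, Runs G samplesProg (n * (23 * j + 89) + 3) h ν ∧
      (∀ h' ∈ ν.support, h'.mem = h.mem ∧ h'.out = h.out ∧ ∀ x, x < 12 → h'.var x = h.var x) ∧
      expect ν (fun h' => ENNReal.ofReal (((h'.var 12 : ℝ) - a) ^ 2)) ≤
        ENNReal.ofReal ((h.var 12 + n * (returnProb G j).toReal - a) ^ 2 + n) := by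
  induction n with
  | zero =>
    intro h _ _ h13
    refine ⟨_, (Runs.whilePos_nonpos _ (by simp [h13])).mono (by omega), ?_, ?_⟩
    · intro h' hh'
      rw [PMF.mem_support_pure_iff] at hh'
      simp [hh']
    · simp [expect_pure]
  | succ n ih =>
    intro h h10 h1 h13
    obtain ⟨ν, hν, hsupp, p', hp', hf⟩ := sampleProg_runs (G := G) h10 h1
    -- The implication lets `choose` produce a total function `κ`; off the support any distribution
    -- will do.
    have ih' : ∀ h' : View V, ∃ ν', h' ∈ ν.support → Runs G samplesProg (n * (23 * j + 89) + 3) h' ν' ∧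
      (∀ h'' ∈ ν'.support, h''.mem = h'.mem ∧ h''.out = h'.out ∧
        ∀ x, x < 12 → h''.var x = h'.var x) ∧
      expect ν' (fun h'' => ENNReal.ofReal (((h''.var 12 : ℝ) - a) ^ 2)) ≤
        ENNReal.ofReal ((h'.var 12 + n * (returnProb G j).toReal - a) ^ 2 + n) := by
      intro h'
      by_cases hh' : h' ∈ ν.support
      · obtain ⟨_, _, h13', hx⟩ := hsupp h' hh'
        obtain ⟨ν', h'⟩ := ih h' (by rw [hx _ (by norm_num), h10])
          (by rw [hx _ (by norm_num), h1]) (by rw [h13', h13]; push_cast; ring)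
        exact ⟨ν', fun _ => h'⟩
      · exact ⟨ν, fun h => absurd h hh'⟩
    choose κ hκ using ih'
    refine ⟨ν.bind κ, (Runs.whilePos_pos (by rw [h13]; omega) hν fun h' hh' =>
      (hκ h' hh').1).mono (by ring_nf; omega), ?_, ?_⟩
    · intro h'' hh''
      rw [PMF.mem_support_bind_iff] at hh''
      obtain ⟨h', hh', hh''⟩ := hh''
      obtain ⟨m1, o1, _, x1⟩ := hsupp h' hh'
      obtain ⟨m2, o2, x2⟩ := (hκ h' hh').2.1 h'' hh''
      exact ⟨m2.trans m1, o2.trans o1, fun x hx => (x2 x hx).trans (x1 x hx)⟩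
    · rw [expect_bind]
      refine (expect_mono fun h' hh' => (hκ h' hh').2.2).trans ?_
      rw [hf fun c => ENNReal.ofReal ((c + n * (returnProb G j).toReal - a) ^ 2 + n)]
      have hpt : returnProb G j ≠ ⊤ := ne_top_of_le_ne_top ENNReal.one_ne_top (returnProb_le_one j)
      have hpt' : p' ≠ ⊤ := ne_top_of_le_ne_top ENNReal.one_ne_top (hp' ▸ le_add_self)
      obtain ⟨r, hr⟩ : ∃ r, r = (returnProb G j).toReal := ⟨_, rfl⟩
      have hr' : p'.toReal = 1 - r := by
        rw [hr, eq_sub_iff_add_eq', ← ENNReal.toReal_add hpt hpt', hp', ENNReal.toReal_one]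
      have h0 : 0 ≤ r := hr ▸ ENNReal.toReal_nonneg
      have h0' : 0 ≤ 1 - r := hr' ▸ ENNReal.toReal_nonneg
      rw [← ENNReal.ofReal_toReal hpt, ← ENNReal.ofReal_toReal hpt', hr', ← hr,
        ENNReal.toReal_ofReal h0, ← ENNReal.ofReal_mul h0, ← ENNReal.ofReal_mul h0',
        ← ENNReal.ofReal_add (by positivity) (by positivity)]
      refine ENNReal.ofReal_le_ofReal ?_
      push_cast
      -- With `x = c + (n + 1) r - a`, where `c` is the old counter, averaging over one sample gives
      -- `x² + r (1 - r) + n`, and `r (1 - r) ≤ 1`.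
      nlinarith

/-- Estimate the return probabilities: store in the memory cell `j` the number of returns of
random walks of length `j`, for all `j` less than the value of variable `5`. -/
def momentsProg : Prog :=
  .seq (block [.set 10 0, .set 11 0, .add 11 11 5]) (whilePos 11
    (.seq (block [.set 12 0, .set 13 0, .add 13 13 3]) (.seq samplesProg
      (block [.store 10 12, .add 10 10 1, .sub 11 11 1]))))

open Classical in
-- Chebyshev's inequality: the indicator of a deviation beyond `c` is at most `(f - a)² / c²`.
theorem expect_deviation_le {α : Type*} {ν : PMF α} {f : α → ℝ} {a b c : ℝ} (hc : 0 < c)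
    (h : expect ν (fun x => ENNReal.ofReal ((f x - a) ^ 2)) ≤ ENNReal.ofReal b) :
    expect ν (fun x => if |f x - a| ≤ c then 0 else 1) ≤ ENNReal.ofReal (b / c ^ 2) := by
  calc expect ν (fun x => if |f x - a| ≤ c then 0 else 1)
      ≤ expect ν (fun x => ENNReal.ofReal ((f x - a) ^ 2) * ENNReal.ofReal (1 / c ^ 2)) := by
        refine expect_mono fun x _ => ?_
        split_ifs with hx
        · exact zero_le
        · rw [← ENNReal.ofReal_mul (sq_nonneg _), ENNReal.one_le_ofReal, mul_one_div,
            one_le_div (by positivity), ← sq_abs (f x - a)]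
          push Not at hx
          gcongr
    _ ≤ ENNReal.ofReal b * ENNReal.ofReal (1 / c ^ 2) := by
        rw [expect_mul_const]
        gcongr
    _ = _ := by rw [← ENNReal.ofReal_mul' (by positivity), mul_one_div]

open Classical in
-- A union bound over the remaining lengths. Later passes leave the cells below their starting index
-- alone, so whether cell `j` is accurate is decided by the first pass.
theorem momentsLoop_runs {N : ℕ} {c : ℝ} (hc : 0 < c) (D d : ℕ) : ∀ (j : ℕ) (h : View V),
    h.var 1 = 1 → h.var 3 = N → h.var 10 = j → h.var 11 = d → j + d ≤ D →
    ∃ ν, Runs G (whilePos 11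
      (.seq (block [.set 12 0, .set 13 0, .add 13 13 3]) (.seq samplesProg
      (block [.store 10 12, .add 10 10 1, .sub 11 11 1]))))
      (d * (N * (23 * D + 89) + 109) + 3) h ν ∧
      (∀ h' ∈ ν.support, h'.out = h.out ∧ (∀ x, x < 10 → h'.var x = h.var x) ∧
        ∀ i < j, h'.mem i = h.mem i) ∧
      expect ν (fun h' => if ∀ i, j ≤ i → i < j + d →
        |(h'.mem i : ℝ) - N * (returnProb G i).toReal| ≤ c then 0 else 1) ≤
        d * ENNReal.ofReal (N / c ^ 2) := by
  induction d with
  | zero =>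
    intro j h _ _ _ h11 _
    refine ⟨_, (Runs.whilePos_nonpos _ (by simp [h11])).mono (by omega), ?_, ?_⟩
    · intro h' hh'
      rw [PMF.mem_support_pure_iff] at hh'
      simp [hh']
    · rw [expect_pure, if_pos]
      · exact zero_le
      · intro i h1 h2
        omega
  | succ d ih =>
    intro j h h1 h3 h10 h11 hD
    obtain ⟨ν, hν, hs, hd⟩ := samplesProg_runs (G := G) (N * (returnProb G j).toReal) N
      (blockDen [.set 12 0, .set 13 0, .add 13 13 3] h) (j := j) (by simp [blockDen, Instr.den, h10])
      (by simp [blockDen, Instr.den, h1]) (by simp [blockDen, Instr.den, h3])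
    have hb : Runs G (.seq (block [.set 12 0, .set 13 0, .add 13 13 3]) (.seq samplesProg
        (block [.store 10 12, .add 10 10 1, .sub 11 11 1]))) (N * (23 * D + 89) + 105) h
        (ν.bind fun h' => PMF.pure (blockDen [.store 10 12, .add 10 10 1, .sub 11 11 1] h')) := by
      refine ((block_runs _ _).seq_pure (hν.seq (u := 49) fun h' _ => block_runs _ _)).mono ?_
      simp only [blockTime, Instr.time]
      have : N * (23 * j + 89) ≤ N * (23 * D + 89) := by gcongr; omega
      omega
    set ν₁ := ν.bind fun h' => PMF.pure (blockDen [.store 10 12, .add 10 10 1, .sub 11 11 1] h')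
      with hν₁
    have hs₁ : ∀ h' ∈ ν₁.support, h'.out = h.out ∧ (∀ x, x < 10 → h'.var x = h.var x) ∧
        (∀ i < j, h'.mem i = h.mem i) ∧ h'.var 10 = j + 1 ∧ h'.var 11 = d := by
      intro h' hh'
      simp only [hν₁, PMF.mem_support_bind_iff, PMF.mem_support_pure_iff] at hh'
      obtain ⟨h₂, hh₂, rfl⟩ := hh'
      obtain ⟨hm, ho, hx⟩ := hs h₂ hh₂
      have hx10 := hx 10 (by norm_num)
      have hx11 := hx 11 (by norm_num)
      have hx1 := hx 1 (by norm_num)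
      simp only [blockDen, Instr.den] at hx10 hx11 hx1 hm ho
      simp [h10, h11, h1] at hx10 hx11 hx1
      refine ⟨by simp [blockDen, Instr.den, ho], fun x hx' => ?_, fun i hi => ?_, ?_, ?_⟩
      · have := hx x (by omega)
        have : x ≠ 10 ∧ x ≠ 11 ∧ x ≠ 12 ∧ x ≠ 13 := by omega
        simp_all [blockDen, Instr.den]
      · have : i ≠ j := by omega
        simp [blockDen, Instr.den, hx10, hm, this]
      · simp [blockDen, Instr.den, hx10, hx1]
      · simp [blockDen, Instr.den, hx11, hx1]
    have hd₁ : expect ν₁ (fun h' => if |(h'.mem j : ℝ) - N * (returnProb G j).toReal| ≤ c then 0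
        else 1) ≤ ENNReal.ofReal (N / c ^ 2) := by
      -- The counter starts at zero and the centre is its mean, so the bias vanishes and only the
      -- variance bound `N` remains.
      have := expect_deviation_le hc (f := fun h' : View V => (h'.var 12 : ℝ)) (b := N)
        (hd.trans (le_of_eq (by simp [blockDen, Instr.den])))
      refine le_trans (le_of_eq ?_) this
      rw [hν₁, expect_bind]
      simp only [expect_pure]
      refine le_antisymm (expect_mono fun h' hh' => ?_) (expect_mono fun h' hh' => ?_) <;>
      · have hx10 := (hs h' hh').2.2 10 (by norm_num)
        simp [blockDen, Instr.den, h10] at hx10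
        simp [blockDen, Instr.den, hx10]
    have ih' : ∀ h' : View V, ∃ ν', h' ∈ ν₁.support → _ := fun h' => by
      by_cases hh' : h' ∈ ν₁.support
      · obtain ⟨_, hx, _, h10', h11'⟩ := hs₁ h' hh'
        obtain ⟨ν', h'⟩ := ih (j + 1) h' (by rw [hx _ (by norm_num), h1])
          (by rw [hx _ (by norm_num), h3]) (by rw [h10']; push_cast; ring) h11' (by omega)
        exact ⟨ν', fun _ => h'⟩
      · exact ⟨ν, fun h => absurd h hh'⟩
    choose κ hκ using ih'
    refine ⟨ν₁.bind κ, (Runs.whilePos_pos (by rw [h11]; omega) hb fun h' hh' =>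
      (hκ h' hh').1).mono (le_of_eq (by ring)), ?_, ?_⟩
    · intro h'' hh''
      rw [PMF.mem_support_bind_iff] at hh''
      obtain ⟨h', hh', hh''⟩ := hh''
      obtain ⟨o1, x1, m1, _, _⟩ := hs₁ h' hh'
      obtain ⟨o2, x2, m2⟩ := (hκ h' hh').2.1 h'' hh''
      exact ⟨o2.trans o1, fun x hx => (x2 x hx).trans (x1 x hx),
        fun i hi => (m2 i (by omega)).trans (m1 i hi)⟩
    · rw [expect_bind]
      calc _ ≤ expect ν₁ (fun h' => (if |(h'.mem j : ℝ) - N * (returnProb G j).toReal| ≤ c then 0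
            else 1) + d * ENNReal.ofReal (N / c ^ 2)) := by
            refine expect_mono fun h' hh' => ?_
            refine le_trans ?_ (add_le_add le_rfl (hκ h' hh').2.2)
            rw [← expect_const (κ h') (if |(h'.mem j : ℝ) - N * (returnProb G j).toReal| ≤ c then 0
              else 1), ← expect_add]
            refine expect_mono fun h'' hh'' => ?_
            have hm := ((hκ h' hh').2.1 h'' hh'').2.2 j (by omega)
            by_cases hA : |(h'.mem j : ℝ) - N * (returnProb G j).toReal| ≤ c
            · by_cases hB : ∀ i, j + 1 ≤ i → i < j + 1 + d →
                |(h''.mem i : ℝ) - N * (returnProb G i).toReal| ≤ c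
              · rw [if_pos]
                · exact zero_le
                · intro i hi hi'
                  rcases hi.eq_or_lt with rfl | hi
                  · rwa [hm]
                  · exact hB i hi (by omega)
              · rw [if_neg hB]
                split_ifs <;> simp
            · rw [if_neg hA]
              split_ifs <;> simp
        _ ≤ _ := by
            rw [expect_add, expect_const, Nat.cast_succ, add_mul, one_mul, add_comm]
            gcongr

open Classical in
theorem momentsProg_runs {N D : ℕ} {c : ℝ} (hc : 0 < c) {h : View V} (h1 : h.var 1 = 1)
    (h3 : h.var 3 = N) (h5 : h.var 5 = D) :
    ∃ ν, Runs G momentsProg (D * (N * (23 * D + 89) + 109) + 53) h ν ∧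
      (∀ h' ∈ ν.support, h'.out = h.out ∧ (∀ x, x < 10 → h'.var x = h.var x)) ∧
      expect ν (fun h' => if ∀ i < D,
        |(h'.mem i : ℝ) - N * (returnProb G i).toReal| ≤ c then 0 else 1) ≤
        D * ENNReal.ofReal (N / c ^ 2) := by
  obtain ⟨ν, hν, hs, hd⟩ := momentsLoop_runs (G := G) (N := N) hc D D 0
    (blockDen [.set 10 0, .set 11 0, .add 11 11 5] h) (by simp [blockDen, Instr.den, h1])
    (by simp [blockDen, Instr.den, h3]) (by simp [blockDen, Instr.den])
    (by simp [blockDen, Instr.den, h5]) (by omega)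
  refine ⟨ν, ((block_runs _ _).seq_pure hν).mono ?_, fun h' hh' => ?_, ?_⟩
  · simp only [blockTime, Instr.time]
    omega
  · obtain ⟨ho, hx, _⟩ := hs h' hh'
    refine ⟨by simpa [blockDen, Instr.den] using ho, fun x hx' => ?_⟩
    have : x ≠ 10 ∧ x ≠ 11 := by omega
    simpa [blockDen, Instr.den, this] using hx x hx'
  · simpa using hd

end Walk

/-! ### Evaluating kernels

A sequence `f` stands for the linear functional on polynomials that maps `y ^ j` to `f j`. Then
multiplication of the argument by a polynomial is an operation on sequences. -/

/-- One step of a three-term recurrence on sequences. -/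
def recurStep (e : Fin 4 → ℝ) (R P : ℕ → ℝ) (j : ℕ) : ℝ :=
  e 0 * R j + e 1 * R (j + 1) + e 2 * R (j + 2) + e 3 * P j

/-- The three-term recurrence with the initial values `0` and `f`. -/
def recur (e : Fin 4 → ℝ) (f : ℕ → ℝ) : ℕ → (ℕ → ℝ) × (ℕ → ℝ)
  | 0 => (f, 0)
  | t + 1 => (recurStep e (recur e f t).1 (recur e f t).2, (recur e f t).1)

/-- The coefficients of the recurrence at a grid point. -/
def coeff (M A : ℝ) : Fin 4 → ℝ :=
  -- For `c = 1 - (A/M - 2 + y)²/8` one has `4M² · 2c = 8M² - (A - 2M + M y)²`, whose coefficients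
  -- in `y` come first. With `R_t = (4M²)^t U_t(c)` the recurrence for `U` becomes `R_{t+1} = 4M² ·
  -- 2c · R_t - (4M²)² R_{t-1}`, hence the last entry.
  ![8 * M ^ 2 - (A - 2 * M) ^ 2, -((A - 2 * M) * (2 * M)), -M ^ 2, -(16 * M ^ 4)]

/-- The value of the kernel of order `k` at a grid point, for the functional given by `f`. -/
def kernelValue (k : ℕ) (M A : ℝ) (f : ℕ → ℝ) : ℝ :=
  -- Each round multiplies the functional by the scaled `U_k`; entry `0` of the result evaluates the
  -- functional at the scaled `U_k^4`.
  (fun f => (recur (coeff M A) f k).1)^[4] f 0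

/-- Copy the cells `0, …, D - 1` to `D, …, 2 D - 1`, where `D` is variable `5`. -/
def copyProg : Prog :=
  .seq (block [.set 19 0, .set 20 0, .add 20 20 5])
    (whilePos 20 (block [.load 21 19, .add 22 19 5, .store 22 21, .add 19 19 1, .sub 20 20 1]))

/-- Clear the cells `2 D, …, 3 D - 1`, where `D` is variable `5`. -/
def clearProg : Prog :=
  .seq (block [.set 19 0, .set 20 0, .add 20 20 5, .add 26 5 5, .set 21 0])
    (whilePos 20 (block [.add 22 19 26, .store 22 21, .add 19 19 1, .sub 20 20 1]))

/-- One step of the recurrence, in place. -/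
def passProg : Prog :=
  .seq (block [.set 19 0, .set 20 0, .add 20 20 5, .add 26 5 5])
    (whilePos 20 (block [.add 21 19 5, .load 27 21, .add 22 21 1, .load 28 22, .add 22 22 1,
      .load 29 22, .add 23 19 26, .load 30 23, .store 23 27, .set 31 0, .mulAcc 31 27 15,
      .mulAcc 31 28 16, .mulAcc 31 29 6, .mulAcc 31 30 7, .store 21 31, .add 19 19 1,
      .sub 20 20 1]))

/-! ### Invariants of the passes through memory. -/

section Passes

variable {V : Type*} [Fintype V] [DecidableEq V] [Nonempty V]
  {G : SimpleGraph V} [DecidableRel G.Adj]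

/-- The variables below `b` have the values `w`, the first `D` memory cells have the values `m`,
and the output is `o`. -/
structure Fixed (b : ℕ) (w : ℕ → ℤ) (D : ℕ) (m : ℕ → ℤ) (o : List Atom) (v : View V) : Prop where
  var : ∀ x < b, v.var x = w x
  mem : ∀ l < D, v.mem l = m l
  out : v.out = o

theorem lt_nineteen {x : ℕ} (hx : x < 19) : x ≠ 19 ∧ x ≠ 20 ∧ x ≠ 21 ∧ x ≠ 22 ∧ x ≠ 23 ∧ x ≠ 26 ∧
    x ≠ 27 ∧ x ≠ 28 ∧ x ≠ 29 ∧ x ≠ 30 ∧ x ≠ 31 := by omega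

/-- Memory consists of three blocks of length `D`: the moments, which are reused at every grid
point, the current sequence of the recurrence, and its predecessor. -/
theorem copyProg_triple {w : ℕ → ℤ} {D : ℕ} {m : ℕ → ℤ} {o : List Atom} (h1 : w 1 = 1)
    (h5 : w 5 = D) :
    Triple G (Fixed 19 w D m o) copyProg (D * 90 + 100)
      (fun v => Fixed 19 w D m o v ∧ ∀ l < D, v.mem (D + l) = m l) := by
  let I : ℕ → View V → Prop := fun i v => Fixed 19 w D m o v ∧ v.var 19 = i ∧ v.var 20 = D - i ∧
    ∀ l < i, v.mem (D + l) = m l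
  have hbody : ∀ i < D, Triple G (I i) (block [.load 21 19, .add 22 19 5, .store 22 21,
      .add 19 19 1, .sub 20 20 1]) 81 (I (i + 1)) := by
    refine fun i hi => .block fun v hv => ⟨?_, by simp [blockTime, Instr.time]⟩
    obtain ⟨hF, h19, h20, hl⟩ := hv
    have h1' : v.var 1 = 1 := by rw [hF.var _ (by norm_num), h1]
    have h5' : v.var 5 = D := by rw [hF.var _ (by norm_num), h5]
    have ht : ((i : ℤ) + D).toNat = D + i := by omega
    refine ⟨⟨fun x hx => ?_, fun l hl' => ?_, ?_⟩, ?_, ?_, fun l hl' => ?_⟩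
    · simp [blockDen, Instr.den, lt_nineteen hx, hF.var x hx]
    · have : l ≠ D + i := by omega
      simp [blockDen, Instr.den, h19, h5', ht, this, hF.mem l hl']
    · simp [blockDen, Instr.den, hF.out]
    · simp [blockDen, Instr.den, h19, h1']
    · simp [blockDen, Instr.den, h20, h1']
      ring
    · rcases Nat.lt_succ_iff_lt_or_eq.mp hl' with hl' | rfl
      · simp [blockDen, Instr.den, h19, h5', ht, hl'.ne, hl l hl']
      · simp [blockDen, Instr.den, h19, h5', ht, hF.mem l hi]
  have hinit : Triple G (Fixed 19 w D m o) (block [.set 19 0, .set 20 0, .add 20 20 5]) 49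
      (I 0) := by
    refine .block fun v hF => ⟨⟨⟨fun x hx => ?_, fun l hl' => ?_, ?_⟩, ?_, ?_, ?_⟩,
      by simp [blockTime, Instr.time]⟩
    · simp [blockDen, Instr.den, lt_nineteen hx, hF.var x hx]
    · simp [blockDen, Instr.den, hF.mem l hl']
    · simp [blockDen, Instr.den, hF.out]
    · simp [blockDen, Instr.den]
    · simp [blockDen, Instr.den, hF.var 5 (by norm_num), h5]
    · simp
  exact (hinit.seq (.whilePos I (fun i _ v hv => hv.2.2.1) hbody)).mono (fun _ h => h)
    (by ring_nf; omega) (fun v hv => ⟨hv.1, hv.2.2.2⟩)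

theorem clearProg_triple {w : ℕ → ℤ} {D : ℕ} {m : ℕ → ℤ} {o : List Atom} (h1 : w 1 = 1)
    (h5 : w 5 = D) {R : ℕ → ℝ} {L : ℕ} (hL : L ≤ D) :
    Triple G (fun v => Fixed 19 w D m o v ∧ ∀ l < L, (v.mem (D + l) : ℝ) = R l)
      clearProg (D * 90 + 100)
      (fun v => Fixed 19 w D m o v ∧ (∀ l < L, (v.mem (D + l) : ℝ) = R l) ∧
        ∀ l < L, (v.mem (2 * D + l) : ℝ) = 0) := by
  let I : ℕ → View V → Prop := fun i v => Fixed 19 w D m o v ∧ v.var 19 = i ∧ v.var 20 = D - i ∧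
    v.var 26 = 2 * D ∧ v.var 21 = 0 ∧ (∀ l < L, (v.mem (D + l) : ℝ) = R l) ∧
    ∀ l < i, v.mem (2 * D + l) = 0
  have hbody : ∀ i < D, Triple G (I i) (block [.add 22 19 26, .store 22 21, .add 19 19 1,
      .sub 20 20 1]) 65 (I (i + 1)) := by
    refine fun i hi => .block fun v hv => ⟨?_, by simp [blockTime, Instr.time]⟩
    obtain ⟨hF, h19, h20, h26, h21, hR, hl⟩ := hv
    have h1' : v.var 1 = 1 := by rw [hF.var _ (by norm_num), h1]
    have ht : ((i : ℤ) + 2 * D).toNat = 2 * D + i := by omega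
    refine ⟨⟨fun x hx => ?_, fun l hl' => ?_, ?_⟩, ?_, ?_, ?_, ?_, fun l hl' => ?_, fun l hl' => ?_⟩
    · simp [blockDen, Instr.den, lt_nineteen hx, hF.var x hx]
    · have : l ≠ 2 * D + i := by omega
      simp [blockDen, Instr.den, h19, h26, ht, this, hF.mem l hl']
    · simp [blockDen, Instr.den, hF.out]
    · simp [blockDen, Instr.den, h19, h1']
    · simp [blockDen, Instr.den, h20, h1']
      ring
    · simp [blockDen, Instr.den, h26]
    · simp [blockDen, Instr.den, h21]
    · have : D + l ≠ 2 * D + i := by omega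
      simp [blockDen, Instr.den, h19, h26, ht, this, hR l hl']
    · rcases Nat.lt_succ_iff_lt_or_eq.mp hl' with hl' | rfl
      · simp [blockDen, Instr.den, h19, h26, ht, hl'.ne, hl l hl']
      · simp [blockDen, Instr.den, h19, h26, ht, h21]
  have hinit : Triple G (fun v => Fixed 19 w D m o v ∧ ∀ l < L, (v.mem (D + l) : ℝ) = R l)
      (block [.set 19 0, .set 20 0, .add 20 20 5, .add 26 5 5, .set 21 0]) 81 (I 0) := by
    refine .block fun v ⟨hF, hR⟩ => ⟨⟨⟨fun x hx => ?_, fun l hl' => ?_, ?_⟩, ?_, ?_, ?_, ?_, ?_, ?_⟩,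
      by simp [blockTime, Instr.time]⟩
    · simp [blockDen, Instr.den, lt_nineteen hx, hF.var x hx]
    · simp [blockDen, Instr.den, hF.mem l hl']
    · simp [blockDen, Instr.den, hF.out]
    · simp [blockDen, Instr.den]
    · simp [blockDen, Instr.den, hF.var 5 (by norm_num), h5]
    · simp [blockDen, Instr.den, hF.var 5 (by norm_num), h5, two_mul]
    · simp [blockDen, Instr.den]
    · simpa [blockDen, Instr.den] using hR
    · simp
  exact (hinit.seq (.whilePos I (fun i _ v hv => hv.2.2.1) hbody)).mono (fun _ h => h)
    (by ring_nf; omega) (fun v hv => ⟨hv.1, hv.2.2.2.2.2.1, fun l hl => by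
      rw [hv.2.2.2.2.2.2 l (by omega)]; simp⟩)

/-- Going upwards, entry `l` needs only the entries `l`, `l + 1`, `l + 2`, which are not yet
overwritten. The last two valid entries lack successors, so the valid prefix shrinks by two. The
cost involves only the coefficients, bounded by `E`, because they and not the large sequence entries
are the repetition counts in `mulAcc`. -/
theorem passProg_triple {w : ℕ → ℤ} {D : ℕ} {m : ℕ → ℤ} {o : List Atom} (h1 : w 1 = 1)
    (h5 : w 5 = D) {e : Fin 4 → ℝ} (he0 : w 15 = e 0) (he1 : w 16 = e 1) (he2 : w 6 = e 2)
    (he3 : w 7 = e 3) {E : ℕ}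
    (hE : (w 15).natAbs + (w 16).natAbs + (w 6).natAbs + (w 7).natAbs ≤ E)
    {R P : ℕ → ℝ} {L : ℕ} (hL : L + 2 ≤ D) :
    Triple G (fun v => Fixed 19 w D m o v ∧ (∀ l < L + 2, (v.mem (D + l) : ℝ) = R l) ∧
        ∀ l < L + 2, (v.mem (2 * D + l) : ℝ) = P l)
      passProg (D * (6 * E + 300) + 100)
      (fun v => Fixed 19 w D m o v ∧ (∀ l < L, (v.mem (D + l) : ℝ) = recurStep e R P l) ∧
        ∀ l < L, (v.mem (2 * D + l) : ℝ) = R l) := by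
  let I : ℕ → View V → Prop := fun i v => Fixed 19 w D m o v ∧ v.var 19 = i ∧ v.var 20 = D - i ∧
    v.var 26 = 2 * D ∧
    (∀ l < i, l < L → (v.mem (D + l) : ℝ) = recurStep e R P l) ∧
    (∀ l < i, l < L → (v.mem (2 * D + l) : ℝ) = R l) ∧
    (∀ l, i ≤ l → l < L + 2 → (v.mem (D + l) : ℝ) = R l) ∧
    (∀ l, i ≤ l → l < L + 2 → (v.mem (2 * D + l) : ℝ) = P l)
  have hbody : ∀ i < D, Triple G (I i) (block [.add 21 19 5, .load 27 21, .add 22 21 1,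
      .load 28 22, .add 22 22 1, .load 29 22, .add 23 19 26, .load 30 23, .store 23 27, .set 31 0,
      .mulAcc 31 27 15, .mulAcc 31 28 16, .mulAcc 31 29 6, .mulAcc 31 30 7, .store 21 31,
      .add 19 19 1, .sub 20 20 1]) (6 * E + 273) (I (i + 1)) := by
    refine fun i hi => .block fun v hv => ?_
    obtain ⟨hF, h19, h20, h26, hA, hB, hC, hD⟩ := hv
    have h1' : v.var 1 = 1 := by rw [hF.var _ (by norm_num), h1]
    have h5' : v.var 5 = D := by rw [hF.var _ (by norm_num), h5]
    have h15 := hF.var 15 (by norm_num)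
    have h16 := hF.var 16 (by norm_num)
    have h6 := hF.var 6 (by norm_num)
    have h7 := hF.var 7 (by norm_num)
    have t0 : ((i : ℤ) + D).toNat = D + i := by omega
    have t1 : ((i : ℤ) + D + 1).toNat = D + i + 1 := by omega
    have t2 : ((i : ℤ) + D + 1 + 1).toNat = D + i + 2 := by omega
    have t3 : ((i : ℤ) + 2 * D).toNat = 2 * D + i := by omega
    refine ⟨?_, ?_⟩
    swap
    · simp [blockTime, Instr.time, Instr.den, h15, h16, h6, h7]
      omega
    have hm : (blockDen [.add 21 19 5, .load 27 21, .add 22 21 1,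
      .load 28 22, .add 22 22 1, .load 29 22, .add 23 19 26, .load 30 23, .store 23 27, .set 31 0,
      .mulAcc 31 27 15, .mulAcc 31 28 16, .mulAcc 31 29 6, .mulAcc 31 30 7, .store 21 31,
      .add 19 19 1, .sub 20 20 1] v).mem = Function.update (Function.update v.mem (2 * D + i)
        (v.mem (D + i))) (D + i) (v.mem (D + i) * w 15 + v.mem (D + i + 1) * w 16 +
          v.mem (D + i + 2) * w 6 + v.mem (2 * D + i) * w 7) := by
      simp [blockDen, Instr.den, h15, h16, h6, h7, h19, h5', h26, h1', t0, t1, t2, t3]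
    refine ⟨⟨fun x hx => ?_, fun l hl' => ?_, ?_⟩, ?_, ?_, ?_, fun l hl hl' => ?_,
      fun l hl hl' => ?_, fun l hl hl' => ?_, fun l hl hl' => ?_⟩
    · simp [blockDen, Instr.den, lt_nineteen hx, hF.var x hx]
    · rw [hm, Function.update_of_ne (by omega), Function.update_of_ne (by omega), hF.mem l hl']
    · simp [blockDen, Instr.den, hF.out]
    · simp [blockDen, Instr.den, h19, h1']
    · simp [blockDen, Instr.den, h20, h1']
      ring
    · simp [blockDen, Instr.den, h26]
    · rw [hm]
      rcases Nat.lt_succ_iff_lt_or_eq.mp hl with hl | rfl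
      · rw [Function.update_of_ne (by omega), Function.update_of_ne (by omega), hA l hl hl']
      · rw [Function.update_self]
        push_cast
        rw [hC l le_rfl (by omega), add_assoc D l 1, hC (l + 1) (by omega) (by omega),
          add_assoc D l 2, hC (l + 2) (by omega) (by omega), hD l le_rfl (by omega), he0, he1, he2,
          he3, recurStep]
        ring
    · rw [hm, Function.update_of_ne (by omega)]
      rcases Nat.lt_succ_iff_lt_or_eq.mp hl with hl | rfl
      · rw [Function.update_of_ne (by omega), hB l hl hl']
      · rw [Function.update_self, hC l le_rfl (by omega)]
    · rw [hm, Function.update_of_ne (by omega), Function.update_of_ne (by omega),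
        hC l (by omega) hl']
    · rw [hm, Function.update_of_ne (by omega), Function.update_of_ne (by omega),
        hD l (by omega) hl']
  have hinit : Triple G (fun v => Fixed 19 w D m o v ∧ (∀ l < L + 2, (v.mem (D + l) : ℝ) = R l) ∧
        ∀ l < L + 2, (v.mem (2 * D + l) : ℝ) = P l)
      (block [.set 19 0, .set 20 0, .add 20 20 5, .add 26 5 5]) 65 (I 0) := by
    refine .block fun v ⟨hF, hR, hP⟩ => ⟨⟨⟨fun x hx => ?_, fun l hl' => ?_, ?_⟩, ?_, ?_, ?_, ?_, ?_,
      ?_, ?_⟩, by simp [blockTime, Instr.time]⟩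
    · simp [blockDen, Instr.den, lt_nineteen hx, hF.var x hx]
    · simp [blockDen, Instr.den, hF.mem l hl']
    · simp [blockDen, Instr.den, hF.out]
    · simp [blockDen, Instr.den]
    · simp [blockDen, Instr.den, hF.var 5 (by norm_num), h5]
    · simp [blockDen, Instr.den, hF.var 5 (by norm_num), h5, two_mul]
    · simp
    · simp
    · simpa [blockDen, Instr.den] using hR
    · simpa [blockDen, Instr.den] using hP
  exact (hinit.seq (.whilePos I (fun i _ v hv => hv.2.2.1) hbody)).mono (fun _ h => h)
    (by ring_nf; omega) (fun v hv => ⟨hv.1, fun l hl => hv.2.2.2.2.1 l (by omega) hl,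
      fun l hl => hv.2.2.2.2.2.1 l (by omega) hl⟩)

end Passes

/-- Run the recurrence; the number of steps is variable `2`. -/
def recurProg : Prog :=
  .seq (block [.set 18 0, .add 18 18 2]) (whilePos 18 (.seq passProg (block [.sub 18 18 1])))

/-- Apply the operation on sequences that is given by the recurrence four times. -/
def kernelProg : Prog :=
  .seq (block [.set 17 4]) (whilePos 17 (.seq (.seq clearProg recurProg) (block [.sub 17 17 1])))

/-- Add to variable `13` the value of the kernel at the grid point with the index in variable
`12`, and pass to the next grid point. -/
def gridProg : Prog :=
  .seq (block [.sub 21 12 9, .set 22 0, .mulAcc 22 21 21, .sub 15 8 22, .set 22 0, .mulAcc 22 21 9,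
    .set 23 0, .sub 16 23 22]) (.seq (.seq copyProg kernelProg)
    (block [.load 21 5, .add 13 13 21, .add 12 12 1, .sub 14 14 1]))

/-- Emit the atom with the index in variable `10`. -/
def atomProg : Prog :=
  .seq (block [.set 13 0, .set 14 0, .add 14 14 3]) (.seq (whilePos 14 gridProg)
    (block [.add 22 2 2, .add 23 22 2, .tsub 21 23 10, .tsub 21 22 21, .emit 21 2 13, .add 10 10 1,
      .sub 11 11 1]))

/-- Emit all atoms. -/
def outputProg : Prog :=
  .seq (block [.set 10 0, .set 12 0, .set 11 0, .add 21 2 2, .add 11 21 21]) (whilePos 11 atomProg)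

/-! ### Correctness and cost of the deterministic phases. -/

section Output

variable {V : Type*} [Fintype V] [DecidableEq V] [Nonempty V]
  {G : SimpleGraph V} [DecidableRel G.Adj]

/-- Inner loops preserve a longer initial segment of the variables than outer ones; this freezes the
counter of an outer loop while an inner one runs. -/
theorem Fixed.succ {V : Type*} {b : ℕ} {w : ℕ → ℤ} {D : ℕ} {m : ℕ → ℤ} {o : List Atom} {v : View V} {c : ℤ}
    (h : Fixed b w D m o v) (hb : v.var b = c) : Fixed (b + 1) (Function.update w b c) D m o v where
  var x hx := by
    rcases Nat.lt_succ_iff_lt_or_eq.mp hx with hx | rfl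
    · rw [Function.update_of_ne hx.ne, h.var x hx]
    · rw [Function.update_self, hb]
  mem := h.mem
  out := h.out

theorem Fixed.mono {V : Type*} {b b' : ℕ} {w w' : ℕ → ℤ} {D : ℕ} {m : ℕ → ℤ} {o : List Atom} {v : View V}
    (h : Fixed b w D m o v) (hb : b' ≤ b) (hw : ∀ x < b', w x = w' x) : Fixed b' w' D m o v where
  var x hx := (h.var x (hx.trans_le hb)).trans (hw x hx)
  mem := h.mem
  out := h.out

theorem recurProg_triple {w : ℕ → ℤ} {D : ℕ} {m : ℕ → ℤ} {o : List Atom} (h1 : w 1 = 1)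
    (h5 : w 5 = D) {k : ℕ} (h2 : w 2 = k) {e : Fin 4 → ℝ} (he0 : w 15 = e 0) (he1 : w 16 = e 1)
    (he2 : w 6 = e 2) (he3 : w 7 = e 3) {E : ℕ}
    (hE : (w 15).natAbs + (w 16).natAbs + (w 6).natAbs + (w 7).natAbs ≤ E)
    {f : ℕ → ℝ} {L : ℕ} (hL : L ≤ D) (hk : 2 * k ≤ L) :
    Triple G (fun v => Fixed 18 w D m o v ∧ (∀ l < L, (v.mem (D + l) : ℝ) = f l) ∧
        ∀ l < L, (v.mem (2 * D + l) : ℝ) = 0)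
      recurProg (k * (D * (6 * E + 300) + 130) + 50)
      (fun v => Fixed 18 w D m o v ∧
        ∀ l, l + 2 * k < L → (v.mem (D + l) : ℝ) = (recur e f k).1 l) := by
  let I : ℕ → View V → Prop := fun t v => Fixed 18 w D m o v ∧ v.var 18 = k - t ∧
    (∀ l, l + 2 * t < L → (v.mem (D + l) : ℝ) = (recur e f t).1 l) ∧
    (∀ l, l + 2 * t < L → (v.mem (2 * D + l) : ℝ) = (recur e f t).2 l)
  have hbody : ∀ t < k, Triple G (I t) (.seq passProg (block [.sub 18 18 1]))
      (D * (6 * E + 300) + 100 + 17 + 1) (I (t + 1)) := by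
    intro t ht
    refine .seq (t := D * (6 * E + 300) + 100) (u := 17)
      (Q := fun v => Fixed 18 w D m o v ∧ v.var 18 = k - t ∧
      (∀ l, l + 2 * (t + 1) < L → (v.mem (D + l) : ℝ) = (recur e f (t + 1)).1 l) ∧
      (∀ l, l + 2 * (t + 1) < L → (v.mem (2 * D + l) : ℝ) = (recur e f (t + 1)).2 l)) ?_ ?_
    · refine (passProg_triple (w := Function.update w 18 (k - t)) (D := D) (m := m) (o := o)
        (by simpa) (by simpa) (e := e) (by simpa) (by simpa) (by simpa) (by simpa) (E := E)
        (by simpa) (R := (recur e f t).1) (P := (recur e f t).2) (L := L - 2 * t - 2)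
        (by omega)).mono (fun v hv => ⟨hv.1.succ hv.2.1, fun l hl => hv.2.2.1 l (by omega),
          fun l hl => hv.2.2.2 l (by omega)⟩) le_rfl (fun v hv => ⟨hv.1.mono (by omega) ?_, ?_,
          fun l hl => hv.2.1 l (by omega), fun l hl => hv.2.2 l (by omega)⟩)
      · intro x hx
        rw [Function.update_of_ne hx.ne]
      · rw [hv.1.var 18 (by omega), Function.update_self]
    · refine .block fun v ⟨hF, h18, hA, hB⟩ => ⟨⟨⟨fun x hx => ?_, fun l hl' => ?_, ?_⟩, ?_, ?_, ?_⟩,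
        by simp [blockTime, Instr.time]⟩
      · simp [blockDen, Instr.den, hx.ne, hF.var x hx]
      · simp [blockDen, Instr.den, hF.mem l hl']
      · simp [blockDen, Instr.den, hF.out]
      · simp [blockDen, Instr.den, h18, hF.var 1 (by norm_num), h1]
        ring
      · simpa [blockDen, Instr.den] using hA
      · simpa [blockDen, Instr.den] using hB
  have hinit : Triple G (fun v => Fixed 18 w D m o v ∧ (∀ l < L, (v.mem (D + l) : ℝ) = f l) ∧
        ∀ l < L, (v.mem (2 * D + l) : ℝ) = 0) (block [.set 18 0, .add 18 18 2]) 33 (I 0) := by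
    refine .block fun v ⟨hF, hA, hB⟩ => ⟨⟨⟨fun x hx => ?_, fun l hl' => ?_, ?_⟩, ?_, ?_, ?_⟩,
        by simp [blockTime, Instr.time]⟩
    · simp [blockDen, Instr.den, hx.ne, hF.var x hx]
    · simp [blockDen, Instr.den, hF.mem l hl']
    · simp [blockDen, Instr.den, hF.out]
    · simp [blockDen, Instr.den, hF.var 2 (by norm_num), h2]
    · simpa [blockDen, Instr.den, recur] using hA
    · simpa [blockDen, Instr.den, recur] using hB
  exact (hinit.seq (.whilePos I (fun i _ v hv => hv.2.1) hbody)).mono (fun _ h => h)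
    (by ring_nf; omega) (fun v hv => ⟨hv.1, hv.2.2.1⟩)

/-- Each of the four rounds shortens the valid prefix by `2k`, so the length `8k + 1` leaves exactly
entry `0`. -/
theorem kernelProg_triple {w : ℕ → ℤ} {k : ℕ} {m : ℕ → ℤ} {o : List Atom} (h1 : w 1 = 1)
    (h5 : w 5 = (8 * k + 1 : ℕ)) (h2 : w 2 = k) {e : Fin 4 → ℝ} (he0 : w 15 = e 0)
    (he1 : w 16 = e 1) (he2 : w 6 = e 2) (he3 : w 7 = e 3) {E : ℕ}
    (hE : (w 15).natAbs + (w 16).natAbs + (w 6).natAbs + (w 7).natAbs ≤ E)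
    {f : ℕ → ℝ} (hf : ∀ l < 8 * k + 1, (m l : ℝ) = f l) :
    Triple G (Fixed 17 w (8 * k + 1) m o) (.seq copyProg kernelProg)
      (4 * (k * ((8 * k + 1) * (6 * E + 300) + 130) + (8 * k + 1) * 90 + 200) +
        (8 * k + 1) * 90 + 150)
      (fun v => Fixed 17 w (8 * k + 1) m o v ∧
        (v.mem (8 * k + 1) : ℝ) = (fun f => (recur e f k).1)^[4] f 0) := by
  set D := 8 * k + 1 with hD
  set T : (ℕ → ℝ) → (ℕ → ℝ) := fun f => (recur e f k).1
  let I : ℕ → View V → Prop := fun r v => Fixed 17 w D m o v ∧ v.var 17 = (4 : ℕ) - r ∧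
    (∀ l, l + 2 * k * r < D → (v.mem (D + l) : ℝ) = T^[r] f l)
  have hcopy : Triple G (Fixed 17 w D m o) copyProg (D * 90 + 100)
      (fun v => Fixed 17 w D m o v ∧ ∀ l < D, (v.mem (D + l) : ℝ) = f l) := by
    intro v hv
    have := copyProg_triple (G := G) (w := Function.update (Function.update w 17 (v.var 17)) 18
      (v.var 18)) (D := D) (m := m) (o := o) (by simpa) (by simpa) v ((hv.succ rfl).succ rfl)
    obtain ⟨v', hr, hF, hm⟩ := this
    refine ⟨v', hr, hF.mono (by omega) fun x hx => ?_, fun l hl => by rw [hm l hl, hf l hl]⟩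
    rw [Function.update_of_ne (by omega), Function.update_of_ne (by omega)]
  have hbody : ∀ r < 4, Triple G (I r) (.seq (.seq clearProg recurProg) (block [.sub 17 17 1]))
      ((D * 90 + 100) + (k * (D * (6 * E + 300) + 130) + 50) + 1 + 17 + 1) (I (r + 1)) := by
    intro r hr
    have hrk : 2 * k * r ≤ 6 * k := by
      have : r ≤ 3 := by omega
      nlinarith
    have hrk' : 2 * k * (r + 1) = 2 * k * r + 2 * k := by ring
    refine .seq (t := (D * 90 + 100) + (k * (D * (6 * E + 300) + 130) + 50) + 1) (u := 17)
      (Q := fun v => Fixed 17 w D m o v ∧ v.var 17 = (4 : ℕ) - r ∧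
      (∀ l, l + 2 * k * (r + 1) < D → (v.mem (D + l) : ℝ) = T^[r + 1] f l)) ?_ ?_
    · refine .seq (t := D * 90 + 100) (u := k * (D * (6 * E + 300) + 130) + 50)
        (Q := fun v => Fixed 18 (Function.update w 17 ((4 : ℕ) - r)) D m o v ∧
        (∀ l < D - 2 * k * r, (v.mem (D + l) : ℝ) = T^[r] f l) ∧
        ∀ l < D - 2 * k * r, (v.mem (2 * D + l) : ℝ) = 0) ?_ ?_
      · intro v hv
        have := clearProg_triple (G := G) (w := Function.update (Function.update w 17 ((4 : ℕ) - r))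
          18 (v.var 18)) (D := D) (m := m) (o := o) (by simpa) (by simpa) (R := T^[r] f)
          (L := D - 2 * k * r) (by omega) v
          ⟨(hv.1.succ hv.2.1).succ rfl, fun l hl => hv.2.2 l (by omega)⟩
        obtain ⟨v', hr, hF, hm⟩ := this
        refine ⟨v', hr, hF.mono (by omega) fun x hx => ?_, hm⟩
        rw [Function.update_of_ne (by omega)]
      · refine (recurProg_triple (w := Function.update w 17 ((4 : ℕ) - r)) (D := D) (m := m)
          (o := o) (by simpa) (by simpa) (k := k) (by simpa) (e := e) (by simpa) (by simpa)
          (by simpa) (by simpa) (E := E) (by simpa) (f := T^[r] f) (L := D - 2 * k * r) (by omega)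
          (by omega)).mono (fun _ h => h) le_rfl (fun v hv => ⟨hv.1.mono (by omega) ?_, ?_,
          fun l hl => ?_⟩)
        · intro x hx
          rw [Function.update_of_ne (by omega)]
        · rw [hv.1.var 17 (by omega), Function.update_self]
        · rw [hv.2 l (by omega), Function.iterate_succ_apply']
    · refine .block fun v ⟨hF, h18, hA⟩ => ⟨⟨⟨fun x hx => ?_, fun l hl' => ?_, ?_⟩, ?_, ?_⟩,
        by simp [blockTime, Instr.time]⟩
      · simp [blockDen, Instr.den, hx.ne, hF.var x hx]
      · simp [blockDen, Instr.den, hF.mem l hl']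
      · simp [blockDen, Instr.den, hF.out]
      · simp [blockDen, Instr.den, h18, hF.var 1 (by norm_num), h1]
        ring
      · simpa [blockDen, Instr.den] using hA
  have hinit : Triple G (fun v => Fixed 17 w D m o v ∧ (∀ l < D, (v.mem (D + l) : ℝ) = f l))
      (block [.set 17 4]) 17 (I 0) := by
    refine .block fun v ⟨hF, hA⟩ => ⟨⟨⟨fun x hx => ?_, fun l hl' => ?_, ?_⟩, ?_, ?_⟩,
        by simp [blockTime, Instr.time]⟩
    · simp [blockDen, Instr.den, hx.ne, hF.var x hx]
    · simp [blockDen, Instr.den, hF.mem l hl']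
    · simp [blockDen, Instr.den, hF.out]
    · simp [blockDen, Instr.den]
    · simpa [blockDen, Instr.den] using hA
  exact (hcopy.seq (hinit.seq (.whilePos I (fun i _ v hv => hv.2.1) hbody))).mono (fun _ h => h)
    (by ring_nf; omega) (fun v hv => ⟨hv.1, by simpa using hv.2.2 0 (by omega)⟩)

/-- The values of the variables that are fixed before the queries. -/
structure Params (k B : ℕ) (w : ℕ → ℤ) : Prop where
  one : w 1 = 1
  order : w 2 = k
  block : w 3 = B
  scale : w 4 = (B * k : ℕ)
  length : w 5 = (8 * k + 1 : ℕ)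
  coeff₂ : w 6 = -((B * k : ℕ) : ℤ) ^ 2
  coeff₃ : w 7 = -(16 * ((B * k : ℕ) : ℤ) ^ 4)
  eight : w 8 = 8 * ((B * k : ℕ) : ℤ) ^ 2
  two : w 9 = 2 * ((B * k : ℕ) : ℤ)

/-- A bound for the running time of `gridProg`. -/
def gridTime (k B : ℕ) : ℕ :=
  4 * (k * ((8 * k + 1) * (6 * (40 * (B * k) ^ 4) + 300) + 130) + (8 * k + 1) * 90 + 200) +
    (8 * k + 1) * 90 + 500 + 24 * (B * k)

theorem gridProg_triple {w : ℕ → ℤ} {k B : ℕ} {m : ℕ → ℤ} {o : List Atom} (hw : Params k B w)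
    {f : ℕ → ℝ} (hf : ∀ l < 8 * k + 1, (m l : ℝ) = f l) {A : ℕ} {c b : ℤ}
    (hA : A ≤ 4 * (B * k)) :
    Triple G (fun v => Fixed 12 w (8 * k + 1) m o v ∧ v.var 12 = A ∧ v.var 13 = c ∧ v.var 14 = b)
      gridProg (gridTime k B)
      (fun v => Fixed 12 w (8 * k + 1) m o v ∧ v.var 12 = (A + 1 : ℕ) ∧
        (v.var 13 : ℝ) = c + kernelValue k (B * k : ℕ) A f ∧ v.var 14 = b - 1) := by
  obtain ⟨M, hM⟩ : ∃ M, M = B * k := ⟨_, rfl⟩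
  rw [gridTime, ← hM]
  rw [← hM] at hA
  have hw4 := hw.scale
  have hw6 := hw.coeff₂
  have hw7 := hw.coeff₃
  have hw8 := hw.eight
  have hw9 := hw.two
  rw [← hM] at hw4 hw6 hw7 hw8 hw9
  rintro v ⟨hF, h12, h13, h14⟩
  set l₁ : List Instr := [.sub 21 12 9, .set 22 0, .mulAcc 22 21 21, .sub 15 8 22, .set 22 0,
    .mulAcc 22 21 9, .set 23 0, .sub 16 23 22] with hl₁
  have v1 : v.var 1 = 1 := by rw [hF.var _ (by norm_num), hw.one]
  have v2 : v.var 2 = k := by rw [hF.var _ (by norm_num), hw.order]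
  have v5 : v.var 5 = (8 * k + 1 : ℕ) := by rw [hF.var _ (by norm_num), hw.length]
  have v6 : v.var 6 = -(M : ℤ) ^ 2 := by rw [hF.var _ (by norm_num), hw6]
  have v7 : v.var 7 = -(16 * (M : ℤ) ^ 4) := by rw [hF.var _ (by norm_num), hw7]
  have v8 : v.var 8 = 8 * (M : ℤ) ^ 2 := by rw [hF.var _ (by norm_num), hw8]
  have v9 : v.var 9 = 2 * (M : ℤ) := by rw [hF.var _ (by norm_num), hw9]
  have w15 : (blockDen l₁ v).var 15 = 8 * (M : ℤ) ^ 2 - ((A : ℤ) - 2 * M) ^ 2 := by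
    simp [hl₁, blockDen, Instr.den, v8, v9, h12, sq]
  have w16 : (blockDen l₁ v).var 16 = -(((A : ℤ) - 2 * M) * (2 * M)) := by
    simp [hl₁, blockDen, Instr.den, v9, h12]
  have w6 : (blockDen l₁ v).var 6 = -(M : ℤ) ^ 2 := by
    simp [hl₁, blockDen, Instr.den, v6]
  have w7 : (blockDen l₁ v).var 7 = -(16 * (M : ℤ) ^ 4) := by
    simp [hl₁, blockDen, Instr.den, v7]
  have wle : ∀ x < 15, (blockDen l₁ v).var x = v.var x := by
    intro x hx
    have : x ≠ 15 ∧ x ≠ 16 ∧ x ≠ 21 ∧ x ≠ 22 ∧ x ≠ 23 := by omega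
    simp [hl₁, blockDen, Instr.den, this]
  have hAM : |(A : ℤ) - 2 * M| ≤ 2 * M := by
    rw [abs_le]
    constructor <;> push_cast [← Int.ofNat_le] at hA ⊢ <;> omega
  -- The four coefficients are at most `8M²`, `4M²`, `M²` and `16M⁴` in absolute value.
  have hE : ((blockDen l₁ v).var 15).natAbs + ((blockDen l₁ v).var 16).natAbs +
      ((blockDen l₁ v).var 6).natAbs + ((blockDen l₁ v).var 7).natAbs ≤ 40 * M ^ 4 := by
    rw [w15, w16, w6, w7]
    zify
    have h2 : ((A : ℤ) - 2 * M) ^ 2 ≤ (2 * M) ^ 2 := sq_le_sq.mpr (by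
      rwa [abs_of_nonneg (by positivity : (0 : ℤ) ≤ 2 * M)])
    have h3 : |-(((A : ℤ) - 2 * M) * (2 * M))| ≤ 2 * M * (2 * M) := by
      rw [abs_neg, abs_mul, abs_of_nonneg (by positivity : (0 : ℤ) ≤ 2 * M)]
      gcongr
    have h4 : (M : ℤ) ^ 2 ≤ M ^ 4 := by
      rcases Nat.eq_zero_or_pos M with h | h
      · simp [h]
      · exact pow_le_pow_right₀ (by exact_mod_cast h) (by norm_num)
    have h5 : |-(M : ℤ) ^ 2| = M ^ 2 := by rw [abs_neg, abs_of_nonneg (by positivity)]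
    have h6 : |-(16 * (M : ℤ) ^ 4)| = 16 * (M : ℤ) ^ 4 := by rw [abs_neg, abs_of_nonneg (by positivity)]
    have h7 : |8 * (M : ℤ) ^ 2 - ((A : ℤ) - 2 * M) ^ 2| ≤ 8 * (M : ℤ) ^ 2 := by
      rw [abs_of_nonneg (by nlinarith)]
      linarith [sq_nonneg ((A : ℤ) - 2 * M)]
    rw [h5, h6]
    nlinarith
  obtain ⟨v', hr, hF', hm'⟩ := kernelProg_triple (G := G) (w := (blockDen l₁ v).var) (k := k)
    (m := m) (o := o) (by rw [wle _ (by norm_num), v1]) (by rw [wle _ (by norm_num), v5])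
    (by rw [wle _ (by norm_num), v2]) (e := coeff M A)
    (by rw [w15]; simp [coeff]) (by rw [w16]; simp [coeff]) (by rw [w6]; simp [coeff])
    (by rw [w7]; simp [coeff]) hE hf (blockDen l₁ v) ⟨fun _ _ => rfl,
      fun l hl => by simp [hl₁, blockDen, Instr.den, hF.mem l hl],
      by simp [hl₁, blockDen, Instr.den, hF.out]⟩
  refine ⟨blockDen [.load 21 5, .add 13 13 21, .add 12 12 1, .sub 14 14 1] v',
    ((block_runs _ _).seq_pure (hr.seq_pure (block_runs _ _))).mono ?_, ?_⟩
  · have h1 : ((A : ℤ) - 2 * M).natAbs ≤ 2 * M := by omega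
    have h2 : (2 * (M : ℤ)).natAbs ≤ 2 * M := by omega
    simp only [hl₁, blockTime, Instr.time, Instr.den]
    simp only [Function.update_self, ne_eq, Nat.reduceEqDiff, not_false_eq_true,
      Function.update_of_ne, h12, v9]
    omega
  · have hv' : ∀ x < 15, v'.var x = v.var x := fun x hx => by rw [hF'.var x (by omega), wle x hx]
    have t5 : (v.var 5).toNat = 8 * k + 1 := by rw [v5, Int.toNat_natCast]
    refine ⟨⟨fun x hx => ?_, fun l hl => ?_, ?_⟩, ?_, ?_, ?_⟩
    · have : x ≠ 12 ∧ x ≠ 13 ∧ x ≠ 14 ∧ x ≠ 21 := by omega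
      simp [blockDen, Instr.den, this, hv' x (by omega), hF.var x hx]
    · simp [blockDen, Instr.den, hF'.mem l hl]
    · simp [blockDen, Instr.den, hF'.out]
    · simp [blockDen, Instr.den, hv', h12, v1]
    · simp [blockDen, Instr.den, hv', h13, t5, hm', kernelValue]
    · simp [blockDen, Instr.den, hv', h14, v1]

/-- The total value of the kernel over the grid points that belong to atom `i`. -/
noncomputable def atomValue (k B : ℕ) (f : ℕ → ℝ) (i : ℕ) : ℝ :=
  ∑ b ∈ Finset.range B, kernelValue k (B * k : ℕ) (i * B + b : ℕ) f

/-- The atoms that are emitted. -/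
noncomputable def outputAtom (k B : ℕ) (f : ℕ → ℝ) (i : ℕ) : Atom :=
  ⟨min (i - k) (2 * k), k, ⌊atomValue k B f i⌋₊⟩

theorem atomProg_triple {w : ℕ → ℤ} {k B : ℕ} {m : ℕ → ℤ} {o : List Atom} (hw : Params k B w)
    {f : ℕ → ℝ} (hf : ∀ l < 8 * k + 1, (m l : ℝ) = f l) {i : ℕ} (hi : i < 4 * k) {b : ℤ} :
    Triple G (fun v => Fixed 10 w (8 * k + 1) m o v ∧ v.var 10 = i ∧ v.var 11 = b ∧
        v.var 12 = (i * B : ℕ))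
      atomProg (B * (gridTime k B + 4) + 200)
      (fun v => Fixed 10 w (8 * k + 1) m (o ++ [outputAtom k B f i]) v ∧ v.var 10 = (i + 1 : ℕ) ∧
        v.var 11 = b - 1 ∧ v.var 12 = ((i + 1) * B : ℕ)) := by
  let w' := Function.update (Function.update w 10 i) 11 b
  have hw' : Params k B w' := by
    constructor <;> simp only [w', ne_eq, Nat.reduceEqDiff, not_false_eq_true, Function.update_of_ne]
    exacts [hw.one, hw.order, hw.block, hw.scale, hw.length, hw.coeff₂, hw.coeff₃, hw.eight, hw.two]
  let I : ℕ → View V → Prop := fun t v => Fixed 12 w' (8 * k + 1) m o v ∧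
    v.var 14 = B - t ∧ v.var 12 = (i * B + t : ℕ) ∧
    (v.var 13 : ℝ) = ∑ b ∈ Finset.range t, kernelValue k (B * k : ℕ) (i * B + b : ℕ) f
  have hbody : ∀ t < B, Triple G (I t) gridProg (gridTime k B) (I (t + 1)) := by
    rintro t ht v ⟨hF, h14, h12, h13⟩
    have hA : i * B + t ≤ 4 * (B * k) := by nlinarith
    obtain ⟨v', hr, hF', h12', h13', h14'⟩ := gridProg_triple (G := G) hw' hf (c := v.var 13) hA v
      ⟨hF, h12, rfl, h14⟩
    refine ⟨v', hr, hF', ?_, h12', ?_⟩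
    · rw [h14']
      push_cast
      ring
    · rw [h13', h13, Finset.sum_range_succ]
  have hinit : Triple G (fun v => Fixed 10 w (8 * k + 1) m o v ∧ v.var 10 = i ∧ v.var 11 = b ∧
        v.var 12 = (i * B : ℕ)) (block [.set 13 0, .set 14 0, .add 14 14 3]) 49 (I 0) := by
    refine .block fun v ⟨hF, h10, h11, h12⟩ => ⟨?_, by simp [blockTime, Instr.time]⟩
    have hF' := (hF.succ h10).succ h11
    refine ⟨⟨fun x hx => ?_, fun l hl => ?_, ?_⟩, ?_, ?_, ?_⟩
    · have : x ≠ 13 ∧ x ≠ 14 := by omega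
      simp only [blockDen, Instr.den]
      simpa [this] using hF'.var x hx
    · simp [blockDen, Instr.den, hF.mem l hl]
    · simp [blockDen, Instr.den, hF.out]
    · simp [blockDen, Instr.den, hF.var 3 (by norm_num), hw.block]
    · simp [blockDen, Instr.den, h12]
    · simp [blockDen, Instr.den]
  have hend : Triple G (I B) (block [.add 22 2 2, .add 23 22 2, .tsub 21 23 10, .tsub 21 22 21,
      .emit 21 2 13, .add 10 10 1, .sub 11 11 1]) 113
      (fun v => Fixed 10 w (8 * k + 1) m (o ++ [outputAtom k B f i]) v ∧ v.var 10 = (i + 1 : ℕ) ∧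
        v.var 11 = b - 1 ∧ v.var 12 = ((i + 1) * B : ℕ)) := by
    refine .block fun v ⟨hF, _, h12, h13⟩ => ⟨?_, by simp [blockTime, Instr.time]⟩
    have v1 : v.var 1 = 1 := by rw [hF.var 1 (by norm_num), hw'.one]
    have v2 : v.var 2 = k := by rw [hF.var 2 (by norm_num), hw'.order]
    have v10 : v.var 10 = i := by rw [hF.var 10 (by norm_num)]; simp [w']
    have v11 : v.var 11 = b := by rw [hF.var 11 (by norm_num)]; simp [w']
    refine ⟨⟨fun x hx => ?_, fun l hl => ?_, ?_⟩, ?_, ?_, ?_⟩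
    · have : x ≠ 10 ∧ x ≠ 11 ∧ x ≠ 21 ∧ x ≠ 22 ∧ x ≠ 23 := by omega
      simp [blockDen, Instr.den, this, hF.var x (by omega), w']
    · simp [blockDen, Instr.den, hF.mem l hl]
    -- Subtracting `3k - i` from `2k`, both times with truncation, clips `i - k` to `[0, 2k]`.
    · have h1 : (max ((k : ℤ) + k - max ((k : ℤ) + k + k - i) 0) 0).toNat =
          min (i - k) (2 * k) := by omega
      -- The value is an integer, so the floor loses nothing; both sides send negative values to
      -- zero.
      have h2 : (v.var 13).toNat = ⌊atomValue k B f i⌋₊ := by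
        rw [atomValue, ← h13, ← Int.floor_toNat, Int.floor_intCast]
      simp [blockDen, Instr.den, hF.out, v2, v10, outputAtom, h1, h2]
    · simp [blockDen, Instr.den, v10, v1]
    · simp [blockDen, Instr.den, v11, v1]
    · simp [blockDen, Instr.den, h12]
      ring
  exact (hinit.seq ((Triple.whilePos I (fun i _ v hv => hv.2.1) hbody).seq hend)).mono (fun _ h => h)
    (by ring_nf; omega) (fun _ h => h)

/-- A bound for the running time of `outputProg`. -/
def outputTime (k B : ℕ) : ℕ :=
  4 * k * (B * (gridTime k B + 4) + 204) + 100

theorem outputProg_triple {w : ℕ → ℤ} {k B : ℕ} {m : ℕ → ℤ} (hw : Params k B w)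
    {f : ℕ → ℝ} (hf : ∀ l < 8 * k + 1, (m l : ℝ) = f l) :
    Triple G (Fixed 10 w (8 * k + 1) m []) outputProg (outputTime k B)
      (fun v => v.out = (List.range (4 * k)).map (outputAtom k B f)) := by
  let I : ℕ → View V → Prop := fun i v =>
    Fixed 10 w (8 * k + 1) m ((List.range i).map (outputAtom k B f)) v ∧ v.var 10 = i ∧
    v.var 11 = (4 * k : ℕ) - i ∧ v.var 12 = (i * B : ℕ)
  have hbody : ∀ i < 4 * k, Triple G (I i) atomProg (B * (gridTime k B + 4) + 200)
      (I (i + 1)) := fun i hi =>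
    (atomProg_triple hw hf hi (b := (4 * k : ℕ) - i)).mono (fun v hv => hv) le_rfl
      (fun v hv => ⟨by rw [List.range_succ, List.map_append]; exact hv.1, hv.2.1,
        by rw [hv.2.2.1]; push_cast; ring, hv.2.2.2⟩)
  have hinit : Triple G (Fixed 10 w (8 * k + 1) m []) (block [.set 10 0, .set 12 0, .set 11 0,
      .add 21 2 2, .add 11 21 21]) 81 (I 0) := by
    refine .block fun v hF => ⟨?_, by simp [blockTime, Instr.time]⟩
    refine ⟨⟨fun x hx => ?_, fun l hl => ?_, ?_⟩, ?_, ?_, ?_⟩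
    · have : x ≠ 10 ∧ x ≠ 11 ∧ x ≠ 12 ∧ x ≠ 21 := by omega
      simp [blockDen, Instr.den, this, hF.var x hx]
    · simp [blockDen, Instr.den, hF.mem l hl]
    · simp [blockDen, Instr.den, hF.out]
    · simp [blockDen, Instr.den]
    · simp [blockDen, Instr.den, hF.var 2 (by norm_num), hw.order]
      ring
    · simp [blockDen, Instr.den]
  exact (hinit.seq (.whilePos I (fun i _ v hv => hv.2.2.1) hbody)).mono (fun _ h => h)
    (by rw [outputTime]; ring_nf; omega) (fun v hv => hv.1.out)

/-- Compute the parameters from the accuracy. -/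
def paramsProg : Prog :=
  .seq (block [.set 1 1, .set 7 8192, .set 2 0, .mulAcc 2 7 0, .set 3 1, .set 8 32, .set 9 0,
    .mulAcc 9 8 2]) (.seq (whilePos 9 (block [.add 3 3 3, .sub 9 9 1]))
    (block [.set 4 0, .mulAcc 4 3 2, .set 5 1, .set 8 8, .mulAcc 5 8 2, .set 20 0, .mulAcc 20 4 4,
      .set 21 0, .sub 6 21 20, .set 8 0, .set 22 8, .mulAcc 8 20 22, .set 23 0, .mulAcc 23 20 20,
      .set 22 16, .set 24 0, .mulAcc 24 23 22, .sub 7 21 24, .add 9 4 4]))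

/-- The choice of `k` makes the final error `8192/k` equal to `1/n`. `B` is reached by `32k`
doublings, as the machine cannot multiply. -/
theorem paramsProg_triple (n : ℕ) {k B : ℕ} (hk : k = 8192 * n) (hB : B = 2 ^ (32 * k)) :
    Triple G (fun v => v.var 0 = n ∧ v.out = []) paramsProg
      (6 * n + 1000 + 2000 * k + 6 * (B * k) + 6 * (B * k) ^ 2)
      (fun v => Params k B v.var ∧ v.out = []) := by
  let I : ℕ → View V → Prop := fun i v => v.var 1 = 1 ∧ v.var 2 = k ∧ v.var 3 = 2 ^ i ∧
    v.var 9 = (32 * k : ℕ) - i ∧ v.out = []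
  have hinit : Triple G (fun v => v.var 0 = n ∧ v.out = []) (block [.set 1 1, .set 7 8192, .set 2 0,
      .mulAcc 2 7 0, .set 3 1, .set 8 32, .set 9 0, .mulAcc 9 8 2]) (6 * n + 6 * k + 129) (I 0) := by
    refine .block fun v ⟨h0, ho⟩ => ⟨?_, ?_⟩
    · simp [I, blockDen, Instr.den, h0, hk, ho]
    · simp [blockTime, Instr.time, Instr.den, h0, hk]
      omega
  have hbody : ∀ i < 32 * k, Triple G (I i) (block [.add 3 3 3, .sub 9 9 1]) 33 (I (i + 1)) := by
    refine fun i hi => .block fun v ⟨h1, h2, h3, h9, ho⟩ => ⟨?_, by simp [blockTime, Instr.time]⟩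
    simp [I, blockDen, Instr.den, h1, h2, h3, h9, ho]
    constructor <;> ring
  have hend : Triple G (I (32 * k)) (block [.set 4 0, .mulAcc 4 3 2, .set 5 1, .set 8 8,
      .mulAcc 5 8 2, .set 20 0, .mulAcc 20 4 4,
      .set 21 0, .sub 6 21 20, .set 8 0, .set 22 8, .mulAcc 8 20 22, .set 23 0, .mulAcc 23 20 20,
      .set 22 16, .set 24 0, .mulAcc 24 23 22, .sub 7 21 24, .add 9 4 4])
      (12 * k + 6 * (B * k) + 6 * (B * k) ^ 2 + 500) (fun v => Params k B v.var ∧ v.out = []) := by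
    refine .block fun v ⟨h1, h2, h3, h9, ho⟩ => ⟨⟨?_, ?_⟩, ?_⟩
    · have h3' : v.var 3 = B := by rw [h3, hB]; simp
      constructor <;> simp [blockDen, Instr.den, h1, h2, h3'] <;> ring
    · simp [blockDen, Instr.den, ho]
    · have h3' : v.var 3 = B := by rw [h3, hB]; simp
      simp [blockTime, Instr.time, Instr.den, h2, h3', Int.natAbs_mul]
      ring_nf
      omega
  exact (hinit.seq ((Triple.whilePos I (fun i _ v hv => hv.2.2.2.1) hbody).seq hend)).mono
    (fun _ h => h) (by ring_nf; omega) (fun _ h => h)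

end Output

/-! ### Return probabilities and eigenvalues -/

section Spectral

variable {V : Type*} [Fintype V] [DecidableEq V] (G : SimpleGraph V) [DecidableRel G.Adj]

/-- The transition matrix `D⁻¹ A` of the random walk. -/
noncomputable def transition : Matrix V V ℝ :=
  Matrix.diagonal (fun v => (G.degree v : ℝ)⁻¹) * G.adjMatrix ℝ

theorem transition_apply (v w : V) :
    transition G v w = if G.Adj v w then (G.degree v : ℝ)⁻¹ else 0 := by
  rw [transition, Matrix.diagonal_mul, SimpleGraph.adjMatrix_apply, mul_ite, mul_one, mul_zero]

theorem transition_nonneg (v w : V) : 0 ≤ transition G v w := by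
  rw [transition_apply]
  split_ifs <;> positivity

theorem transition_pow_nonneg (t : ℕ) (v w : V) : 0 ≤ (transition G ^ t) v w := by
  induction t generalizing v with
  | zero =>
    rw [pow_zero, Matrix.one_apply]
    split_ifs <;> norm_num
  | succ t ih =>
    rw [pow_succ', Matrix.mul_apply]
    exact Finset.sum_nonneg fun i _ => mul_nonneg (transition_nonneg G v i) (ih i)

variable {G}

theorem neighborDist_some (hG : ∀ v, 0 < G.degree v) (v w : V) :
    neighborDist G (some v) (some w) = ENNReal.ofReal (transition G v w) := by
  have h : (G.neighborFinset v).Nonempty := by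
    rw [← Finset.card_pos, SimpleGraph.card_neighborFinset_eq_degree]
    exact hG v
  rw [neighborDist, dif_pos h, PMF.map_apply, tsum_eq_single w]
  · rw [if_pos rfl, PMF.uniformOfFinset_apply, transition_apply,
      SimpleGraph.card_neighborFinset_eq_degree]
    simp only [SimpleGraph.mem_neighborFinset]
    split_ifs with hvw
    · rw [ENNReal.ofReal_inv_of_pos (by exact_mod_cast hG v), ENNReal.ofReal_natCast]
    · simp
  · intro w' hw'
    rw [if_neg]
    simpa using hw'.symm

theorem neighborDist_none (hG : ∀ v, 0 < G.degree v) (v : V) :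
    neighborDist G (some v) none = 0 := by
  have h : (G.neighborFinset v).Nonempty := by
    rw [← Finset.card_pos, SimpleGraph.card_neighborFinset_eq_degree]
    exact hG v
  rw [neighborDist, dif_pos h, PMF.map_apply]
  simp

theorem walkDist_some [Nonempty V] (hG : ∀ v, 0 < G.degree v) (t : ℕ) (v w : V) :
    walkDist G t (some v) (some w) = ENNReal.ofReal ((transition G ^ t) v w) := by
  induction t generalizing v with
  | zero =>
    rw [walkDist, pow_zero, Matrix.one_apply, PMF.pure_apply]
    by_cases h : v = w
    · simp [h]
    · simp [h, Ne.symm h]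
  | succ t ih =>
    rw [walkDist, PMF.bind_apply, tsum_fintype, Fintype.sum_option, neighborDist_none hG, zero_mul,
      zero_add, pow_succ', Matrix.mul_apply, ENNReal.ofReal_sum_of_nonneg
        fun i _ => mul_nonneg (transition_nonneg G v i) (transition_pow_nonneg G t i w)]
    refine Finset.sum_congr rfl fun i _ => ?_
    rw [neighborDist_some hG, ih, ENNReal.ofReal_mul (transition_nonneg G v i)]

/-- With `S = D^(-1/2)`, which is invertible in the absence of isolated vertices, `D⁻¹A = S (1 - L)
S⁻¹`. -/
theorem trace_transition_pow (hG : ∀ v, 0 < G.degree v) (t : ℕ) :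
    (transition G ^ t).trace = ((1 - normLaplacian G) ^ t).trace := by
  have hS : ∀ v, Real.sqrt (G.degree v) ≠ 0 := fun v =>
    (Real.sqrt_pos.mpr (by exact_mod_cast hG v)).ne'
  set S := invSqrtDegree G with hSdef
  set S' : Matrix V V ℝ := Matrix.diagonal fun v => Real.sqrt (G.degree v)
  have h1 : S * S' = 1 := by
    rw [hSdef, invSqrtDegree, Matrix.diagonal_mul_diagonal, ← Matrix.diagonal_one]
    congr 1
    funext v
    exact inv_mul_cancel₀ (hS v)
  have h2 : S' * S = 1 := by
    rw [hSdef, invSqrtDegree, Matrix.diagonal_mul_diagonal, ← Matrix.diagonal_one]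
    congr 1
    funext v
    exact mul_inv_cancel₀ (hS v)
  have h3 : transition G = S * S * G.adjMatrix ℝ := by
    rw [transition, hSdef, invSqrtDegree, Matrix.diagonal_mul_diagonal]
    congr 2
    funext v
    rw [← mul_inv, Real.mul_self_sqrt (by positivity)]
  have h4 : 1 - normLaplacian G = S * G.adjMatrix ℝ * S := by
    rw [normLaplacian, sub_sub_cancel]
  have h5 : transition G ^ t * S = S * (1 - normLaplacian G) ^ t := by
    induction t with
    | zero => simp
    | succ t ih =>
      rw [pow_succ', mul_assoc, ih, pow_succ', h3, h4]
      simp only [mul_assoc]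
  calc (transition G ^ t).trace = (transition G ^ t * S * S').trace := by
        rw [mul_assoc, h1, mul_one]
    _ = (S' * (S * (1 - normLaplacian G) ^ t)).trace := by rw [Matrix.trace_mul_comm, h5]
    _ = _ := by rw [← mul_assoc, h2, one_mul]

theorem trace_one_sub_normLaplacian_pow (t : ℕ) : ((1 - normLaplacian G) ^ t).trace =
    ∑ i, (1 - (normLaplacian_isHermitian G).eigenvalues i) ^ t := by
  set hL := normLaplacian_isHermitian G
  have h := hL.spectral_theorem
  have h1 : 1 - normLaplacian G = Unitary.conjStarAlgAut ℝ _ hL.eigenvectorUnitary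
      (Matrix.diagonal fun i => 1 - hL.eigenvalues i) := by
    conv_lhs => rw [h, ← map_one (Unitary.conjStarAlgAut ℝ _ hL.eigenvectorUnitary), ← map_sub]
    congr 1
    rw [← Matrix.diagonal_one, Matrix.diagonal_sub]
    rfl
  rw [h1, ← map_pow, Matrix.diagonal_pow, Unitary.conjStarAlgAut_apply, Matrix.trace_mul_comm,
    ← mul_assoc, Unitary.coe_star_mul_self, one_mul, Matrix.trace_diagonal]
  rfl

theorem returnProb_toReal [Nonempty V] (hG : ∀ v, 0 < G.degree v) (t : ℕ) :
    (returnProb G t).toReal = (Fintype.card V : ℝ)⁻¹ *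
      ∑ i, (1 - (normLaplacian_isHermitian G).eigenvalues i) ^ t := by
  rw [← trace_one_sub_normLaplacian_pow, ← trace_transition_pow hG, returnProb,
    expect_uniformOfFintype, ← Finset.mul_sum, ENNReal.toReal_mul, ENNReal.toReal_inv,
    ENNReal.toReal_natCast]
  simp only [walkDist_some hG]
  rw [← ENNReal.ofReal_sum_of_nonneg fun i _ => transition_pow_nonneg G t i i,
    ENNReal.toReal_ofReal (Finset.sum_nonneg fun i _ => transition_pow_nonneg G t i i)]
  rfl

/-- Return probabilities are at most one, so the even power sums of the `y_i` are bounded by `|V|`;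
a `y_i` of modulus above one would make them unbounded. -/
theorem abs_one_sub_eigenvalue_le [Nonempty V] (hG : ∀ v, 0 < G.degree v) (i : V) :
    |1 - (normLaplacian_isHermitian G).eigenvalues i| ≤ 1 := by
  by_contra! hlt
  set y := fun i => 1 - (normLaplacian_isHermitian G).eigenvalues i with hy
  have hb : ∀ t : ℕ, (y i ^ 2) ^ t ≤ Fintype.card V := fun t => by
    have h1 : (returnProb G (2 * t)).toReal ≤ 1 :=
      ENNReal.toReal_le_of_le_ofReal zero_le_one (by simpa using returnProb_le_one _)
    rw [returnProb_toReal hG, inv_mul_le_iff₀ (by exact_mod_cast Fintype.card_pos), mul_one] at h1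
    refine le_trans ?_ h1
    rw [← pow_mul]
    exact Finset.single_le_sum (f := fun i => y i ^ (2 * t))
      (fun i _ => (even_two_mul t).pow_nonneg _) (Finset.mem_univ i)
  have h2 : 1 < y i ^ 2 := by
    rw [← sq_abs]
    exact one_lt_pow₀ hlt (by norm_num)
  obtain ⟨t, ht⟩ := pow_unbounded_of_one_lt (Fintype.card V : ℝ) h2
  exact absurd (hb t) (not_le.mpr ht)

end Spectral

/-! ### The kernel -/

/-- The value of the Chebyshev polynomial of the second kind. -/
noncomputable def chebU (k : ℕ) (c : ℝ) : ℝ := (Polynomial.Chebyshev.U ℝ k).eval c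

/-- The value of the preceding Chebyshev polynomial, which is `0` for `k = 0`. -/
noncomputable def chebUPred (k : ℕ) (c : ℝ) : ℝ := (Polynomial.Chebyshev.U ℝ ((k : ℤ) - 1)).eval c

theorem chebU_zero (c : ℝ) : chebU 0 c = 1 := by simp [chebU]

theorem chebUPred_zero (c : ℝ) : chebUPred 0 c = 0 := by simp [chebUPred]

theorem chebU_succ (k : ℕ) (c : ℝ) : chebU (k + 1) c = 2 * c * chebU k c - chebUPred k c := by
  simp only [chebU, chebUPred, Nat.cast_succ, Polynomial.Chebyshev.U_add_one]
  simp

theorem chebUPred_succ (k : ℕ) (c : ℝ) : chebUPred (k + 1) c = chebU k c := by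
  simp [chebU, chebUPred]

theorem abs_chebU_le (k : ℕ) {c : ℝ} (hc : |c| ≤ 1) : |chebU k c| ≤ k + 1 := by
  induction k with
  | zero => simp [chebU_zero]
  | succ k ih =>
    have h : chebU (k + 1) c = c * chebU k c + (Polynomial.Chebyshev.T ℝ (k + 1 : ℤ)).eval c := by
      simp only [chebU, Nat.cast_succ, Polynomial.Chebyshev.U_eq_X_mul_U_add_T]
      simp
    have hT : |(Polynomial.Chebyshev.T ℝ (k + 1 : ℤ)).eval c| ≤ 1 :=
      Polynomial.Chebyshev.abs_eval_T_real_le_one _ hc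
    rw [h]
    refine (abs_add_le _ _).trans ?_
    rw [abs_mul]
    have : |c| * |chebU k c| ≤ 1 * (k + 1) := mul_le_mul hc ih (abs_nonneg _) zero_le_one
    push_cast
    linarith

/-- For `c = cos θ` the left side is `sin² ((k + 1) θ)`. -/
theorem chebU_sq_le (k : ℕ) {c : ℝ} (hc : |c| ≤ 1) : (1 - c ^ 2) * chebU k c ^ 2 ≤ 1 := by
  have h := Polynomial.Chebyshev.U_real_cos (Real.arccos c) k
  have hs := Real.sin_sq_add_cos_sq (Real.arccos c)
  rw [Real.cos_arccos (abs_le.mp hc).1 (abs_le.mp hc).2] at h hs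
  have h1 : 1 - c ^ 2 = Real.sin (Real.arccos c) ^ 2 := by linarith
  rw [h1, ← mul_pow, mul_comm, chebU, h]
  exact Real.sin_sq_le_one _

/-- The increments `U_t - U_{t-1}` start at `1` and drop by `2 (1 - c) U_t ≤ 2 (1 - c) (t + 1)` per
step. The hypothesis keeps them at least `1/2` up to index `k`. -/
theorem le_chebU {k : ℕ} {c : ℝ} (hc : c ≤ 1) (hc' : 2 * (1 - c) * (k + 1) ^ 2 ≤ 1) :
    ((k : ℝ) + 1) / 2 ≤ chebU k c := by
  have hc1 : |c| ≤ 1 := by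
    rw [abs_le]
    refine ⟨?_, hc⟩
    have : (1 : ℝ) ≤ (k + 1) ^ 2 := one_le_pow₀ (by linarith [(Nat.cast_nonneg k : (0 : ℝ) ≤ k)])
    nlinarith
  have hdiff : ∀ t : ℕ, 1 - (1 - c) * (t * (t + 1)) ≤ chebU t c - chebUPred t c := by
    intro t
    induction t with
    | zero => simp [chebU_zero, chebUPred_zero]
    | succ t ih =>
      have h2 : (1 - c) * chebU t c ≤ (1 - c) * (t + 1) :=
        mul_le_mul_of_nonneg_left ((le_abs_self _).trans (abs_chebU_le t hc1)) (by linarith)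
      rw [chebU_succ, chebUPred_succ]
      push_cast
      nlinarith
  have hmain : ∀ t : ℕ, t ≤ k → ((t : ℝ) + 1) / 2 ≤ chebU t c := by
    intro t
    induction t with
    | zero => simp [chebU_zero]; norm_num
    | succ t ih =>
      intro ht
      have h1 := ih (by omega)
      have h2 := hdiff (t + 1)
      rw [chebUPred_succ] at h2
      have h3 : (((t + 1 : ℕ) : ℝ) * ((t + 1 : ℕ) + 1)) ≤ (k + 1) ^ 2 := by
        have : ((t + 1 : ℕ) : ℝ) ≤ k := by exact_mod_cast ht
        have h0 : (0 : ℝ) ≤ (t + 1 : ℕ) := by positivity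
        nlinarith
      have h4 : (1 - c) * (((t + 1 : ℕ) : ℝ) * ((t + 1 : ℕ) + 1)) ≤ (1 - c) * (k + 1) ^ 2 :=
        mul_le_mul_of_nonneg_left h3 (by linarith)
      push_cast at *
      linarith
  exact hmain k le_rfl

/-- A crude exponential constant suffices, since the grid is exponentially fine. Both members of the
recurrence are carried along; a step costs at most a factor `2 + 2 + 1 ≤ 8`. -/
theorem chebU_lipschitz {c c' : ℝ} (hc : |c| ≤ 1) (hc' : |c'| ≤ 1) (k : ℕ) :
    |chebU k c - chebU k c'| ≤ 8 ^ k * |c - c'| ∧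
      |chebUPred k c - chebUPred k c'| ≤ 8 ^ k * |c - c'| := by
  induction k with
  | zero => simp [chebU_zero, chebUPred_zero]
  | succ k ih =>
    have h0 := abs_nonneg (c - c')
    have hk : ((k : ℝ) + 1) ≤ 2 ^ k := by exact_mod_cast Nat.lt_two_pow_self
    have hk' : (2 : ℝ) ^ k ≤ 8 ^ k := by gcongr; norm_num
    have hX : 0 ≤ (8 : ℝ) ^ k * |c - c'| := by positivity
    rw [chebU_succ, chebU_succ, chebUPred_succ, chebUPred_succ, pow_succ]
    refine ⟨?_, ih.1.trans (by nlinarith)⟩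
    have h1 : |c * (chebU k c - chebU k c')| ≤ 1 * (8 ^ k * |c - c'|) := by
      rw [abs_mul]
      exact mul_le_mul hc ih.1 (abs_nonneg _) zero_le_one
    have h2 : |(c - c') * chebU k c'| ≤ |c - c'| * 8 ^ k := by
      rw [abs_mul]
      gcongr
      exact (abs_chebU_le k hc').trans (hk.trans hk')
    have h3 := ih.2
    rw [abs_le] at h1 h2 h3 ⊢
    constructor <;> nlinarith

/-- The kernel. -/
noncomputable def kernel (k : ℕ) (v : ℝ) : ℝ := chebU k (1 - v ^ 2 / 8) ^ 4

/-- Grid points lie in `[-1, 3]` and eigenvalues in `[0, 2]`, so differences are at most `3`. The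
substitution puts `v = 0` at the peak `c = 1` of `U_k` and stays away from the peak at `-1`. -/
theorem abs_kernel_arg_le {v : ℝ} (hv : |v| ≤ 3) : |1 - v ^ 2 / 8| ≤ 1 := by
  have : v ^ 2 ≤ 9 := by
    rw [← sq_abs]
    nlinarith [abs_nonneg v]
  rw [abs_le]
  constructor <;> nlinarith [sq_nonneg v]

theorem kernel_nonneg (k : ℕ) (v : ℝ) : 0 ≤ kernel k v := by
  rw [kernel]
  positivity

/-- For `c = 1 - v²/8` one has `1 - c² = v² (16 - v²) / 64 ≥ 7 v² / 64`, and `64/7 ≤ 10`. -/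
theorem sq_mul_chebU_sq_le (k : ℕ) {v : ℝ} (hv : |v| ≤ 3) :
    v ^ 2 * chebU k (1 - v ^ 2 / 8) ^ 2 ≤ 10 := by
  have h := chebU_sq_le k (abs_kernel_arg_le hv)
  have : v ^ 2 ≤ 9 := by
    rw [← sq_abs]
    nlinarith [abs_nonneg v]
  have h0 := sq_nonneg (chebU k (1 - v ^ 2 / 8))
  have h2 : v ^ 2 * 7 / 64 ≤ 1 - (1 - v ^ 2 / 8) ^ 2 := by nlinarith [sq_nonneg v]
  nlinarith

theorem chebU_sq_mul_le (k : ℕ) {v : ℝ} (hv : |v| ≤ 3) :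
    chebU k (1 - v ^ 2 / 8) ^ 2 * (1 + (k + 1) ^ 2 * v ^ 2) ≤ 11 * (k + 1) ^ 2 := by
  have h1 := sq_mul_chebU_sq_le k hv
  have h2 : chebU k (1 - v ^ 2 / 8) ^ 2 ≤ (k + 1) ^ 2 :=
    sq_le_sq' (by linarith [(abs_le.mp (abs_chebU_le k (abs_kernel_arg_le hv))).1])
      (abs_le.mp (abs_chebU_le k (abs_kernel_arg_le hv))).2
  nlinarith [sq_nonneg ((k : ℝ) + 1)]

/-- With `κ = k + 1` and `s = 1 + κ² v²`, the kernel is at most `121 κ⁴ / s²`, and `2 κ |v| ≤ s`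
turns one factor `1/s` into `1/|v|`. The fourth power in the kernel leaves a summable bound. -/
theorem abs_mul_kernel_le (k : ℕ) {v : ℝ} (hv : |v| ≤ 3) :
    |v| * kernel k v ≤ 61 * (k + 1) ^ 3 * (1 / (1 + (k + 1) ^ 2 * v ^ 2)) := by
  set κ : ℝ := (k : ℝ) + 1 with hκ
  have hκ0 : 0 < κ := by positivity
  set s := 1 + κ ^ 2 * v ^ 2 with hs
  have hs0 : 0 < s := by positivity
  have h1 := chebU_sq_mul_le k hv
  rw [← hκ, ← hs] at h1
  set q := chebU k (1 - v ^ 2 / 8) ^ 2 with hq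
  have hq0 : 0 ≤ q := sq_nonneg _
  have hK : kernel k v = q ^ 2 := by rw [kernel, hq]; ring
  have h2 : 2 * (κ * |v|) ≤ s := by
    rw [hs, ← sq_abs v]
    nlinarith [sq_nonneg (κ * |v| - 1)]
  rw [hK, mul_one_div, le_div_iff₀ hs0]
  have h3 : (q * s) ^ 2 ≤ (11 * κ ^ 2) ^ 2 := by gcongr
  have h4 : |v| * q ^ 2 * s * (2 * κ) ≤ (11 * κ ^ 2) ^ 2 := by
    calc |v| * q ^ 2 * s * (2 * κ) = (2 * (κ * |v|)) * (q ^ 2 * s) := by ring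
      _ ≤ s * (q ^ 2 * s) := by gcongr
      _ = (q * s) ^ 2 := by ring
      _ ≤ _ := h3
  have h5 : |v| * q ^ 2 * s * (2 * κ) ≤ 61 * κ ^ 3 * (2 * κ) := by nlinarith [pow_pos hκ0 4]
  exact le_of_mul_le_mul_right h5 (by positivity)

theorem kernel_le_of_one_le (k : ℕ) {v : ℝ} (hv : |v| ≤ 3) (hv' : 1 ≤ |v|) : kernel k v ≤ 100 := by
  have h1 := sq_mul_chebU_sq_le k hv
  set q := chebU k (1 - v ^ 2 / 8) ^ 2 with hq
  have hq0 : 0 ≤ q := sq_nonneg _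
  have hK : kernel k v = q ^ 2 := by rw [kernel, hq]; ring
  have : 1 ≤ v ^ 2 := by
    rw [← sq_abs]
    nlinarith
  have : q ≤ 10 := by nlinarith
  rw [hK]
  nlinarith

theorem le_kernel (k : ℕ) {v : ℝ} (hv : |v| ≤ 2 / (k + 1)) : ((k : ℝ) + 1) ^ 4 / 16 ≤ kernel k v := by
  have hκ0 : (0 : ℝ) < k + 1 := by positivity
  have h1 : |v| * (k + 1) ≤ 2 := by rwa [le_div_iff₀ hκ0] at hv
  have h2 : ((k : ℝ) + 1) / 2 ≤ chebU k (1 - v ^ 2 / 8) := by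
    refine le_chebU (by nlinarith [sq_nonneg v]) ?_
    have : (|v| * (k + 1)) ^ 2 ≤ 2 ^ 2 := by gcongr
    rw [mul_pow, sq_abs] at this
    linarith
  calc ((k : ℝ) + 1) ^ 4 / 16 = (((k : ℝ) + 1) / 2) ^ 4 := by ring
    _ ≤ _ := by
      rw [kernel]
      gcongr

theorem kernel_lipschitz (k : ℕ) {v v' : ℝ} (hv : |v| ≤ 3) (hv' : |v'| ≤ 3) :
    |kernel k v - kernel k v'| ≤ 3 * (k + 1) ^ 3 * 8 ^ k * |v - v'| := by
  have hc := abs_kernel_arg_le hv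
  have hc' := abs_kernel_arg_le hv'
  have h1 := (chebU_lipschitz hc hc' k).1
  have ha := abs_chebU_le k hc
  have hb := abs_chebU_le k hc'
  rw [kernel, kernel]
  set a := chebU k (1 - v ^ 2 / 8)
  set b := chebU k (1 - v' ^ 2 / 8)
  have hκ0 : (0 : ℝ) < k + 1 := by positivity
  have h2 : |(1 - v ^ 2 / 8) - (1 - v' ^ 2 / 8)| ≤ 3 / 4 * |v - v'| := by
    have : (1 - v ^ 2 / 8) - (1 - v' ^ 2 / 8) = -((v + v') / 8 * (v - v')) := by ring
    rw [this, abs_neg, abs_mul]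
    gcongr
    rw [abs_div, div_le_iff₀ (by positivity)]
    refine (abs_add_le v v').trans ?_
    rw [abs_of_pos (by norm_num : (0 : ℝ) < 8)]
    linarith
  have h3 : |a ^ 3 + a ^ 2 * b + a * b ^ 2 + b ^ 3| ≤ 4 * (k + 1) ^ 3 := by
    refine (abs_add_le _ _).trans ?_
    have e1 : |a ^ 3 + a ^ 2 * b + a * b ^ 2| ≤ 3 * (k + 1) ^ 3 := by
      refine (abs_add_le _ _).trans ?_
      have e2 : |a ^ 3 + a ^ 2 * b| ≤ 2 * (k + 1) ^ 3 := by
        refine (abs_add_le _ _).trans ?_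
        rw [abs_mul, abs_pow, abs_pow]
        have : |a| ^ 3 ≤ (k + 1) ^ 3 := by gcongr
        have : |a| ^ 2 * |b| ≤ (k + 1) ^ 2 * (k + 1) := by gcongr
        linarith
      rw [abs_mul a, abs_pow b]
      have : |a| * |b| ^ 2 ≤ (k + 1) * (k + 1) ^ 2 := by gcongr
      linarith
    rw [abs_pow b]
    have : |b| ^ 3 ≤ (k + 1) ^ 3 := by gcongr
    linarith
  calc |a ^ 4 - b ^ 4| = |a ^ 3 + a ^ 2 * b + a * b ^ 2 + b ^ 3| * |a - b| := by
        rw [← abs_mul]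
        congr 1
        ring
    _ ≤ (4 * (k + 1) ^ 3) * (8 ^ k * (3 / 4 * |v - v'|)) := by
        gcongr
        exact h1.trans (by gcongr)
    _ = _ := by ring

/-! ### Sums over the grid -/

/-- On either side of `θ` the successive integers are at distance at least `0, 1, 2, …`. -/
theorem sum_antitone_abs_le {φ : ℝ → ℝ} (h0 : ∀ x, 0 ≤ φ x)
    (hφ : ∀ x y, 0 ≤ x → x ≤ y → φ y ≤ φ x) {n : ℕ} {θ : ℝ} (hθ : 0 ≤ θ) (hθ' : θ ≤ n) :
    ∑ A ∈ Finset.range n, φ |A - θ| ≤ 2 * ∑ l ∈ Finset.range n, φ l := by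
  set c := ⌈θ⌉₊
  have hc1 : θ ≤ c := Nat.le_ceil θ
  have hc2 : (c : ℝ) < θ + 1 := Nat.ceil_lt_add_one hθ
  have hcn : c ≤ n := Nat.ceil_le.mpr hθ'
  rw [← Finset.sum_range_add_sum_Ico _ hcn, two_mul]
  refine add_le_add ?_ ?_
  · calc ∑ A ∈ Finset.range c, φ |A - θ| ≤ ∑ A ∈ Finset.range c, φ ((c - 1 - A : ℕ) : ℝ) := by
          refine Finset.sum_le_sum fun A hA => hφ _ _ (by positivity) ?_
          have hA' : A + 1 ≤ c := Finset.mem_range.mp hA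
          rw [Nat.sub_sub, Nat.cast_sub (by omega), abs_sub_comm]
          push_cast
          exact le_trans (by linarith) (le_abs_self _)
      _ = ∑ l ∈ Finset.range c, φ l := Finset.sum_range_reflect (fun l : ℕ => φ l) c
      _ ≤ _ := Finset.sum_le_sum_of_subset_of_nonneg (Finset.range_mono hcn) fun _ _ _ => h0 _
  · rw [Finset.sum_Ico_eq_sum_range]
    calc ∑ l ∈ Finset.range (n - c), φ |((c + l : ℕ) : ℝ) - θ|
        ≤ ∑ l ∈ Finset.range (n - c), φ l := by
          refine Finset.sum_le_sum fun l _ => hφ _ _ (by positivity) ?_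
          push_cast
          exact le_trans (by linarith) (le_abs_self _)
      _ ≤ _ := Finset.sum_le_sum_of_subset_of_nonneg (Finset.range_mono (by omega))
          fun _ _ _ => h0 _

/-- By `(s + l)² ≤ 2 (s² + l²)` each term is at most `2s² / ((s + l - 1)(s + l))`, which telescopes.
-/
theorem sum_inv_one_add_sq_le {s : ℝ} (hs : 2 ≤ s) (n : ℕ) :
    ∑ l ∈ Finset.range n, 1 / (1 + ((l : ℝ) / s) ^ 2) ≤ 4 * s := by
  calc ∑ l ∈ Finset.range n, 1 / (1 + ((l : ℝ) / s) ^ 2)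
      ≤ ∑ l ∈ Finset.range n, (2 * s ^ 2 / (s + l - 1) - 2 * s ^ 2 / (s + (l + 1 : ℕ) - 1)) := by
        refine Finset.sum_le_sum fun l _ => ?_
        have hl : (0 : ℝ) ≤ l := by positivity
        have e1 : 1 / (1 + ((l : ℝ) / s) ^ 2) = s ^ 2 / (s ^ 2 + l ^ 2) := by
          field_simp
        have e2 : 2 * s ^ 2 / (s + l - 1) - 2 * s ^ 2 / (s + (l + 1 : ℕ) - 1) =
            2 * s ^ 2 / ((s + l - 1) * (s + l)) := by
          have : s + l - 1 ≠ 0 := by linarith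
          have : s + l ≠ 0 := by linarith
          push_cast
          rw [show s + ((l : ℝ) + 1) - 1 = s + l by ring]
          field_simp
          ring
        rw [e1, e2, div_le_div_iff₀ (by positivity) (mul_pos (by linarith) (by linarith))]
        have : (s + l - 1) * (s + l) ≤ 2 * (s ^ 2 + l ^ 2) := by nlinarith [sq_nonneg (s - l)]
        nlinarith [sq_nonneg s]
    _ = 2 * s ^ 2 / (s - 1) - 2 * s ^ 2 / (s + n - 1) := by
        rw [Finset.sum_range_sub']
        simp
    _ ≤ 4 * s := by
        have h1 : 0 ≤ 2 * s ^ 2 / (s + n - 1) :=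
          div_nonneg (by positivity) (by linarith [(Nat.cast_nonneg n : (0 : ℝ) ≤ n)])
        have h2 : 2 * s ^ 2 / (s - 1) ≤ 4 * s := by
          rw [div_le_iff₀ (by linarith)]
          nlinarith
        linarith

theorem abs_grid_le {M A : ℕ} (hA : A < 4 * M) {l : ℝ} (h0 : 0 ≤ l) (h2 : l ≤ 2) :
    |(A : ℝ) / M - 1 - l| ≤ 3 := by
  have hM : (0 : ℝ) < M := by
    have : 0 < M := by omega
    exact_mod_cast this
  have hA' : (A : ℝ) / M ≤ 4 := by
    rw [div_le_iff₀ hM]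
    exact_mod_cast hA.le
  have hA0 : 0 ≤ (A : ℝ) / M := by positivity
  rw [abs_le]
  constructor <;> linarith

theorem sum_abs_mul_kernel_le {k M : ℕ} (hM : 2 * (k + 1) ≤ M) {l : ℝ} (h0 : 0 ≤ l) (h2 : l ≤ 2) :
    ∑ A ∈ Finset.range (4 * M), |(A : ℝ) / M - 1 - l| * kernel k (A / M - 1 - l) ≤
      488 * M * (k + 1) ^ 2 := by
  have hκ : (0 : ℝ) < k + 1 := by positivity
  have hM' : 2 * ((k : ℝ) + 1) ≤ M := by exact_mod_cast hM
  have hM0 : (0 : ℝ) < M := by linarith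
  set s : ℝ := M / (k + 1) with hs
  have hs2 : 2 ≤ s := by
    rw [hs, le_div_iff₀ hκ]
    exact hM'
  have hs0 : 0 < s := by linarith
  calc ∑ A ∈ Finset.range (4 * M), |(A : ℝ) / M - 1 - l| * kernel k (A / M - 1 - l)
      ≤ ∑ A ∈ Finset.range (4 * M), 61 * ((k : ℝ) + 1) ^ 3 *
          (fun x : ℝ => 1 / (1 + (x / s) ^ 2)) |(A : ℝ) - M * (1 + l)| := by
        refine Finset.sum_le_sum fun A hA => ?_
        refine (abs_mul_kernel_le k (abs_grid_le (Finset.mem_range.mp hA) h0 h2)).trans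
          (le_of_eq ?_)
        dsimp only
        rw [div_pow |_|, sq_abs]
        congr 3
        rw [hs]
        field_simp
        ring
    _ ≤ 61 * (k + 1) ^ 3 * (2 * (4 * s)) := by
        rw [← Finset.mul_sum]
        gcongr
        refine (sum_antitone_abs_le (φ := fun x : ℝ => 1 / (1 + (x / s) ^ 2))
          (fun x => by positivity) (fun x y hx hxy => ?_) (by positivity) ?_).trans ?_
        · gcongr
        · push_cast
          nlinarith
        · gcongr
          exact sum_inv_one_add_sq_le hs2 _
    _ = 488 * M * (k + 1) ^ 2 := by
        rw [hs]
        field_simp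
        ring

/-- The central part of the sum of the kernel over the grid. -/
noncomputable def centralSum (k M : ℕ) : ℝ :=
  ∑ j ∈ Finset.range (2 * M), kernel k (((j : ℝ) - M) / M)

/-- More than `2M/(k+1)` grid points satisfy `0 ≤ v ≤ 2/(k+1)`, and each contributes at least
`(k+1)^4/16`. Against `sum_abs_mul_kernel_le` this bounds the mean displacement by `3904/(k+1)`. -/
theorem le_centralSum {k M : ℕ} (hk : 3 ≤ k) (hM : 4 ≤ M) :
    (M : ℝ) * (k + 1) ^ 3 / 8 ≤ centralSum k M := by
  have hκ : (0 : ℝ) < k + 1 := by positivity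
  have hM0 : (0 : ℝ) < M := by positivity
  set c := ⌊2 * (M : ℝ) / (k + 1)⌋₊ with hc
  have hc1 : (c : ℝ) ≤ 2 * M / (k + 1) := Nat.floor_le (by positivity)
  have hc2 : 2 * (M : ℝ) / (k + 1) < c + 1 := Nat.lt_floor_add_one _
  have hcM : M + (c + 1) ≤ 2 * M := by
    have h1 : 2 * (M : ℝ) / (k + 1) ≤ M / 2 := by
      rw [div_le_div_iff₀ hκ (by norm_num)]
      have : (3 : ℝ) ≤ k := by exact_mod_cast hk
      nlinarith
    have h4 : (4 : ℝ) ≤ M := by exact_mod_cast hM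
    have : (M : ℝ) + (c + 1) ≤ 2 * M := by linarith
    exact_mod_cast this
  calc (M : ℝ) * (k + 1) ^ 3 / 8 = 2 * M / (k + 1) * ((k + 1) ^ 4 / 16) := by
        field_simp
        ring
    _ ≤ (c + 1 : ℕ) * (((k : ℝ) + 1) ^ 4 / 16) := by
        push_cast
        gcongr
    _ = ∑ j ∈ Finset.Ico M (M + (c + 1)), (((k : ℝ) + 1) ^ 4 / 16) := by
        rw [Finset.sum_const, Nat.card_Ico, nsmul_eq_mul, Nat.add_sub_cancel_left]
    _ ≤ ∑ j ∈ Finset.Ico M (M + (c + 1)), kernel k (((j : ℝ) - M) / M) := by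
        refine Finset.sum_le_sum fun j hj => le_kernel k ?_
        rw [Finset.mem_Ico] at hj
        have h1 : (M : ℝ) ≤ j := by exact_mod_cast hj.1
        have h2 : (j : ℝ) - M ≤ c := by
          have : j ≤ M + c := by omega
          have : (j : ℝ) ≤ M + c := by exact_mod_cast this
          linarith
        rw [abs_of_nonneg (div_nonneg (by linarith) hM0.le), div_le_iff₀ hM0]
        calc (j : ℝ) - M ≤ 2 * M / (k + 1) := h2.trans hc1
          _ = _ := by ring
    _ ≤ _ := by
        refine Finset.sum_le_sum_of_subset_of_nonneg (fun j hj => ?_) fun _ _ _ => kernel_nonneg _ _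
        rw [Finset.mem_Ico] at hj
        rw [Finset.mem_range]
        omega

/-- One normalization must serve all eigenvalues. Rounding `l` down to a grid multiple `b/M` changes
the sum by at most `M`, by the Lipschitz bound. For the rounded centre the window `-1 ≤ v < 1` fits
into the grid and contributes exactly `centralSum`; at the other `2M` points `|v| ≥ 1` and the
kernel is at most `100`. -/
theorem sum_kernel_bounds {k M : ℕ} (hM : 12 * (k + 1) ^ 3 * 8 ^ k ≤ M) {l : ℝ} (h0 : 0 ≤ l)
    (h2 : l ≤ 2) :
    centralSum k M - M ≤ ∑ A ∈ Finset.range (4 * M), kernel k (A / M - 1 - l) ∧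
    ∑ A ∈ Finset.range (4 * M), kernel k (A / M - 1 - l) ≤ centralSum k M + 201 * M := by
  have hMpos : 0 < M := lt_of_lt_of_le (by positivity) hM
  have hM0 : (0 : ℝ) < M := by exact_mod_cast hMpos
  have hM' : 12 * ((k : ℝ) + 1) ^ 3 * 8 ^ k ≤ M := by exact_mod_cast hM
  set b := ⌊l * M⌋₊ with hb
  have hb1 : (b : ℝ) ≤ l * M := Nat.floor_le (by positivity)
  have hb2 : l * M < b + 1 := Nat.lt_floor_add_one _
  have hbM : b ≤ 2 * M := by
    have : (b : ℝ) ≤ 2 * M := hb1.trans (by gcongr)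
    exact_mod_cast this
  have hbl : (b : ℝ) / M ≤ 2 := by
    rw [div_le_iff₀ hM0]
    exact_mod_cast hbM
  have hclose : |∑ A ∈ Finset.range (4 * M), kernel k (A / M - 1 - l) -
      ∑ A ∈ Finset.range (4 * M), kernel k (A / M - 1 - (b : ℝ) / M)| ≤ M := by
    rw [← Finset.sum_sub_distrib]
    refine (Finset.abs_sum_le_sum_abs _ _).trans ?_
    calc _ ≤ ∑ A ∈ Finset.range (4 * M), 3 * ((k : ℝ) + 1) ^ 3 * 8 ^ k * (1 / M) := by
          refine Finset.sum_le_sum fun A hA => ?_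
          refine (kernel_lipschitz k (abs_grid_le (Finset.mem_range.mp hA) h0 h2)
            (abs_grid_le (Finset.mem_range.mp hA) (by positivity) hbl)).trans ?_
          gcongr
          rw [show (A : ℝ) / M - 1 - l - (A / M - 1 - (b : ℝ) / M) = -((l * M - b) / M) by
            field_simp; ring, abs_neg, abs_div, abs_of_pos hM0]
          gcongr
          rw [abs_le]
          constructor <;> linarith
      _ = 12 * ((k : ℝ) + 1) ^ 3 * 8 ^ k := by
          rw [Finset.sum_const, Finset.card_range, nsmul_eq_mul]
          push_cast
          field_simp
          ring
      _ ≤ M := hM'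
  have hsplit : ∑ A ∈ Finset.range (4 * M), kernel k (A / M - 1 - (b : ℝ) / M) =
      ∑ A ∈ Finset.range b, kernel k (A / M - 1 - (b : ℝ) / M) + centralSum k M +
      ∑ A ∈ Finset.Ico (b + 2 * M) (4 * M), kernel k (A / M - 1 - (b : ℝ) / M) := by
    rw [← Finset.sum_range_add_sum_Ico _ (show b + 2 * M ≤ 4 * M by omega),
      ← Finset.sum_range_add_sum_Ico _ (show b ≤ b + 2 * M by omega)]
    congr 2
    rw [Finset.sum_Ico_eq_sum_range, centralSum, Nat.add_sub_cancel_left]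
    refine Finset.sum_congr rfl fun j _ => ?_
    congr 1
    push_cast
    field_simp
    ring
  have hleft : ∑ A ∈ Finset.range b, kernel k (A / M - 1 - (b : ℝ) / M) ≤ b * 100 := by
    rw [← nsmul_eq_mul, ← Finset.card_range b, ← Finset.sum_const, Finset.card_range]
    refine Finset.sum_le_sum fun A hA => ?_
    have hA := Finset.mem_range.mp hA
    refine kernel_le_of_one_le k (abs_grid_le (by omega) (by positivity) hbl) ?_
    have : (A : ℝ) / M ≤ b / M := by gcongr
    rw [le_abs]
    right
    linarith
  have hright : ∑ A ∈ Finset.Ico (b + 2 * M) (4 * M), kernel k (A / M - 1 - (b : ℝ) / M) ≤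
      (2 * M - b : ℕ) * 100 := by
    rw [← nsmul_eq_mul, show 2 * M - b = (Finset.Ico (b + 2 * M) (4 * M)).card by
      rw [Nat.card_Ico]; omega, ← Finset.sum_const]
    refine Finset.sum_le_sum fun A hA => ?_
    have hA := Finset.mem_Ico.mp hA
    refine kernel_le_of_one_le k (abs_grid_le (by omega) (by positivity) hbl) ?_
    have h1 : (b : ℝ) + 2 * M ≤ A := by exact_mod_cast hA.1
    have : (b : ℝ) / M + 2 ≤ A / M := by
      rw [le_div_iff₀ hM0, add_mul, div_mul_cancel₀ _ hM0.ne']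
      exact h1
    rw [le_abs]
    left
    linarith
  rw [Nat.cast_sub hbM] at hright
  push_cast at hright
  have hl0 : 0 ≤ ∑ A ∈ Finset.range b, kernel k (A / M - 1 - (b : ℝ) / M) :=
    Finset.sum_nonneg fun _ _ => kernel_nonneg _ _
  have hr0 : 0 ≤ ∑ A ∈ Finset.Ico (b + 2 * M) (4 * M), kernel k (A / M - 1 - (b : ℝ) / M) :=
    Finset.sum_nonneg fun _ _ => kernel_nonneg _ _
  rw [abs_le] at hclose
  constructor <;> linarith [hclose.1, hclose.2]

/-! ### Evaluation of the kernel from approximate moments -/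

section Moments

variable {ι : Type*} [Fintype ι]

/-- Multiplying the predecessor by `4M²` brings both sequences to the same scale. A step then
multiplies the error by at most `8M² + 4M² + M² + 4M² ≤ 5 · 4M²`. -/
theorem recur_error {M A : ℝ} (hM : 0 < M) (hA0 : 0 ≤ A) (hA : A ≤ 4 * M) {y g : ι → ℝ}
    {f : ℕ → ℝ} {η : ℝ} (hη : 0 ≤ η) (hf : ∀ j, |f j - ∑ i, g i * y i ^ j| ≤ η) (t : ℕ) :
    (∀ j, |(recur (coeff M A) f t).1 j - ∑ i, g i * (4 * M ^ 2) ^ t *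
      chebU t (1 - (A / M - 2 + y i) ^ 2 / 8) * y i ^ j| ≤ (5 * (4 * M ^ 2)) ^ t * η) ∧
    (∀ j, |4 * M ^ 2 * (recur (coeff M A) f t).2 j - ∑ i, g i * (4 * M ^ 2) ^ t *
      chebUPred t (1 - (A / M - 2 + y i) ^ 2 / 8) * y i ^ j| ≤ (5 * (4 * M ^ 2)) ^ t * η) := by
  induction t with
  | zero =>
    refine ⟨fun j => by simpa [recur, chebU_zero] using hf j, fun j => ?_⟩
    simpa [recur, chebUPred_zero] using hη
  | succ t ih =>
    set E := (5 * (4 * M ^ 2)) ^ t * η with hE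
    have hE0 : 0 ≤ E := by positivity
    set R := (recur (coeff M A) f t).1
    set P := (recur (coeff M A) f t).2
    set U : ι → ℝ := fun i => chebU t (1 - (A / M - 2 + y i) ^ 2 / 8) with hU
    set W : ι → ℝ := fun i => chebUPred t (1 - (A / M - 2 + y i) ^ 2 / 8) with hW
    set r : ℕ → ℝ := fun j => ∑ i, g i * (4 * M ^ 2) ^ t * U i * y i ^ j with hr
    set p : ℕ → ℝ := fun j => ∑ i, g i * (4 * M ^ 2) ^ t * W i * y i ^ j with hp
    have h1 : ∀ j, |R j - r j| ≤ E := ih.1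
    have h2 : ∀ j, |4 * M ^ 2 * P j - p j| ≤ E := ih.2
    have hE' : (5 * (4 * M ^ 2)) ^ (t + 1) * η = 20 * M ^ 2 * E := by
      rw [hE, pow_succ]
      ring
    rw [hE']
    constructor
    · intro j
      have hnew : ∑ i, g i * (4 * M ^ 2) ^ (t + 1) * chebU (t + 1)
          (1 - (A / M - 2 + y i) ^ 2 / 8) * y i ^ j =
          (8 * M ^ 2 - (A - 2 * M) ^ 2) * r j - (A - 2 * M) * (2 * M) * r (j + 1) -
            M ^ 2 * r (j + 2) - 4 * M ^ 2 * p j := by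
        simp only [hr, hp, Finset.mul_sum, ← Finset.sum_sub_distrib]
        refine Finset.sum_congr rfl fun i _ => ?_
        rw [chebU_succ]
        simp only [hU, hW]
        generalize hu : chebU t (1 - (A / M - 2 + y i) ^ 2 / 8) = u
        generalize chebUPred t (1 - (A / M - 2 + y i) ^ 2 / 8) = w
        have hq : 4 * M ^ 2 * (2 * (1 - (A / M - 2 + y i) ^ 2 / 8)) =
            8 * M ^ 2 - (A - 2 * M + M * y i) ^ 2 := by
          field_simp
          ring
        linear_combination g i * (4 * M ^ 2) ^ t * u * y i ^ j * hq
      have hstep : (recur (coeff M A) f (t + 1)).1 j =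
          (8 * M ^ 2 - (A - 2 * M) ^ 2) * R j - (A - 2 * M) * (2 * M) * R (j + 1) -
            M ^ 2 * R (j + 2) - 4 * M ^ 2 * (4 * M ^ 2 * P j) := by
        simp [recur, recurStep, coeff, R, P]
        ring
      rw [hnew, hstep]
      have ha : |A - 2 * M| ≤ 2 * M := by
        rw [abs_le]
        constructor <;> linarith
      have ha2 : (A - 2 * M) ^ 2 ≤ (2 * M) ^ 2 := sq_le_sq' (abs_le.mp ha).1 (abs_le.mp ha).2
      have b0 : |(8 * M ^ 2 - (A - 2 * M) ^ 2) * (R j - r j)| ≤ 8 * M ^ 2 * E := by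
        rw [abs_mul]
        gcongr
        · rw [abs_of_nonneg (by nlinarith)]
          nlinarith [sq_nonneg (A - 2 * M)]
        · exact h1 j
      have b1 : |(A - 2 * M) * (2 * M) * (R (j + 1) - r (j + 1))| ≤ 2 * M * (2 * M) * E := by
        rw [abs_mul, abs_mul, abs_of_pos (show 0 < 2 * M by linarith)]
        gcongr
        exact h1 _
      have b2 : |M ^ 2 * (R (j + 2) - r (j + 2))| ≤ M ^ 2 * E := by
        rw [abs_mul, abs_of_nonneg (sq_nonneg M)]
        gcongr
        exact h1 _
      have b3 : |4 * M ^ 2 * (4 * M ^ 2 * P j - p j)| ≤ 4 * M ^ 2 * E := by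
        rw [abs_mul, abs_of_nonneg (by positivity : (0 : ℝ) ≤ 4 * M ^ 2)]
        gcongr
        exact h2 j
      have hME : 0 ≤ M ^ 2 * E := by positivity
      rw [abs_le] at b0 b1 b2 b3 ⊢
      constructor <;> linarith [b0.1, b0.2, b1.1, b1.2, b2.1, b2.2, b3.1, b3.2]
    · intro j
      have hnew : ∑ i, g i * (4 * M ^ 2) ^ (t + 1) * chebUPred (t + 1)
          (1 - (A / M - 2 + y i) ^ 2 / 8) * y i ^ j = 4 * M ^ 2 * r j := by
        simp only [hr, Finset.mul_sum]
        refine Finset.sum_congr rfl fun i _ => ?_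
        rw [chebUPred_succ, pow_succ]
        ring
      rw [hnew]
      change |4 * M ^ 2 * R j - 4 * M ^ 2 * r j| ≤ _
      rw [← mul_sub, abs_mul, abs_of_nonneg (by positivity : (0 : ℝ) ≤ 4 * M ^ 2)]
      have hME : 0 ≤ M ^ 2 * E := by positivity
      calc 4 * M ^ 2 * |R j - r j| ≤ 4 * M ^ 2 * E := by gcongr; exact h1 j
        _ ≤ _ := by linarith

/-- The result of a round again approximates moments, with the scaled values of `U_k` absorbed into
the weights `g`, so `recur_error` can be iterated. -/
theorem recur_iterate_error (k : ℕ) {M A : ℝ} (hM : 0 < M) (hA0 : 0 ≤ A) (hA : A ≤ 4 * M)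
    {y g : ι → ℝ} {f : ℕ → ℝ} {η : ℝ} (hη : 0 ≤ η) (hf : ∀ j, |f j - ∑ i, g i * y i ^ j| ≤ η)
    (s j : ℕ) :
    |(fun f => (recur (coeff M A) f k).1)^[s] f j - ∑ i, g i * ((4 * M ^ 2) ^ k *
      chebU k (1 - (A / M - 2 + y i) ^ 2 / 8)) ^ s * y i ^ j| ≤
      ((5 * (4 * M ^ 2)) ^ k) ^ s * η := by
  induction s generalizing j with
  | zero => simpa using hf j
  | succ s ih =>
    rw [Function.iterate_succ_apply']
    refine le_trans (le_of_eq ?_) (((recur_error hM hA0 hA (by positivity) ih k).1 j).trans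
      (le_of_eq ?_))
    · congr 2
      refine Finset.sum_congr rfl fun i _ => ?_
      ring
    · ring

theorem kernelValue_error (k : ℕ) {M A : ℝ} (hM : 0 < M) (hA0 : 0 ≤ A) (hA : A ≤ 4 * M)
    {y g : ι → ℝ} {f : ℕ → ℝ} {η : ℝ} (hη : 0 ≤ η) (hf : ∀ j, |f j - ∑ i, g i * y i ^ j| ≤ η) :
    |kernelValue k M A f - (4 * M ^ 2) ^ (4 * k) * ∑ i, g i * kernel k (A / M - 2 + y i)| ≤
      (4 * M ^ 2) ^ (4 * k) * (625 ^ k * η) := by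
  refine le_trans (le_of_eq ?_) ((recur_iterate_error k hM hA0 hA hη hf 4 0).trans (le_of_eq ?_))
  · rw [kernelValue, Finset.mul_sum]
    congr 2
    refine Finset.sum_congr rfl fun i _ => ?_
    rw [kernel, mul_comm 4 k, pow_mul]
    ring
  · rw [show (625 : ℝ) = 5 ^ 4 by norm_num, mul_pow 5, mul_comm 4 k, pow_mul, ← pow_mul 5 4 k]
    ring

end Moments

/-! ### Transport between finitely supported distributions -/

section Transport

variable {ι κ : Type*} [Fintype ι] [Fintype κ]

theorem W1_le_of_plan (x : ι → ℝ) (y : κ → ℝ) (π : ι → κ → ℝ≥0∞) :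
    W1 (∑ i, (∑ j, π i j) • Measure.dirac (x i)) (∑ j, (∑ i, π i j) • Measure.dirac (y j)) ≤
      ∑ i, ∑ j, π i j * ENNReal.ofReal |x i - y j| := by
  have hfst : (∑ i, ∑ j, π i j • Measure.dirac (x i, y j)).map Prod.fst =
      ∑ i, (∑ j, π i j) • Measure.dirac (x i) := by
    ext s hs
    rw [Measure.map_apply measurable_fst hs]
    simp only [Measure.coe_finsetSum, Finset.sum_apply, Measure.smul_apply, smul_eq_mul,
      Measure.dirac_apply' _ (measurable_fst hs), Measure.dirac_apply' _ hs, Finset.sum_mul]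
    rfl
  have hsnd : (∑ i, ∑ j, π i j • Measure.dirac (x i, y j)).map Prod.snd =
      ∑ j, (∑ i, π i j) • Measure.dirac (y j) := by
    ext s hs
    rw [Measure.map_apply measurable_snd hs]
    simp only [Measure.coe_finsetSum, Finset.sum_apply, Measure.smul_apply, smul_eq_mul,
      Measure.dirac_apply' _ (measurable_snd hs), Measure.dirac_apply' _ hs, Finset.sum_mul]
    rw [Finset.sum_comm]
    rfl
  rw [W1]
  refine (iInf_le _ (∑ i, ∑ j, π i j • Measure.dirac (x i, y j))).trans ?_
  refine (iInf_le _ hfst).trans ((iInf_le _ hsnd).trans (le_of_eq ?_))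
  simp only [lintegral_finsetSum_measure, lintegral_smul_measure, lintegral_dirac, smul_eq_mul]

theorem W1_le_of_real_plan (x : ι → ℝ) (y : κ → ℝ) {π : ι → κ → ℝ} (hπ : ∀ i j, 0 ≤ π i j) :
    W1 (∑ i, ENNReal.ofReal (∑ j, π i j) • Measure.dirac (x i))
      (∑ j, ENNReal.ofReal (∑ i, π i j) • Measure.dirac (y j)) ≤
      ENNReal.ofReal (∑ i, ∑ j, π i j * |x i - y j|) := by
  refine le_trans (le_of_eq ?_) ((W1_le_of_plan x y fun i j => ENNReal.ofReal (π i j)).trans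
    (le_of_eq ?_))
  · simp only [ENNReal.ofReal_sum_of_nonneg fun j _ => hπ _ j,
      ENNReal.ofReal_sum_of_nonneg fun i _ => hπ i _]
  · rw [ENNReal.ofReal_sum_of_nonneg fun i _ =>
      Finset.sum_nonneg fun j _ => mul_nonneg (hπ i j) (abs_nonneg _)]
    refine Finset.sum_congr rfl fun i _ => ?_
    rw [ENNReal.ofReal_sum_of_nonneg fun j _ => mul_nonneg (hπ i j) (abs_nonneg _)]
    exact Finset.sum_congr rfl fun j _ => (ENNReal.ofReal_mul (hπ i j)).symm

/-- A partial transport plan can be completed, at the cost of the diameter for the mass that it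
leaves over. -/
theorem W1_le_of_subplan (x : ι → ℝ) (y : κ → ℝ) {p : ι → ℝ} {q : κ → ℝ} {a : ι → κ → ℝ}
    {d : ℝ} (hd : ∀ i j, |x i - y j| ≤ d) (hp : ∑ i, p i = 1) (hq : ∑ j, q j = 1)
    (ha : ∀ i j, 0 ≤ a i j) (hrow : ∀ i, ∑ j, a i j ≤ p i) (hcol : ∀ j, ∑ i, a i j ≤ q j) :
    W1 (∑ i, ENNReal.ofReal (p i) • Measure.dirac (x i))
      (∑ j, ENNReal.ofReal (q j) • Measure.dirac (y j)) ≤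
      ENNReal.ofReal (∑ i, ∑ j, a i j * |x i - y j| + d * (1 - ∑ j, ∑ i, a i j)) := by
  set r : ι → ℝ := fun i => p i - ∑ j, a i j with hr
  set c : κ → ℝ := fun j => q j - ∑ i, a i j with hc
  have hr0 : ∀ i, 0 ≤ r i := fun i => sub_nonneg.mpr (hrow i)
  have hc0 : ∀ j, 0 ≤ c j := fun j => sub_nonneg.mpr (hcol j)
  set ρ : ℝ := 1 - ∑ j, ∑ i, a i j with hρ
  have hcρ : ∑ j, c j = ρ := by rw [hc, Finset.sum_sub_distrib, hq]
  have hrρ : ∑ i, r i = ρ := by rw [hr, Finset.sum_sub_distrib, hp, Finset.sum_comm]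
  have hρ0 : 0 ≤ ρ := hcρ ▸ Finset.sum_nonneg fun j _ => hc0 j
  -- The leftover masses are coupled by the product plan `r i * c j / ρ`. If `ρ = 0`, all leftovers
  -- vanish and division by zero does no harm.
  have hri : ∀ i, r i * ρ / ρ = r i := fun i => by
    rcases eq_or_ne ρ 0 with h | h
    · have := (Finset.sum_eq_zero_iff_of_nonneg fun i _ => hr0 i).mp (hrρ.trans h) i
        (Finset.mem_univ i)
      rw [this]
      simp
    · exact mul_div_cancel_right₀ _ h
  have hcj : ∀ j, ρ * c j / ρ = c j := fun j => by
    rcases eq_or_ne ρ 0 with h | h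
    · have := (Finset.sum_eq_zero_iff_of_nonneg fun j _ => hc0 j).mp (hcρ.trans h) j
        (Finset.mem_univ j)
      rw [this]
      simp
    · exact mul_div_cancel_left₀ _ h
  have hπ : ∀ i j, 0 ≤ a i j + r i * c j / ρ := fun i j =>
    add_nonneg (ha i j) (div_nonneg (mul_nonneg (hr0 i) (hc0 j)) hρ0)
  have hrows : ∀ i, ∑ j, (a i j + r i * c j / ρ) = p i := fun i => by
    rw [Finset.sum_add_distrib, ← Finset.sum_div, ← Finset.mul_sum, hcρ, hri, hr]
    ring
  have hcols : ∀ j, ∑ i, (a i j + r i * c j / ρ) = q j := fun j => by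
    rw [Finset.sum_add_distrib, ← Finset.sum_div, ← Finset.sum_mul, hrρ, hcj, hc]
    ring
  have h := W1_le_of_real_plan x y hπ
  simp only [hrows, hcols] at h
  refine h.trans (ENNReal.ofReal_le_ofReal ?_)
  simp only [add_mul, Finset.sum_add_distrib]
  gcongr
  calc ∑ i, ∑ j, r i * c j / ρ * |x i - y j| ≤ ∑ i, ∑ j, r i * c j / ρ * d := by
        refine Finset.sum_le_sum fun i _ => Finset.sum_le_sum fun j _ => ?_
        exact mul_le_mul_of_nonneg_left (hd i j)
          (div_nonneg (mul_nonneg (hr0 i) (hc0 j)) hρ0)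
    _ = ∑ i, r i * d := by
        refine Finset.sum_congr rfl fun i _ => ?_
        rw [← Finset.sum_mul, ← Finset.sum_div, ← Finset.mul_sum, hcρ, hri]
    _ = d * ρ := by rw [← Finset.sum_mul, hrρ, mul_comm]

/-- Spreading each `p i` along a nearly stochastic kernel `b`, and then perturbing the resulting
weights, moves the distribution only by the mean displacement of the kernel and the defects. -/
theorem W1_le_of_kernel (x : ι → ℝ) (y : κ → ℝ) {p : ι → ℝ} {w : κ → ℝ} {b : ι → κ → ℝ}
    {d Z e E : ℝ} (hd : ∀ i j, |x i - y j| ≤ d) (hd0 : 0 ≤ d) (hp : ∑ i, p i = 1)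
    (hb : ∀ i j, 0 ≤ b i j) (hw : ∀ j, 0 ≤ w j) (hZ : 0 < Z) (hW : 0 < ∑ j, w j)
    (hrow : ∀ i, ∑ j, b i j ≤ p i * Z) (htot : Z - e ≤ ∑ j, ∑ i, b i j)
    (hE : ∑ j, |w j - ∑ i, b i j| ≤ E) :
    W1 (∑ i, ENNReal.ofReal (p i) • Measure.dirac (x i))
      (∑ j, ENNReal.ofReal (w j / ∑ j, w j) • Measure.dirac (y j)) ≤
      ENNReal.ofReal ((∑ i, ∑ j, b i j * |x i - y j| + d * (e + 2 * E)) / Z) := by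
  set W := ∑ j, w j with hWdef
  set β : κ → ℝ := fun j => ∑ i, b i j with hβ
  have hβ0 : ∀ j, 0 ≤ β j := fun j => Finset.sum_nonneg fun i _ => hb i j
  -- Column `j` of `b` is scaled as far as both constraints allow: `1 / Z` respects the rows, the
  -- other term the column. For `β j = 0` the column is empty and the value of `m j` does not
  -- matter.
  set m : κ → ℝ := fun j => min (1 / Z) (w j / W / β j) with hm
  have hm0 : ∀ j, 0 ≤ m j := fun j =>
    le_min (by positivity) (div_nonneg (div_nonneg (hw j) hW.le) (hβ0 j))
  have hmZ : ∀ j, m j ≤ 1 / Z := fun j => min_le_left _ _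
  have hβm : ∀ j, β j * m j = min (β j / Z) (w j / W) := fun j => by
    rcases (hβ0 j).eq_or_lt with h | h
    · rw [← h, zero_mul, zero_div, min_eq_left (div_nonneg (hw j) hW.le)]
    · rw [hm, mul_min_of_nonneg _ _ h.le, mul_one_div, mul_div_cancel₀ _ h.ne']
  have hcolsum : ∀ j, ∑ i, b i j * m j = β j * m j := fun j => by rw [hβ, Finset.sum_mul]
  refine (W1_le_of_subplan x y (a := fun i j => b i j * m j) hd hp ?_
    (fun i j => mul_nonneg (hb i j) (hm0 j)) (fun i => ?_) fun j => ?_).trans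
    (ENNReal.ofReal_le_ofReal ?_)
  · rw [← Finset.sum_div, div_self hW.ne']
  · calc ∑ j, b i j * m j ≤ ∑ j, b i j * (1 / Z) :=
          Finset.sum_le_sum fun j _ => mul_le_mul_of_nonneg_left (hmZ j) (hb i j)
      _ ≤ p i * Z * (1 / Z) := by
          rw [← Finset.sum_mul]
          exact mul_le_mul_of_nonneg_right (hrow i) (by positivity)
      _ = p i := by field_simp
  · rw [hcolsum, hβm]
    exact min_le_right _ _
  · rw [add_div, mul_div_assoc]
    have hcost : ∑ i, ∑ j, b i j * m j * |x i - y j| ≤ (∑ i, ∑ j, b i j * |x i - y j|) / Z := by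
      rw [Finset.sum_div]
      refine Finset.sum_le_sum fun i _ => ?_
      rw [Finset.sum_div]
      refine Finset.sum_le_sum fun j _ => ?_
      calc b i j * m j * |x i - y j| = b i j * |x i - y j| * m j := by ring
        _ ≤ b i j * |x i - y j| * (1 / Z) :=
            mul_le_mul_of_nonneg_left (hmZ j) (mul_nonneg (hb i j) (abs_nonneg _))
        _ = _ := mul_one_div _ _
    have hq : ∑ j, w j / W = 1 := by rw [← Finset.sum_div, div_self hW.ne']
    have hdef : 1 - ∑ j, ∑ i, b i j * m j ≤ (e + 2 * E) / Z := by
      simp only [hcolsum, hβm]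
      rw [← hq, ← Finset.sum_sub_distrib, le_div_iff₀ hZ]
      have hβW : Z - e - E ≤ W := by
        have : ∑ j, β j - W ≤ E := by
          rw [← Finset.sum_sub_distrib]
          refine le_trans (Finset.sum_le_sum fun j _ => ?_) hE
          rw [abs_sub_comm]
          exact le_abs_self _
        linarith
      -- This rests on `w/W - β/Z = (Z - W)(w/W)/Z + (w - β)/Z`. Summed and multiplied by `Z`, the
      -- parts are at most `e + E` and `E`.
      have hpt : ∀ j, w j / W - min (β j / Z) (w j / W) ≤
          max 0 (Z - W) * (w j / W) / Z + |w j - β j| / Z := fun j => by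
        have hz : 0 ≤ max 0 (Z - W) * (w j / W) / Z := by
          have := div_nonneg (hw j) hW.le
          have := le_max_left 0 (Z - W)
          positivity
        rcases min_cases (β j / Z) (w j / W) with ⟨h, _⟩ | ⟨h, _⟩
        · rw [h, ← add_div, ← sub_nonneg]
          have h1 : (Z - W) * (w j / W) ≤ max 0 (Z - W) * (w j / W) :=
            mul_le_mul_of_nonneg_right (le_max_right _ _) (div_nonneg (hw j) hW.le)
          have h2 := le_abs_self (w j - β j)
          have h3 : (Z - W) * (w j / W) = Z * (w j / W) - w j := by
            field_simp
          have h4 : w j / W = Z * (w j / W) / Z := by field_simp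
          rw [h4, ← sub_div, ← sub_div]
          refine div_nonneg ?_ hZ.le
          rw [← h4]
          linarith
        · rw [h, sub_self]
          positivity
      calc _ ≤ (∑ j, (max 0 (Z - W) * (w j / W) / Z + |w j - β j| / Z)) * Z :=
            mul_le_mul_of_nonneg_right (Finset.sum_le_sum fun j _ => hpt j) hZ.le
        _ = max 0 (Z - W) + ∑ j, |w j - β j| := by
            rw [Finset.sum_add_distrib, ← Finset.sum_div, ← Finset.sum_div, ← Finset.mul_sum, hq]
            field_simp
        _ ≤ e + 2 * E := by
            have hE0 : 0 ≤ E := le_trans (Finset.sum_nonneg fun _ _ => abs_nonneg _) hE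
            have he : 0 ≤ e := by
              have : ∑ j, ∑ i, b i j ≤ Z := by
                rw [Finset.sum_comm]
                calc _ ≤ ∑ i, p i * Z := Finset.sum_le_sum fun i _ => hrow i
                  _ = Z := by rw [← Finset.sum_mul, hp, one_mul]
              linarith
            have : max 0 (Z - W) ≤ e + E := max_le (by linarith) (by linarith)
            linarith
    exact add_le_add hcost (mul_le_mul_of_nonneg_left hdef hd0)

end Transport

/-! ### Accuracy of the output -/

theorem sum_fin_sum_range_block (F : ℕ → ℝ) (n B : ℕ) :
    ∑ i : Fin n, ∑ b ∈ Finset.range B, F (i * B + b) = ∑ A ∈ Finset.range (n * B), F A := by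
  rw [← Finset.sum_range fun i => ∑ b ∈ Finset.range B, F (i * B + b)]
  induction n with
  | zero => simp
  | succ n ih => rw [Finset.sum_range_succ, ih, Nat.succ_mul, Finset.sum_range_add]

theorem outputMeasure_map_range (a : ℕ → Atom) {n : ℕ}
    (h : 0 < totalMass ((List.range n).map a)) :
    outputMeasure ((List.range n).map a) = ∑ i : Fin n,
      ENNReal.ofReal (((a i).mass : ℝ) / ∑ j : Fin n, ((a j).mass : ℝ)) •
        Measure.dirac (a i).loc := by
  have htot : (totalMass ((List.range n).map a) : ℝ) = ∑ j : Fin n, ((a j).mass : ℝ) := by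
    rw [← Finset.sum_range fun j => ((a j).mass : ℝ), ← Nat.cast_sum, totalMass, List.map_map]
    rfl
  have hsum : outputMeasure ((List.range n).map a) = ∑ i ∈ Finset.range n,
      (((a i).mass : ℝ≥0∞) / (totalMass ((List.range n).map a) : ℝ≥0∞)) •
        Measure.dirac (a i).loc := by
    rw [outputMeasure, List.map_map]
    rfl
  rw [hsum, Finset.sum_range]
  refine Finset.sum_congr rfl fun i _ => ?_
  rw [← htot, ENNReal.ofReal_div_of_pos (by exact_mod_cast h), ENNReal.ofReal_natCast,
    ENNReal.ofReal_natCast]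

theorem outputAtom_loc {k : ℕ} (hk : 0 < k) (B : ℕ) (f : ℕ → ℝ) (i : ℕ) :
    (outputAtom k B f i).loc = min (max ((i : ℝ) / k - 1) 0) 2 := by
  have hk' : (0 : ℝ) < k := by exact_mod_cast hk
  have h1 : ((i - k : ℕ) : ℝ) = max ((i : ℝ) - k) 0 := by
    rcases le_total k i with h | h
    · rw [Nat.cast_sub h, max_eq_left (sub_nonneg.mpr (by exact_mod_cast h))]
    · rw [Nat.sub_eq_zero_of_le h, max_eq_right (sub_nonpos.mpr (by exact_mod_cast h)),
        Nat.cast_zero]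
  rw [Atom.loc, outputAtom]
  push_cast
  rw [h1, ← min_div_div_right hk'.le, ← max_div_div_right hk'.le, sub_div, div_self hk'.ne',
    zero_div, mul_div_cancel_right₀ _ hk'.ne']

/-- Grid points of block `i` are within `1/k` of `i/k - 1`, and clipping to `[0, 2]` moves no point
away from `l`. -/
theorem abs_sub_outputAtom_loc_le {k B : ℕ} (hk : 0 < k) (f : ℕ → ℝ) {i b : ℕ} (hb : b < B)
    {l : ℝ} (h0 : 0 ≤ l) (h2 : l ≤ 2) :
    |l - (outputAtom k B f i).loc| ≤ |((i * B + b : ℕ) : ℝ) / (B * k : ℕ) - 1 - l| + 1 / k := by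
  have hk' : (0 : ℝ) < k := by exact_mod_cast hk
  have hB : (0 : ℝ) < B := by
    have : 0 < B := by omega
    exact_mod_cast this
  have hb' : (b : ℝ) ≤ B := by exact_mod_cast hb.le
  rw [outputAtom_loc hk]
  have h1 : ((i * B + b : ℕ) : ℝ) / (B * k : ℕ) = i / k + b / B * (1 / k) := by
    push_cast
    field_simp
  have h3 : (b : ℝ) / B * (1 / k) ≤ 1 / k := by
    have : (b : ℝ) / B ≤ 1 := (div_le_one hB).mpr hb'
    have : (0 : ℝ) ≤ 1 / k := by positivity
    nlinarith
  have h4 : (0 : ℝ) ≤ b / B * (1 / k) := by positivity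
  rw [h1]
  set u : ℝ := i / k
  set d : ℝ := b / B * (1 / k)
  have hclip : |l - min (max (u - 1) 0) 2| ≤ |u - 1 - l| := by
    rcases min_cases (max (u - 1) 0) 2 with ⟨h, h'⟩ | ⟨h, h'⟩ <;>
    rcases max_cases (u - 1) 0 with ⟨g, g'⟩ | ⟨g, g'⟩ <;> rw [h] <;> (try rw [g]) <;>
    cases abs_cases (u - 1 - l) <;> rw [abs_le] <;> constructor <;> linarith
  refine hclip.trans ?_
  calc |u - 1 - l| = |(u + d - 1 - l) - d| := by ring_nf
    _ ≤ |u + d - 1 - l| + |d| := abs_sub _ _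
    _ ≤ _ := by
        rw [abs_of_nonneg h4]
        linarith

/-- Rounding costs at most `1/S ≤ 1`, and cutting off negative values only helps, because the target
is nonnegative. -/
theorem abs_floor_div_sub_le {a S β η : ℝ} (hS : 1 ≤ S) (hβ : 0 ≤ β) (h : |a - S * β| ≤ S * η) :
    |(⌊a⌋₊ : ℝ) / S - β| ≤ η + 1 := by
  have hS0 : 0 < S := by linarith
  have hη : 0 ≤ η := by
    have := (abs_nonneg _).trans h
    exact nonneg_of_mul_nonneg_right this hS0
  have h1 := Nat.lt_floor_add_one a
  have h2 : (⌊a⌋₊ : ℝ) ≤ max a 0 := by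
    rcases le_total 0 a with ha | ha
    · exact (Nat.floor_le ha).trans (le_max_left _ _)
    · rw [Nat.floor_of_nonpos ha, Nat.cast_zero]
      exact le_max_right _ _
  rw [abs_le] at h
  have h3 : max a 0 ≤ S * (β + η) := max_le (by linarith) (by positivity)
  rw [abs_le, le_sub_iff_add_le, le_div_iff₀ hS0, sub_le_iff_le_add, div_le_iff₀ hS0]
  constructor <;> nlinarith

theorem atomValue_error {ι : Type*} [Fintype ι] {k B : ℕ} (hk : 0 < k) (hB : 0 < B)
    {y g : ι → ℝ} {f : ℕ → ℝ} {η : ℝ} (hη : 0 ≤ η) (hf : ∀ j, |f j - ∑ v, g v * y v ^ j| ≤ η)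
    {i : ℕ} (hi : i < 4 * k) :
    |atomValue k B f i - (4 * ((B * k : ℕ) : ℝ) ^ 2) ^ (4 * k) * ∑ b ∈ Finset.range B, ∑ v, g v *
      kernel k (((i * B + b : ℕ) : ℝ) / (B * k : ℕ) - 2 + y v)| ≤
      B * ((4 * ((B * k : ℕ) : ℝ) ^ 2) ^ (4 * k) * (625 ^ k * η)) := by
  rw [atomValue, Finset.mul_sum, ← Finset.sum_sub_distrib]
  refine (Finset.abs_sum_le_sum_abs _ _).trans ?_
  refine (Finset.sum_le_card_nsmul _ _ ((4 * ((B * k : ℕ) : ℝ) ^ 2) ^ (4 * k) * (625 ^ k * η))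
    fun b hb => ?_).trans (le_of_eq ?_)
  · refine kernelValue_error k ?_ (Nat.cast_nonneg _) ?_ hη hf
    · have : 0 < B * k := by positivity
      exact_mod_cast this
    · have hb := Finset.mem_range.mp hb
      have : i * B + b ≤ 4 * (B * k) := by nlinarith
      exact_mod_cast this
  · rw [Finset.card_range, nsmul_eq_mul]

section Accuracy

variable {V : Type*} [Fintype V] [DecidableEq V] [Nonempty V] {G : SimpleGraph V}
  [DecidableRel G.Adj]

theorem output_accuracy (hG : ∀ v, 0 < G.degree v) {k B : ℕ} (hk : 8192 ≤ k)
    (hB : 12 * (k + 1) ^ 3 * 8 ^ k ≤ B) {f : ℕ → ℝ}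
    (hf : ∀ j, |f j - B * (returnProb G j).toReal| ≤ B / 4096 ^ k) :
    IsDistribution ((List.range (4 * k)).map (outputAtom k B f)) ∧
    W1 (spectralMeasure G) (outputMeasure ((List.range (4 * k)).map (outputAtom k B f))) ≤
      ENNReal.ofReal (8192 / k) := by
  have hk0 : 0 < k := by omega
  have hk' : (8192 : ℝ) ≤ k := by exact_mod_cast hk
  have hB0 : 0 < B := lt_of_lt_of_le (by positivity) hB
  have hB1 : (1 : ℝ) ≤ B := by exact_mod_cast hB0
  set M : ℕ := B * k with hMdef
  have hM : (M : ℝ) = B * k := by rw [hMdef, Nat.cast_mul]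
  have hM0 : (0 : ℝ) < M := by rw [hM]; positivity
  have hBM : B ≤ M := Nat.le_mul_of_pos_right B hk0
  have hMk : 2 * (k + 1) ≤ M := by
    refine le_trans ?_ (hB.trans hBM)
    have h1 : 1 ≤ 8 ^ k := Nat.one_le_pow _ _ (by norm_num)
    have h2 : k + 1 ≤ (k + 1) ^ 3 := Nat.le_self_pow (by norm_num) _
    nlinarith
  set l : V → ℝ := fun v => (normLaplacian_isHermitian G).eigenvalues v with hl
  have hl1 : ∀ v, |1 - l v| ≤ 1 := abs_one_sub_eigenvalue_le hG
  have hl0 : ∀ v, 0 ≤ l v := fun v => by linarith [(abs_le.mp (hl1 v)).2]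
  have hl2 : ∀ v, l v ≤ 2 := fun v => by linarith [(abs_le.mp (hl1 v)).1]
  set n : ℝ := ((Fintype.card V : ℕ) : ℝ) with hn
  have hn0 : 0 < n := by
    rw [hn]
    exact_mod_cast Fintype.card_pos
  -- The masses carry the scale `(4M²)^(4k)` of the recurrence and the factor `B`, since counts are
  -- used in place of frequencies.
  set S : ℝ := (4 * (M : ℝ) ^ 2) ^ (4 * k) * B with hS
  have hS1 : 1 ≤ S := by
    have : (1 : ℝ) ≤ M := hB1.trans (by exact_mod_cast hBM)
    have h4 : (1 : ℝ) ≤ 4 * (M : ℝ) ^ 2 := by nlinarith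
    exact one_le_mul_of_one_le_of_one_le (one_le_pow₀ h4) hB1
  have hS0 : 0 < S := by linarith
  set b : V → Fin (4 * k) → ℝ := fun v i => n⁻¹ * ∑ c ∈ Finset.range B,
    kernel k (((i * B + c : ℕ) : ℝ) / M - 1 - l v) with hb
  have hb0 : ∀ v i, 0 ≤ b v i := fun v i =>
    mul_nonneg (by positivity) (Finset.sum_nonneg fun _ _ => kernel_nonneg _ _)
  set w : Fin (4 * k) → ℝ := fun i => ((outputAtom k B f i).mass : ℝ) / S with hw
  have hw0 : ∀ i, 0 ≤ w i := fun i => by positivity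
  have herr : ∀ i, |w i - ∑ v, b v i| ≤ B + 1 := fun i => by
    refine abs_floor_div_sub_le hS1 (Finset.sum_nonneg fun v _ => hb0 v i) ?_
    have h1 := atomValue_error (y := fun v => 1 - l v) (g := fun _ => B * n⁻¹) (f := f)
      (η := B / 4096 ^ k) hk0 hB0 (by positivity) (fun j => by
        have := hf j
        rwa [returnProb_toReal hG, ← mul_assoc, Finset.mul_sum] at this) i.2
    refine le_trans (le_of_eq ?_) (h1.trans ?_)
    · congr 2
      rw [hS, mul_assoc]
      congr 1
      simp only [hb, Finset.mul_sum]
      rw [Finset.sum_comm]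
      refine Finset.sum_congr rfl fun c _ => Finset.sum_congr rfl fun v _ => ?_
      rw [← mul_assoc]
      congr 2
      ring
    -- Here the sampling accuracy beats the error amplification of the recurrence.
    · have h2 : (625 : ℝ) ^ k * (B / 4096 ^ k) ≤ B := by
        rw [mul_div_left_comm, ← div_pow]
        have : ((625 : ℝ) / 4096) ^ k ≤ 1 := pow_le_one₀ (by norm_num) (by norm_num)
        nlinarith
      calc (B : ℝ) * ((4 * (M : ℝ) ^ 2) ^ (4 * k) * (625 ^ k * (B / 4096 ^ k)))
          ≤ B * ((4 * (M : ℝ) ^ 2) ^ (4 * k) * B) := by gcongr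
        _ = S * B := by rw [hS]; ring
  have hsum : ∀ (F : ℕ → ℝ), ∑ i : Fin (4 * k), ∑ c ∈ Finset.range B, F (i * B + c) =
      ∑ A ∈ Finset.range (4 * M), F A := fun F => by
    rw [sum_fin_sum_range_block, hMdef]
    congr 2
    ring
  have hrow : ∀ v, ∑ i, b v i = n⁻¹ * ∑ A ∈ Finset.range (4 * M), kernel k (A / M - 1 - l v) :=
    fun v => by
      rw [← hsum fun A => kernel k ((A : ℝ) / M - 1 - l v), Finset.mul_sum]
  have hbounds := fun v => sum_kernel_bounds (hB.trans hBM) (hl0 v) (hl2 v)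
  set Z : ℝ := centralSum k M + 201 * M with hZ
  have hcs : (M : ℝ) * (k + 1) ^ 3 / 8 ≤ centralSum k M := le_centralSum (by omega) (by omega)
  have hκ3 : (8192 : ℝ) ≤ (k + 1) ^ 3 := by
    have : (1 : ℝ) ≤ k + 1 := by linarith
    calc (8192 : ℝ) ≤ k + 1 := by linarith
      _ ≤ _ := le_self_pow₀ this (by norm_num)
  have hcs' : 1024 * (M : ℝ) ≤ centralSum k M := by nlinarith
  have hZ0 : 0 < Z := by linarith
  have htot : Z - 202 * M ≤ ∑ i, ∑ v, b v i := by
    rw [Finset.sum_comm]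
    calc Z - 202 * M = ∑ v : V, n⁻¹ * (centralSum k M - M) := by
          rw [Finset.sum_const, Finset.card_univ, nsmul_eq_mul, ← hn, mul_inv_cancel_left₀ hn0.ne']
          ring
      _ ≤ _ := Finset.sum_le_sum fun v _ => by
          rw [hrow]
          exact mul_le_mul_of_nonneg_left (hbounds v).1 (by positivity)
  have hE : ∑ i, |w i - ∑ v, b v i| ≤ 8 * M := by
    refine (Finset.sum_le_sum fun i _ => herr i).trans ?_
    rw [Finset.sum_const, Finset.card_univ, Fintype.card_fin, nsmul_eq_mul, hM]
    push_cast
    nlinarith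
  have hW : 0 < ∑ i, w i := by
    have : ∑ i, ∑ v, b v i - ∑ i, w i ≤ 8 * M := by
      rw [← Finset.sum_sub_distrib]
      refine (Finset.sum_le_sum fun i _ => ?_).trans hE
      rw [abs_sub_comm]
      exact le_abs_self _
    linarith
  have hmass : ∑ i, w i = (∑ i : Fin (4 * k), ((outputAtom k B f i).mass : ℝ)) / S := by
    rw [Finset.sum_div]
  have hpos : 0 < totalMass ((List.range (4 * k)).map (outputAtom k B f)) := by
    have h1 : (totalMass ((List.range (4 * k)).map (outputAtom k B f)) : ℝ) =
        ∑ i : Fin (4 * k), ((outputAtom k B f i).mass : ℝ) := by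
      rw [← Finset.sum_range fun j => ((outputAtom k B f j).mass : ℝ), ← Nat.cast_sum, totalMass,
        List.map_map]
      rfl
    have h2 : 0 < ∑ i : Fin (4 * k), ((outputAtom k B f i).mass : ℝ) := by
      rw [hmass] at hW
      exact (div_pos_iff_of_pos_right hS0).mp hW
    rw [← h1] at h2
    exact_mod_cast h2
  have hloc : ∀ i, 0 ≤ (outputAtom k B f i).loc ∧ (outputAtom k B f i).loc ≤ 2 := fun i => by
    rw [outputAtom_loc hk0]
    exact ⟨le_min (le_max_right _ _) (by norm_num), min_le_right _ _⟩
  refine ⟨⟨hpos, fun a ha => ?_⟩, ?_⟩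
  · obtain ⟨i, -, rfl⟩ := List.mem_map.mp ha
    exact ⟨hk0, (hloc i).2⟩
  have hcost : ∑ v, ∑ i : Fin (4 * k), b v i * |l v - (outputAtom k B f i).loc| ≤
      488 * M * (k + 1) ^ 2 + Z / k := by
    calc _ ≤ ∑ v : V, n⁻¹ * (488 * M * (k + 1) ^ 2 + Z * (1 / k)) := by
          refine Finset.sum_le_sum fun v _ => ?_
          calc ∑ i : Fin (4 * k), b v i * |l v - (outputAtom k B f i).loc|
              ≤ ∑ i : Fin (4 * k), n⁻¹ * ∑ c ∈ Finset.range B,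
                (|((i * B + c : ℕ) : ℝ) / M - 1 - l v| *
                  kernel k (((i * B + c : ℕ) : ℝ) / M - 1 - l v) +
                  kernel k (((i * B + c : ℕ) : ℝ) / M - 1 - l v) * (1 / k)) := by
                refine Finset.sum_le_sum fun i _ => ?_
                rw [hb]
                dsimp only
                rw [mul_assoc, Finset.sum_mul]
                refine mul_le_mul_of_nonneg_left (Finset.sum_le_sum fun c hc => ?_) (by positivity)
                rw [mul_comm |_|, ← mul_add]
                exact mul_le_mul_of_nonneg_left (abs_sub_outputAtom_loc_le hk0 f
                  (Finset.mem_range.mp hc) (hl0 v) (hl2 v)) (kernel_nonneg _ _)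
            _ = n⁻¹ * (∑ A ∈ Finset.range (4 * M), |(A : ℝ) / M - 1 - l v| *
                  kernel k (A / M - 1 - l v) +
                  (∑ A ∈ Finset.range (4 * M), kernel k (A / M - 1 - l v)) * (1 / k)) := by
                rw [← Finset.mul_sum, hsum fun A => |(A : ℝ) / M - 1 - l v| *
                  kernel k (A / M - 1 - l v) + kernel k (A / M - 1 - l v) * (1 / k),
                  Finset.sum_add_distrib, Finset.sum_mul]
            _ ≤ _ := by
                gcongr
                · exact sum_abs_mul_kernel_le hMk (hl0 v) (hl2 v)
                · exact (hbounds v).2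
      _ = 488 * M * (k + 1) ^ 2 + Z / k := by
          rw [Finset.sum_const, Finset.card_univ, nsmul_eq_mul, ← hn, mul_inv_cancel_left₀ hn0.ne',
            mul_one_div]
  -- The defect `202 M` is the spread in `sum_kernel_bounds`; `8 M` bounds `4k` atom errors of `B +
  -- 1` each. Since `Z` exceeds `M (k+1)^3 / 8`, the cost comes to at most `(8 · 489 + 1)/k`.
  have hmain := W1_le_of_kernel l (fun i : Fin (4 * k) => (outputAtom k B f i).loc)
    (p := fun _ => n⁻¹) (w := w) (b := b) (d := 2) (Z := Z) (e := 202 * M) (E := 8 * M)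
    (fun v i => by
      rw [abs_le]
      constructor <;> linarith [hl0 v, hl2 v, hloc i])
    (by norm_num)
    (by rw [Finset.sum_const, Finset.card_univ, nsmul_eq_mul, ← hn, mul_inv_cancel₀ hn0.ne'])
    hb0 hw0 hZ0 hW
    (fun v => by
      rw [hrow]
      exact mul_le_mul_of_nonneg_left (hbounds v).2 (by positivity))
    htot hE
  have hspec : spectralMeasure G = ∑ v, ENNReal.ofReal n⁻¹ • Measure.dirac (l v) := by
    rw [spectralMeasure, ENNReal.ofReal_inv_of_pos hn0, hn, ENNReal.ofReal_natCast]
  have hwW : ∀ i, w i / ∑ i, w i = ((outputAtom k B f i).mass : ℝ) /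
      ∑ j : Fin (4 * k), ((outputAtom k B f j).mass : ℝ) := fun i => by
    rw [hmass, hw]
    exact div_div_div_cancel_right₀ hS0.ne' _ _
  rw [hspec, outputMeasure_map_range _ hpos]
  simp only [hwW] at hmain
  refine hmain.trans (ENNReal.ofReal_le_ofReal ?_)
  have hk1 : (0 : ℝ) < k := by linarith
  rw [div_le_div_iff₀ hZ0 hk1]
  have h1 : (∑ v, ∑ i : Fin (4 * k), b v i * |l v - (outputAtom k B f i).loc| +
      2 * (202 * M + 2 * (8 * M))) * k ≤ (488 * M * (k + 1) ^ 2 + Z / k + 436 * M) * k := by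
    refine mul_le_mul_of_nonneg_right ?_ hk1.le
    linarith
  refine h1.trans ?_
  have h2 : (488 * M * ((k : ℝ) + 1) ^ 2 + Z / k + 436 * M) * k =
      (488 * M * ((k : ℝ) + 1) ^ 2 + 436 * M) * k + Z := by
    field_simp
    ring
  rw [h2]
  have h3 : (488 * M * ((k : ℝ) + 1) ^ 2 + 436 * M) * k ≤ 488 * M * (k + 1) ^ 3 + M * (k + 1) ^ 3 := by
    have h5 : (436 : ℝ) * k ≤ (k + 1) ^ 3 := by nlinarith [mul_pos hk1 hk1]
    have h6 : (k : ℝ) * (k + 1) ^ 2 ≤ (k + 1) ^ 3 := by nlinarith [sq_nonneg ((k : ℝ) + 1)]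
    nlinarith
  linarith

end Accuracy

/-! ### The complete program -/

section Main

variable {V : Type*} [Fintype V] [DecidableEq V] [Nonempty V] {G : SimpleGraph V}
  [DecidableRel G.Adj]

theorem step_queries_le {c c' : Config V} (h : c' ∈ (step G c).support) :
    c'.state.queries ≤ c.state.queries + 1 := by
  rcases c with ⟨_ | ⟨p, k⟩, s⟩
  · obtain rfl : c' = _ := by simpa [step] using h
    simp
  · cases p
    case randVertex a =>
      rw [step, PMF.mem_support_map_iff] at h
      obtain ⟨v, -, rfl⟩ := h
      simp
    case randNeighbor a b =>
      rw [step, PMF.mem_support_map_iff] at h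
      obtain ⟨v, -, rfl⟩ := h
      simp
    all_goals
      obtain rfl : c' = _ := by simpa [step] using h
      simp

theorem runFrom_queries_le {c c' : Config V} {T : ℕ} (h : c' ∈ (runFrom G c T).support) :
    c'.state.queries ≤ c.state.queries + T := by
  induction T generalizing c' with
  | zero =>
    obtain rfl : c' = c := by simpa [runFrom] using h
    simp
  | succ T ih =>
    rw [runFrom, PMF.mem_support_bind_iff] at h
    obtain ⟨c₁, h₁, h₂⟩ := h
    have := ih h₁
    have := step_queries_le h₂
    omega

/-- For the weight `1` the value is the probability of having halted; if this is one, no unhalted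
configuration has positive probability. -/
theorem halted_of_haltValue {c c' : Config V} {T : ℕ} (h : 1 ≤ haltValue G (fun _ => 1) c T)
    (hc : c' ∈ (runFrom G c T).support) : c'.Halted := by
  classical
  by_contra hn
  have h1 : haltValue G (fun _ => 1) c T + runFrom G c T c' ≤ 1 := by
    calc haltValue G (fun _ => 1) c T + runFrom G c T c'
        ≤ expect (runFrom G c T) (haltWeight fun _ => 1) +
          expect (runFrom G c T) (fun a => if a = c' then 1 else 0) := by
          refine add_le_add le_rfl ?_
          refine le_trans (le_of_eq ?_) (ENNReal.le_tsum c')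
          simp
      _ ≤ expect (runFrom G c T) (fun _ => 1) := by
          rw [← expect_add]
          refine expect_mono fun a _ => ?_
          rcases a with ⟨_ | ⟨p, k⟩, s⟩
          · rw [if_neg, add_zero, haltWeight]
            rintro rfl
            exact hn rfl
          · simp only [haltWeight, zero_add]
            split_ifs <;> simp
      _ = 1 := expect_const _ _
  have h2 : (1 : ℝ≥0∞) + runFrom G c T c' ≤ 1 + 0 := by
    rw [add_zero]
    exact le_trans (by gcongr) h1
  have h3 := (ENNReal.add_le_add_iff_left ENNReal.one_ne_top).mp h2
  exact ((PMF.mem_support_iff _ _).mp hc) (le_antisymm h3 zero_le)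

/-- The program: compute the parameters, estimate the return probabilities of random walks, and
evaluate the kernel. -/
def spectrumProg : Prog := .seq paramsProg (.seq momentsProg outputProg)

/-- A bound for the running time of `spectrumProg`. -/
def spectrumTime (n k B : ℕ) : ℕ :=
  (6 * n + 1000 + 2000 * k + 6 * (B * k) + 6 * (B * k) ^ 2) +
    (((8 * k + 1) * (B * (23 * (8 * k + 1) + 89) + 109) + 53) + outputTime k B + 1) + 1

/-- A union bound over `8k + 1` lengths, each failing with probability at most `2^(24k) / 2^(32k) =
256⁻ᵏ`. -/
theorem failure_bound {k : ℕ} (hk : 0 < k) :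
    ((8 * k + 1 : ℕ) : ℝ) * (((2 ^ (32 * k) : ℕ) : ℝ) / (((2 ^ (32 * k) : ℕ) : ℝ) / 4096 ^ k) ^ 2) ≤
      1 / 3 := by
  have h1 : ((2 ^ (32 * k) : ℕ) : ℝ) / (((2 ^ (32 * k) : ℕ) : ℝ) / 4096 ^ k) ^ 2 =
      1 / 256 ^ k := by
    have h2 : ((2 ^ (32 * k) : ℕ) : ℝ) = 256 ^ k * (4096 ^ k) ^ 2 := by
      push_cast
      rw [← pow_mul, mul_comm k 2, pow_mul, pow_mul, ← mul_pow]
      norm_num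
    rw [h2]
    field_simp
  rw [h1, mul_one_div, div_le_div_iff₀ (by positivity) (by norm_num), one_mul]
  have h3 : (8 * k + 1) * 3 ≤ 256 ^ k := by
    have h4 : k < 2 ^ k := Nat.lt_two_pow_self
    have h5 : (128 : ℕ) ≤ 128 ^ k := Nat.le_self_pow hk.ne' _
    calc (8 * k + 1) * 3 ≤ 2 ^ k * 128 := by omega
      _ ≤ 2 ^ k * 128 ^ k := by gcongr
      _ = 256 ^ k := by rw [← mul_pow]; norm_num
  exact_mod_cast h3

theorem kernel_scale_le {k : ℕ} (hk : 0 < k) : 12 * (k + 1) ^ 3 * 8 ^ k ≤ 2 ^ (32 * k) := by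
  have h1 : k + 1 ≤ 2 ^ k := Nat.lt_two_pow_self
  calc 12 * (k + 1) ^ 3 * 8 ^ k ≤ 2 ^ 4 * (2 ^ k) ^ 3 * (2 ^ 3) ^ k := by
        gcongr <;> norm_num
    _ = 2 ^ (4 + 6 * k) := by
        rw [← pow_mul, ← pow_mul, ← pow_add, ← pow_add]
        congr 1
        ring
    _ ≤ 2 ^ (32 * k) := Nat.pow_le_pow_right (by norm_num) (by omega)

open Classical in
theorem spectrumProg_runs (hG : ∀ v, 0 < G.degree v) {n k B : ℕ} (hn : 0 < n) (hk : k = 8192 * n)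
    (hB : B = 2 ^ (32 * k)) {h : View V} (h0 : h.var 0 = n) (hout : h.out = []) :
    ∃ ν, Runs G spectrumProg (spectrumTime n k B) h ν ∧
      2 / 3 ≤ expect ν fun v => if IsDistribution v.out ∧ v.out.length = 4 * k ∧
        W1 (spectralMeasure G) (outputMeasure v.out) ≤ ENNReal.ofReal (8192 / k) then 1 else 0 := by
  have hk0 : 0 < k := by omega
  have hBpos : (0 : ℝ) < B := by
    rw [hB]
    positivity
  obtain ⟨h₁, hr₁, hp, ho⟩ := paramsProg_triple (G := G) n hk hB h ⟨h0, hout⟩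
  obtain ⟨μ, hr₂, hsupp, hfail⟩ := momentsProg_runs (G := G) (N := B) (D := 8 * k + 1)
    (c := B / 4096 ^ k) (by positivity) hp.one hp.block hp.length
  -- The program reads only the first `8k + 1` cells as moments. Inserting exact values beyond them
  -- makes the error hypothesis of `output_accuracy` hold for all `j`.
  set f : View V → ℕ → ℝ := fun v j =>
    if j < 8 * k + 1 then (v.mem j : ℝ) else B * (returnProb G j).toReal with hf
  have hthird : ∀ v ∈ μ.support, ∃ v', Runs G outputProg (outputTime k B) v (PMF.pure v') ∧
      v'.out = (List.range (4 * k)).map (outputAtom k B (f v)) := fun v hv => by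
    obtain ⟨hvo, hvv⟩ := hsupp v hv
    have hpv : Params k B v.var := by
      constructor <;> rw [hvv _ (by norm_num)]
      exacts [hp.one, hp.order, hp.block, hp.scale, hp.length, hp.coeff₂, hp.coeff₃, hp.eight,
        hp.two]
    exact outputProg_triple hpv (m := v.mem) (fun l hl => by simp only [hf, if_pos hl]) v
      ⟨fun _ _ => rfl, fun _ _ => rfl, hvo.trans ho⟩
  choose! next hnext using hthird
  refine ⟨μ.bind fun v => PMF.pure (next v),
    hr₁.seq_pure (hr₂.seq fun v hv => (hnext v hv).1), ?_⟩
  simp only [expect_bind, expect_pure]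
  set good : View V → Prop := fun v => ∀ i < 8 * k + 1,
    |(v.mem i : ℝ) - B * (returnProb G i).toReal| ≤ B / 4096 ^ k with hgood
  have hbad : expect μ (fun v => if good v then 0 else 1) ≤ 1 / 3 := by
    refine hfail.trans ?_
    rw [← ENNReal.ofReal_natCast (8 * k + 1), ← ENNReal.ofReal_mul (by positivity)]
    have h3 : (1 / 3 : ℝ≥0∞) = ENNReal.ofReal (1 / 3) := by
      rw [ENNReal.ofReal_div_of_pos (by norm_num)]
      simp
    rw [h3, hB]
    exact ENNReal.ofReal_le_ofReal (failure_bound hk0)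
  have hsum : expect μ (fun v => if good v then 1 else 0) +
      expect μ (fun v => if good v then 0 else 1) = 1 := by
    rw [← expect_add]
    refine Eq.trans ?_ (expect_const μ 1)
    congr 1
    funext v
    split_ifs <;> simp
  have hgoodle : 2 / 3 ≤ expect μ (fun v => if good v then 1 else 0) := by
    have h1 : (1 : ℝ≥0∞) ≤ expect μ (fun v => if good v then 1 else 0) + 1 / 3 :=
      hsum.symm.le.trans (add_le_add le_rfl hbad)
    have h2 : (1 : ℝ≥0∞) = 2 / 3 + 1 / 3 := by
      rw [← ENNReal.add_div, two_add_one_eq_three,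
        ENNReal.div_self (by norm_num) (by norm_num)]
    refine (ENNReal.add_le_add_iff_right (show (1 / 3 : ℝ≥0∞) ≠ ⊤ by simp)).mp ?_
    rwa [← h2]
  refine hgoodle.trans (expect_mono fun v hv => ?_)
  by_cases hg : good v
  · have hacc := output_accuracy hG (k := k) (B := B) (f := f v) (by omega)
      (hB ▸ kernel_scale_le hk0) fun j => by
        simp only [hf]
        split_ifs with hj
        · exact hg j hj
        · rw [sub_self, abs_zero]
          positivity
    rw [if_pos hg, if_pos]
    rw [(hnext v hv).2]
    exact ⟨hacc.1, by simp, hacc.2⟩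
  · rw [if_neg hg]
    exact zero_le

/-- The time is at most a polynomial of degree `8` in `X = B k` whose coefficients sum to less than
`2^32 ≤ X`. So it is at most `X^9`, and `X ≤ 2^(33k)`. -/
theorem spectrumTime_le {n k B : ℕ} (hn : 0 < n) (hk : k = 8192 * n) (hB : B = 2 ^ (32 * k)) :
    spectrumTime n k B ≤ 2 ^ (297 * k) := by
  have hk0 : 0 < k := by omega
  have hB0 : 0 < B := by rw [hB]; positivity
  have hX : 2 ^ 32 ≤ B * k := by
    calc 2 ^ 32 ≤ 2 ^ (32 * k) := Nat.pow_le_pow_right (by norm_num) (by omega)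
      _ ≤ B * k := by rw [hB]; exact Nat.le_mul_of_pos_right _ hk0
  have hX' : B * k ≤ 2 ^ (33 * k) := by
    calc B * k ≤ 2 ^ (32 * k) * 2 ^ k := by
          rw [hB]
          gcongr
          exact Nat.lt_two_pow_self.le
      _ = 2 ^ (33 * k) := by rw [← pow_add]; congr 1; ring
  have hkX : k ≤ B * k := Nat.le_mul_of_pos_left _ hB0
  have hBX : B ≤ B * k := Nat.le_mul_of_pos_right _ hk0
  have hnX : n ≤ B * k := by omega
  have hDX : 8 * k + 1 ≤ 9 * (B * k) := by omega
  rw [spectrumTime, outputTime, gridTime]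
  generalize B * k = X at *
  have hX1 : 1 ≤ X := by omega
  have hp : ∀ i j, i ≤ j → X ^ i ≤ X ^ j := fun i j hij => Nat.pow_le_pow_right hX1 hij
  have hgrid : 4 * (k * ((8 * k + 1) * (6 * (40 * X ^ 4) + 300) + 130) + (8 * k + 1) * 90 + 200) +
      (8 * k + 1) * 90 + 500 + 24 * X ≤ 26000 * X ^ 6 := by
    calc _ ≤ 4 * (X * (9 * X * (6 * (40 * X ^ 4) + 300) + 130) + 9 * X * 90 + 200) +
          9 * X * 90 + 500 + 24 * X := by gcongr
      _ = 8640 * X ^ 6 + 10800 * X ^ 2 + 4594 * X ^ 1 + 1300 * X ^ 0 := by ring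
      _ ≤ 8640 * X ^ 6 + 10800 * X ^ 6 + 4594 * X ^ 6 + 1300 * X ^ 6 := by
          gcongr <;> first | exact hX1 | norm_num
      _ ≤ _ := by omega
  calc _ ≤ (6 * X + 1000 + 2000 * X + 6 * X + 6 * X ^ 2) +
        ((9 * X * (X * (23 * (9 * X) + 89) + 109) + 53) +
          (4 * X * (X * (26000 * X ^ 6 + 4) + 204) + 100) + 1) + 1 := by gcongr
    _ = 104000 * X ^ 8 + 1863 * X ^ 3 + 823 * X ^ 2 + 3809 * X ^ 1 + 1155 * X ^ 0 := by ring
    _ ≤ 104000 * X ^ 8 + 1863 * X ^ 8 + 823 * X ^ 8 + 3809 * X ^ 8 + 1155 * X ^ 8 := by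
        gcongr <;> first | exact hX1 | norm_num
    _ ≤ X * X ^ 8 := by nlinarith [hp 0 8 (by norm_num)]
    _ = X ^ 9 := by ring
    _ ≤ (2 ^ (33 * k)) ^ 9 := by gcongr
    _ = 2 ^ (297 * k) := by
        rw [← pow_mul]
        congr 1
        ring

end Main

end GraphSpectrum

theorem theorem1 :
    ∃ (P : GraphSpectrum.Prog) (C : ℝ), 0 < C ∧
      ∀ ε : ℝ, 0 < ε → ε ≤ 2 →
        ∀ (V : Type*) [Fintype V] [DecidableEq V] [Nonempty V]
          (G : SimpleGraph V) [DecidableRel G.Adj], (∀ v, 0 < G.degree v) →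
          (∀ c ∈ (GraphSpectrum.run G P ⌈1 / ε⌉₊ ⌊Real.exp (C / ε)⌋₊).support,
            c.Halted ∧ (c.state.queries : ℝ) ≤ Real.exp (C / ε)) ∧
          2 / 3 ≤ (GraphSpectrum.run G P ⌈1 / ε⌉₊ ⌊Real.exp (C / ε)⌋₊).toOuterMeasure
            {c | GraphSpectrum.IsDistribution c.state.out ∧
              (c.state.out.length : ℝ) ≤ C / ε ∧
              GraphSpectrum.W1 (GraphSpectrum.spectralMeasure G)
                (GraphSpectrum.outputMeasure c.state.out) ≤ ENNReal.ofReal ε} := by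
  classical
  -- The time is at most `2^(297k) ≤ e^(297k)` with `k = 8192 n`, and `n ≤ 3/ε` because `ε ≤ 2`.
  refine ⟨GraphSpectrum.spectrumProg, 3 * (297 * 8192), by norm_num, fun ε hε hε2 V _ _ _ G _ hG => ?_⟩
  set n := ⌈1 / ε⌉₊ with hn
  have hn0 : 0 < n := Nat.ceil_pos.mpr (by positivity)
  have hn1 : 1 / ε ≤ n := Nat.le_ceil _
  have hn3 : (n : ℝ) ≤ 3 / ε := by
    have h1 : (n : ℝ) < 1 / ε + 1 := Nat.ceil_lt_add_one (by positivity)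
    have h2 : 1 ≤ 2 / ε := by rwa [le_div_iff₀ hε, one_mul]
    have h3 : (3 : ℝ) / ε = 1 / ε + 2 / ε := by ring
    linarith
  set k := 8192 * n with hk
  set B := 2 ^ (32 * k) with hB
  set T := ⌊Real.exp (3 * (297 * 8192) / ε)⌋₊ with hT
  have htime : GraphSpectrum.spectrumTime n k B ≤ T := by
    refine Nat.le_floor ?_
    calc (GraphSpectrum.spectrumTime n k B : ℝ) ≤ (2 ^ (297 * k) : ℕ) := by
          exact_mod_cast GraphSpectrum.spectrumTime_le hn0 hk hB
      _ = 2 ^ (297 * k) := by push_cast; rfl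
      _ ≤ Real.exp 1 ^ (297 * k) := by
          gcongr
          linarith [Real.add_one_le_exp 1]
      _ = Real.exp (297 * k : ℕ) := by rw [← Real.exp_nat_mul, mul_one]
      _ ≤ _ := by
          gcongr
          rw [hk]
          push_cast
          calc (297 : ℝ) * (8192 * n) ≤ 297 * (8192 * (3 / ε)) := by gcongr
            _ = _ := by ring
  obtain ⟨ν, hruns, hν⟩ := GraphSpectrum.spectrumProg_runs hG hn0 hk hB
    (h := (GraphSpectrum.State.init V n).view)
    (by simp [GraphSpectrum.State.view, GraphSpectrum.State.init]) rfl
  -- With an empty continuation and no time left, the specification bounds expectations at the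
  -- halted state itself. It is used for `Φ = 1` and for the indicator of success.
  have hvalue : ∀ Φ : GraphSpectrum.View V → ℝ≥0∞, GraphSpectrum.expect ν Φ ≤
      GraphSpectrum.haltValue G (fun s => Φ s.view)
        ⟨[GraphSpectrum.spectrumProg], GraphSpectrum.State.init V n⟩ T := fun Φ => by
    refine le_trans (hruns (fun s => Φ s.view) [] 0 Φ (fun s => ?_) _ rfl)
      (GraphSpectrum.haltValue_mono G _ _ (by omega))
    rw [GraphSpectrum.haltValue_zero, GraphSpectrum.haltWeight]
  refine ⟨fun c hc => ⟨?_, ?_⟩, ?_⟩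
  · refine GraphSpectrum.halted_of_haltValue ?_ hc
    exact (GraphSpectrum.expect_const ν 1).symm.le.trans (hvalue fun _ => 1)
  · have h1 := GraphSpectrum.runFrom_queries_le hc
    have h2 : c.state.queries ≤ T := by simpa [GraphSpectrum.State.init] using h1
    calc (c.state.queries : ℝ) ≤ T := by exact_mod_cast h2
      _ ≤ _ := Nat.floor_le (Real.exp_pos _).le
  · refine hν.trans ((hvalue _).trans ?_)
    rw [GraphSpectrum.toOuterMeasure_eq_expect]
    refine GraphSpectrum.expect_mono fun c _ => ?_
    rcases c with ⟨_ | ⟨p, l⟩, s⟩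
    · rw [GraphSpectrum.haltWeight]
      split_ifs with h1 h2 h2
      · exact le_rfl
      · refine absurd ?_ h2
        obtain ⟨hd, hlen, hw⟩ := h1
        refine ⟨hd, ?_, hw.trans (ENNReal.ofReal_le_ofReal ?_)⟩
        · change (s.out.length : ℝ) ≤ _
          have hlen' : s.out.length = 4 * k := hlen
          rw [hlen', hk]
          push_cast
          calc (4 : ℝ) * (8192 * n) ≤ 4 * (8192 * (3 / ε)) := by gcongr
            _ = 98304 / ε := by ring
            _ ≤ _ := by gcongr; norm_num
        · rw [hk]
          push_cast
          have hn' : (0 : ℝ) < n := by exact_mod_cast hn0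
          rw [div_mul_cancel_left₀ (by norm_num), inv_le_comm₀ hn' hε, ← one_div]
          exact hn1
      · exact zero_le
      · exact le_rfl
    · exact zero_le
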